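/- Write $\nabla^\perp=(-\partial_2,\partial_1)$ on $\mathbb R^2$, and let $K(x,y)=\frac1{2\pi}\nabla_x^\perp\log|x-y|$. For $\alpha>0$ let $K^\alpha(x,y)=\nabla_x^\perp G^\alpha(|x-y|)$ with $G^\alpha(r)=\frac1{2\pi}\bigl(K_0(r/\alpha)+\log r\bigr)$, where $K_0(r)=\int_0^\infty e^{-r\cosh t}\,dt$ is the modified Bessel function of the second kind of order zero, and set $K^\alpha(x,x)=0$ (the continuous extension). Let $\mathcal G$ be the group of homeomorphisms of $\mathbb R^2$ that preserve Lebesgue measure, and $\mathcal M(\mathbb R^2)$ the space of finite signed Borel (Radon) measures on $\mathbb R^2$ with the total variation norm $\|\cdot\|_{\mathcal M}$. A flow map of the Euler equations with initial vorticity $\omega_0$ is a family $\eta(\cdot,t)\in\mathcal G$, $t\in\mathbb R$, with $\eta(x,0)=x$ and $$\partial_t\eta(x,t)=\int_{\mathbb R^2}K(\eta(x,t),\eta(y,t))\,\omega_0(y)\,dy \qquad(x\in\mathbb R^2,\ t\in\mathbb R).$$ A flow map of the vortex blob method with parameter $\alpha>0$ and initial data $q_0\in\mathcal M(\mathbb R^2)$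 is a family $\eta^\alpha(\cdot,t)\in\mathcal G$, $t\in\mathbb R$, with $\eta^\alpha(x,0)=x$ and $$\partial_t\eta^\alpha(x,t)=\int_{\mathbb R^2}K^\alpha(\eta^\alpha(x,t),\eta^\alpha(y,t))\,dq_0(y) \qquad(x\in\mathbb R^2,\ t\in\mathbb R).$$ Theorem. Let $\omega_0\in L^1(\mathbb R^2)\cap L^\infty(\mathbb R^2)$ and let $\eta$ be the flow map of the Euler equations with initial vorticity $\omega_0$. Let $(q_0^n)_{n\in\mathbb N}$ be a sequence in $\mathcal M(\mathbb R^2)$ such that $q_0^n\rightharpoonup\omega_0$ weakly, i.e. $\int\phi\,dq_0^n\to\int\phi\,\omega_0\,dx$ for every continuous compactly supported $\phi:\mathbb R^2\to\mathbb R$, and $\|q_0^n\|_{\mathcal M}\to\|\omega_0\|_{L^1}$. Then for every $T>0$ there exists a sequence $\alpha_n>0$ with $\alpha_n\to0$ such that for every $n$ the vortex blob method with $\alpha=\alpha_n$ and initial data $q_0^n$ has exactly one flow map $\eta^{\alpha_n}$, and $$\lim_{n\to\infty}\ \sup_{t\in[0,T]}\ \sup_{x\in\mathbb R^2} \bigl|\eta^{\alpha_n}(x,t)-\eta(x,t)\bigr|=0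 .$$ -/

import Mathlib

open MeasureTheory Filter Topology

noncomputable section

/-- The Euclidean plane `ℝ²`. -/
abbrev Plane : Type := EuclideanSpace ℝ (Fin 2)

/-- The perpendicular gradient `∇^⊥ f = (-∂₂ f, ∂₁ f)`. -/
def perpGrad (f : Plane → ℝ) (x : Plane) : Plane :=
  !₂[-(fderiv ℝ f x (EuclideanSpace.single 1 1)), fderiv ℝ f x (EuclideanSpace.single 0 1)]

/-- The Euler (Biot–Savart) kernel `K(x, y) = (1 / 2π) ∇^⊥ log |x - y|`, the gradient being taken
in `x`. On the diagonal the value is `0`; for the integrals below this is a null set. -/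
def eulerKernel (x y : Plane) : Plane :=
  perpGrad (fun z => 1 / (2 * Real.pi) * Real.log ‖z - y‖) x

/-- The modified Bessel function of the second kind of order zero,
`K₀(r) = ∫₀^∞ exp (-r cosh t) dt` for `r > 0`. -/
def besselK0 (r : ℝ) : ℝ :=
  ∫ t in Set.Ioi (0 : ℝ), Real.exp (-(r * Real.cosh t))

/-- The radial profile `G^α(r) = (1 / 2π) (K₀(r / α) + log r)`, `r > 0`. The function
`x ↦ G^α(|x|)` is the Green's function of `(1 - α² Δ) Δ`, that is
`Δ G^α = (1 / (2π α²)) K₀(|x| / α)`. -/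
def blobGreen (α r : ℝ) : ℝ :=
  1 / (2 * Real.pi) * (besselK0 (r / α) + Real.log r)

/-- The kernel `K^α(x, y) = ∇^⊥ G^α(|x - y|)` of the vortex blob method, the gradient being taken
in `x`. A radial function has zero `fderiv` at its centre, so `K^α(x, x) = 0`, which is the
continuous extension of `K^α` to the diagonal. -/
def blobKernel (α : ℝ) (x y : Plane) : Plane :=
  perpGrad (fun z => blobGreen α ‖z - y‖) x

/-- `η` is a flow map of the Euler equations with initial vorticity `ω₀`: a curve of Lebesgue
measure preserving homeomorphisms of the plane, equal to the identity at time zero, with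
`∂ₜ η(x, t) = ∫ K(η(x, t), η(y, t)) ω₀(y) dy` for all `x` and `t`. -/
structure IsEulerFlow (ω₀ : Plane → ℝ) (η : ℝ → Plane ≃ₜ Plane) : Prop where
  measurePreserving : ∀ t, MeasurePreserving (η t) volume volume
  initial : ∀ x, η 0 x = x
  hasDerivAt : ∀ x t,
    HasDerivAt (fun s => η s x) (∫ y, ω₀ y • eulerKernel (η t x) (η t y)) t

/-- `η` is a flow map of the vortex blob method with parameter `α` whose initial datum is the
finite signed Borel measure `q₀`: a curve of Lebesgue measure preserving homeomorphisms of the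
plane, equal to the identity at time zero, with
`∂ₜ η(x, t) = ∫ K^α(η(x, t), η(y, t)) dq₀(y)` for all `x` and `t`. -/
structure IsBlobFlow (α : ℝ) (q₀ : SignedMeasure Plane) (η : ℝ → Plane ≃ₜ Plane) : Prop where
  measurePreserving : ∀ t, MeasurePreserving (η t) volume volume
  initial : ∀ x, η 0 x = x
  hasDerivAt : ∀ x t,
    HasDerivAt (fun s => η s x)
      (q₀.integral (fun y => blobKernel α (η t x) (η t y)) (ContinuousLinearMap.lsmul ℝ ℝ).flip) t

/-- Weak convergence of the finite signed measures `q n` to the measure `ω₀ dx`, tested on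
continuous compactly supported functions. (When the total variations are bounded this is the same
as testing on continuous functions vanishing at infinity.) -/
def WeaklyConvergesTo (q : ℕ → SignedMeasure Plane) (ω₀ : Plane → ℝ) : Prop :=
  ∀ φ : Plane → ℝ, Continuous φ → HasCompactSupport φ →
    Tendsto (fun n => (q n).integral φ (ContinuousLinearMap.lsmul ℝ ℝ)) atTop
      (𝓝 (∫ x, φ x * ω₀ x))

end

open scoped BoundedContinuousFunction

noncomputable section

/-! A flow is the identity plus a bounded displacement, so the blob equation is an autonomous
differential equation in the Banach space `Disp` with vector field `lagField`. The blob kernel, and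
the Biot–Savart integral of a bounded integrable vorticity, have a log-Lipschitz modulus. Osgood's
argument (`osgood_uniform`) turns this into stability: curves that start together and whose
velocities differ by a vanishing error stay together, uniformly on bounded time intervals.

The distance from the blob flow of `q₀ n` to the Euler flow is split at the blob flow of ω₀ itself.
For fixed α the first part vanishes as n → ∞ (`PairConverges.disp_uniform`): convergence of the
total variations prevents mass from escaping to infinity or cancelling, so the velocities converge
uniformly. The second part vanishes as α → 0 (`blobFlowDisp_tendsto_euler`): the constants of the
blob kernel blow up there, but the modulus of the Euler velocity depends only on norms of ω₀,
because both flows preserve area. Letting α decrease slowly with n (`exists_diagonal`) combines the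
two.

Well-posedness of the blob method and the kernel bounds rest on writing K₀ as an integral that
exhibits K^α as a positive superposition of Gaussian vortices. Dropping the narrowest ones leaves a
divergence-free kernel with bounded derivative, for which Picard–Lindelöf applies; Osgood stability
passes to the limit. An explicit Euler step along a divergence-free field changes the Jacobian only
to second order, so the flow does not decrease areas of compact sets. The inverse map is again such
a flow, so areas are preserved (`measurePreserving_flow`). -/

/-- A log-Lipschitz modulus of continuity, written as a family of affine functions: the infimum
over `N` is of order `d * (1 + |log d|)` for small `d`. -/
def logMod (N : ℕ) (d : ℝ) : ℝ := (N + 1) * d + Real.exp (-N)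

lemma logMod_nonneg (N : ℕ) {d : ℝ} (hd : 0 ≤ d) : 0 ≤ logMod N d := by
  unfold logMod; positivity

lemma logMod_mono (N : ℕ) {d e : ℝ} (h : d ≤ e) : logMod N d ≤ logMod N e := by
  unfold logMod; gcongr

lemma logMod_le_mul (N : ℕ) {d c : ℝ} (hc : 1 ≤ c) :
    logMod N (c * d) ≤ c * logMod N d := by
  unfold logMod
  nlinarith [Real.exp_pos (-(N : ℝ))]

lemma exists_exp_neg_nat_le {ε : ℝ} (hε : 0 < ε) : ∃ N : ℕ, Real.exp (-(N : ℝ)) ≤ ε := by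
  have h : Tendsto (fun N : ℕ => Real.exp (-(N : ℝ))) atTop (𝓝 0) :=
    Real.tendsto_exp_neg_atTop_nhds_zero.comp tendsto_natCast_atTop_atTop
  exact (h.eventually (Iic_mem_nhds hε)).exists

/-- A quantity controlled by the log-Lipschitz modulus of something small is small. -/
lemma exists_logMod_le {C ε : ℝ} (hC : 0 ≤ C) (hε : 0 < ε) :
    ∃ δ > 0, ∃ N : ℕ, ∀ d ≤ δ, C * logMod N d ≤ ε := by
  obtain ⟨N, hN⟩ := exists_exp_neg_nat_le (ε := ε / (2 * (C + 1))) (by positivity)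
  refine ⟨ε / (2 * (C + 1) * (N + 1)), by positivity, N, fun d hd => ?_⟩
  have h1 : ((N : ℝ) + 1) * d ≤ ε / (2 * (C + 1)) := by
    calc ((N : ℝ) + 1) * d ≤ (N + 1) * (ε / (2 * (C + 1) * (N + 1))) := by gcongr
      _ = ε / (2 * (C + 1)) := by field_simp
  calc C * logMod N d ≤ C * (ε / (2 * (C + 1)) + ε / (2 * (C + 1))) := by
        unfold logMod; gcongr
    _ = ε * (C / (C + 1)) := by field_simp; ring
    _ ≤ ε * 1 := by gcongr; rw [div_le_one (by positivity)]; linarith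
    _ = ε := mul_one _

lemma gronwallBound_le {δ K ε x h : ℝ} (hK : 0 < K) (hδ : 0 ≤ δ) (hε : 0 ≤ ε) (hx : x ≤ h) :
    gronwallBound δ K ε x ≤ (δ + ε / K) * Real.exp (K * h) := by
  rw [gronwallBound_of_K_ne_0 hK.ne']
  have h1 : Real.exp (K * x) ≤ Real.exp (K * h) := by gcongr
  have h2 : 0 ≤ ε / K := by positivity
  nlinarith

/-! ### Osgood stability and differential equations in a Banach space -/

section Osgood

variable {B : Type*} [NormedAddCommGroup B] [NormedSpace ℝ B]

/-- **Osgood stability.** A family of curves with asymptotically vanishing initial values, whose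
velocities are controlled by a log-Lipschitz modulus up to an asymptotically vanishing error,
tends to zero uniformly on bounded time intervals. -/
theorem osgood_uniform {ι : Type*} {l : Filter ι} {C T : ℝ} (hC : 0 < C)
    {f f' : ι → ℝ → B} {δ : ι → ℝ} (hδ : Tendsto δ l (𝓝 0))
    (h0 : Tendsto (fun i => ‖f i 0‖) l (𝓝 0))
    (hf : ∀ᶠ i in l, ∀ t ∈ Set.Icc 0 T, HasDerivAt (f i) (f' i t) t)
    (hb : ∀ᶠ i in l, ∀ t ∈ Set.Icc 0 T, ∀ N : ℕ, ‖f' i t‖ ≤ C * logMod N ‖f i t‖ + δ i)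
    {ε : ℝ} (hε : 0 < ε) :
    ∀ᶠ i in l, ∀ t ∈ Set.Icc 0 T, ‖f i t‖ ≤ ε := by
  -- Over a time 1/(2C), Grönwall with slope C(N + 1) amplifies by e^((N + 1)/2), which the
  -- remainder e^(-N) of the modulus still beats. Time is covered by such steps, each starting from
  -- the smallness obtained in the previous one.
  set h : ℝ := 1 / (2 * C) with hh
  have hpos : 0 < h := by positivity
  suffices H : ∀ k : ℕ, ∀ ε > 0, ∀ᶠ i in l, ∀ t ∈ Set.Icc 0 T, t ≤ k * h → ‖f i t‖ ≤ ε by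
    obtain ⟨k, hk⟩ := exists_nat_ge (T / h)
    filter_upwards [H k ε hε] with i hi t ht
    exact hi t ht (ht.2.trans ((div_le_iff₀ hpos).1 hk))
  intro k
  induction k with
  | zero =>
    intro ε hε
    filter_upwards [h0.eventually (Iic_mem_nhds hε)] with i hi t ht ht0
    have : t = 0 := le_antisymm (by simpa using ht0) ht.1
    simpa [this] using hi
  | succ k ih =>
    intro ε hε
    obtain ⟨M, hM⟩ := exists_exp_neg_nat_le (ε := ε / 3) (by positivity)
    -- For this N the remainder times the amplification is exactly exp(-M).
    set N : ℕ := 2 * M + 1 with hN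
    set e : ℝ := Real.exp (((N : ℝ) + 1) / 2) with he
    have hepos : 0 < e := Real.exp_pos _
    have hNe : Real.exp (-(N : ℝ)) * e ≤ ε / 3 := by
      rw [he, ← Real.exp_add]
      refine le_trans (Real.exp_le_exp.2 (le_of_eq ?_)) hM
      rw [hN]; push_cast; ring
    have hη : 0 < ε / (3 * e) := by positivity
    have hδ' : ∀ᶠ i in l, |δ i| / C ≤ ε / (3 * e) := by
      have : Tendsto (fun i => |δ i| / C) l (𝓝 0) := by
        simpa using (hδ.abs).div_const C
      exact this.eventually (Iic_mem_nhds hη)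
    -- The induction hypothesis is used at ε for the earlier times, and at the smaller tolerance for
    -- the starting value of the new step.
    filter_upwards [ih ε hε, ih _ hη, hδ', hf, hb] with i h1 h2 h3 h4 h5 t ht htk
    rcases le_or_gt t (k * h) with hle | hgt
    · exact h1 t ht hle
    have ha0 : 0 ≤ (k : ℝ) * h := by positivity
    have hsub : ∀ s ∈ Set.Icc (k * h) t, s ∈ Set.Icc 0 T := fun s hs =>
      ⟨ha0.trans hs.1, hs.2.trans ht.2⟩
    have hK : 0 < C * ((N : ℝ) + 1) := by positivity
    have hG := norm_le_gronwallBound_of_norm_deriv_right_le (f := f i) (f' := f' i)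
      (δ := ‖f i (k * h)‖) (K := C * (N + 1)) (ε := C * Real.exp (-N) + |δ i|)
      (a := k * h) (b := t)
      (fun s hs => (h4 s (hsub s hs)).continuousAt.continuousWithinAt)
      (fun s hs => (h4 s (hsub s ⟨hs.1, hs.2.le⟩)).hasDerivWithinAt) le_rfl
      (fun s hs => by
        have := h5 s (hsub s ⟨hs.1, hs.2.le⟩) N
        unfold logMod at this
        have h6 := le_abs_self (δ i)
        linarith) t ⟨hgt.le, le_rfl⟩
    refine hG.trans ((gronwallBound_le (h := h) hK (norm_nonneg _) (by positivity) ?_).trans ?_)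
    · push_cast at htk; linarith
    have hexp : Real.exp (C * (N + 1) * h) = e := by
      rw [he, hh]; congr 1; field_simp
    rw [hexp]
    have h7 : ‖f i (k * h)‖ ≤ ε / (3 * e) := h2 _ (hsub _ ⟨le_rfl, hgt.le⟩) le_rfl
    have h8 : (C * Real.exp (-N) + |δ i|) / (C * (N + 1)) ≤ Real.exp (-N) + |δ i| / C := by
      rw [div_le_iff₀ hK]
      have : |δ i| / C * C = |δ i| := by field_simp
      have h9 : 0 ≤ |δ i| / C := by positivity
      have h10 := Real.exp_pos (-(N : ℝ))
      have : (Real.exp (-N) + |δ i| / C) * (C * (N + 1)) =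
        C * Real.exp (-N) + |δ i| / C * C + N * (C * Real.exp (-N) + |δ i| / C * C) := by ring
      rw [this]
      have : 0 ≤ N * (C * Real.exp (-N) + |δ i| / C * C) := by positivity
      linarith
    calc (‖f i (k * h)‖ + (C * Real.exp (-N) + |δ i|) / (C * (N + 1))) * e
        ≤ (ε / (3 * e) + (Real.exp (-N) + ε / (3 * e))) * e := by gcongr; linarith
      _ = 2 * ε / 3 + Real.exp (-N) * e := by field_simp; ring
      _ ≤ ε := by linarith

/-- Two-sided version of `osgood_uniform`. -/
theorem osgood_uniform_two_sided {ι : Type*} {l : Filter ι} {C : ℝ} (hC : 0 < C)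
    {f f' : ι → ℝ → B} {δ : ι → ℝ} (hδ : Tendsto δ l (𝓝 0))
    (h0 : Tendsto (fun i => ‖f i 0‖) l (𝓝 0))
    (hf : ∀ i t, HasDerivAt (f i) (f' i t) t)
    (hb : ∀ i t, ∀ N : ℕ, ‖f' i t‖ ≤ C * logMod N ‖f i t‖ + δ i) (T : ℝ)
    {ε : ℝ} (hε : 0 < ε) :
    ∀ᶠ i in l, ∀ t, |t| ≤ T → ‖f i t‖ ≤ ε := by
  have h1 := osgood_uniform (T := T) hC hδ h0 (.of_forall fun i t _ => hf i t)
    (.of_forall fun i t _ => hb i t) hε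
  have h2 := osgood_uniform (T := T) (f := fun i t => f i (-t)) (f' := fun i t => -f' i (-t))
    hC hδ (by simpa using h0)
    (.of_forall fun i t _ => by
      have h1 : HasDerivAt (fun s : ℝ => -s) (-1) t := hasDerivAt_neg t
      simpa [Function.comp_def] using (hf i (-t)).scomp t h1)
    (.of_forall fun i t _ N => by simpa using hb i (-t) N) hε
  filter_upwards [h1, h2] with i h1 h2 t ht
  rcases abs_le.1 ht with ⟨h3, h4⟩
  rcases le_total 0 t with h | h
  · exact h1 t ⟨h, h4⟩
  · simpa using h2 (-t) ⟨by linarith, by linarith⟩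

/-- Solutions of an ordinary differential equation with log-Lipschitz right-hand side are
unique. -/
theorem logLipschitz_ode_unique {C : ℝ} (hC : 0 < C) {F : B → B}
    (hF : ∀ N X Y, ‖F X - F Y‖ ≤ C * logMod N ‖X - Y‖) {X Y : ℝ → B}
    (hX : ∀ t, HasDerivAt X (F (X t)) t) (hY : ∀ t, HasDerivAt Y (F (Y t)) t)
    (h0 : X 0 = Y 0) : X = Y := by
  funext t
  rw [← sub_eq_zero, ← norm_le_zero_iff]
  refine le_of_forall_pos_le_add fun ε hε => ?_
  -- A family over a one-point index with zero error turns the asymptotic statement into a bound by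
  -- every ε.
  have := osgood_uniform_two_sided (ι := Unit) (l := ⊤) hC (f := fun _ t => X t - Y t)
    (f' := fun _ t => F (X t) - F (Y t)) (δ := fun _ => 0) tendsto_const_nhds
    (by simp [h0]) (fun _ t => (hX t).sub (hY t)) (fun _ t N => by simpa using hF N _ _) |t| hε
  simpa using this.exists.choose_spec t le_rfl

/-- Convergence of the explicit Euler scheme for a bounded Lipschitz vector field. -/
theorem tendsto_euler_scheme {G : B → B} {L : NNReal} (hL : LipschitzWith L G)
    {M : ℝ} (hM : ∀ X, ‖G X‖ ≤ M) {X : ℝ → B} (hX : ∀ t, HasDerivAt X (G (X t)) t) (t : ℝ) :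
    Tendsto (fun n : ℕ => (fun Y => Y + (t / (n + 1)) • G Y)^[n + 1] (X 0)) atTop (𝓝 (X t)) := by
  have hM0 : 0 ≤ M := (norm_nonneg _).trans (hM (X 0))
  have hlip : ∀ a b, ‖X b - X a‖ ≤ M * |b - a| := fun a b => by
    simpa using Convex.norm_image_sub_le_of_norm_hasDerivWithin_le (s := Set.univ)
      (fun x _ => (hX x).hasDerivWithinAt) (fun x _ => hM _) convex_univ (Set.mem_univ a)
      (Set.mem_univ b)
  -- Local truncation error: X is M-Lipschitz, so G varies by at most L M |s| along the solution
  -- during one step.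
  have hstep : ∀ a s : ℝ, ‖X (a + s) - X a - s • G (X a)‖ ≤ L * M * s ^ 2 := by
    intro a s
    have h1 : ∀ x, HasDerivAt (fun r => X r - r • G (X a)) (G (X x) - G (X a)) x := fun x => by
      simpa using (hX x).fun_sub ((hasDerivAt_id x).smul_const (G (X a)))
    have h2 := Convex.norm_image_sub_le_of_norm_hasDerivWithin_le (s := Set.uIcc a (a + s))
      (C := L * (M * |s|)) (fun x _ => (h1 x).hasDerivWithinAt) (fun x hx => by
        have h3 := hL.dist_le_mul (X x) (X a)
        rw [dist_eq_norm, dist_eq_norm] at h3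
        refine h3.trans ?_
        gcongr
        refine (hlip a x).trans (mul_le_mul_of_nonneg_left ?_ hM0)
        simpa using Set.abs_sub_left_of_mem_uIcc hx) (convex_uIcc a (a + s))
        Set.left_mem_uIcc Set.right_mem_uIcc
    have h4 : X (a + s) - (a + s) • G (X a) - (X a - a • G (X a)) =
        X (a + s) - X a - s • G (X a) := by
      rw [add_smul]; abel
    rw [h4] at h2
    refine h2.trans (le_of_eq ?_)
    have : a + s - a = s := by ring
    rw [this, Real.norm_eq_abs, ← sq_abs s]
    ring
  -- Discrete Grönwall sums n + 1 local errors of order (t/(n + 1))², amplified in total by at most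
  -- exp(L |t|).
  have herr : ∀ n : ℕ, ‖(fun Y => Y + (t / (n + 1)) • G Y)^[n + 1] (X 0) - X t‖ ≤
      L * M * t ^ 2 * Real.exp (L * |t|) / (n + 1) := by
    intro n
    set s : ℝ := t / (n + 1) with hs
    have hn : (0 : ℝ) < n + 1 := by positivity
    have hns : ((n : ℝ) + 1) * s = t := by rw [hs]; field_simp
    have hD := discrete_gronwall (n₀ := 0) (n := n + 1)
      (u := fun j => ‖(fun Y => Y + s • G Y)^[j] (X 0) - X (j * s)‖)
      (c := fun _ => |s| * L) (b := fun _ => L * M * s ^ 2) (by simp) (fun j _ => by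
        simp only [Function.iterate_succ_apply']
        set Y := (fun Y => Y + s • G Y)^[j] (X 0)
        have h1 := hstep (j * s) s
        have h2 := hL.dist_le_mul Y (X (j * s))
        rw [dist_eq_norm, dist_eq_norm] at h2
        have h3 : X (((j + 1 : ℕ) : ℝ) * s) = X (j * s + s) := by congr 1; push_cast; ring
        rw [h3]
        calc ‖Y + s • G Y - X (j * s + s)‖
            = ‖(Y - X (j * s)) + s • (G Y - G (X (j * s))) +
              -(X (j * s + s) - X (j * s) - s • G (X (j * s)))‖ := by
              congr 1; rw [smul_sub]; abel
          _ ≤ _ := norm_add₃_le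
          _ ≤ ‖Y - X (j * s)‖ + |s| * (L * ‖Y - X (j * s)‖) + L * M * s ^ 2 := by
              rw [norm_neg, norm_smul, Real.norm_eq_abs]
              gcongr
          _ = _ := by ring) (fun _ _ => by positivity) (fun _ _ => by positivity) (Nat.zero_le _)
    simp only [Function.iterate_zero, id_eq, Nat.cast_zero, zero_mul, sub_self, norm_zero,
      zero_add, Finset.sum_const, Nat.card_Ico, nsmul_eq_mul, tsub_zero] at hD
    push_cast at hD
    rw [hns] at hD
    refine hD.trans (le_of_eq ?_)
    have h5 : ((n : ℝ) + 1) * (|s| * L) = L * |t| := by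
      rw [← hns, abs_mul, abs_of_pos hn]; ring
    rw [h5, hs]
    field_simp
  rw [tendsto_iff_norm_sub_tendsto_zero]
  refine squeeze_zero (fun _ => norm_nonneg _) herr ?_
  exact tendsto_const_nhds.div_atTop
    (tendsto_atTop_add_const_right _ _ tendsto_natCast_atTop_atTop)

variable [CompleteSpace B]

/-- Global existence for bounded Lipschitz vector fields. -/
theorem exists_global_solution_of_lipschitz {G : B → B} {L : NNReal} (hL : LipschitzWith L G)
    {M : ℝ} (hM : ∀ X, ‖G X‖ ≤ M) (X₀ : B) :
    ∃ X : ℝ → B, X 0 = X₀ ∧ ∀ t, HasDerivAt X (G (X t)) t := by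
  have hM0 : 0 ≤ M := (norm_nonneg _).trans (hM X₀)
  have hloc : ∀ n : ℕ, ∃ X : ℝ → B, X 0 = X₀ ∧
      ∀ t ∈ Set.Ioo (-((n : ℝ) + 1)) (n + 1), HasDerivAt X (G (X t)) t := by
    intro n
    have hmem : (0 : ℝ) ∈ Set.Icc (-((n : ℝ) + 1)) (n + 1) := by
      constructor <;> linarith [(n.cast_nonneg : (0 : ℝ) ≤ n)]
    -- A ball of radius M(n + 1) contains whatever a solution can reach in this interval, so local
    -- existence already covers all of it.
    have hP : IsPicardLindelof (fun _ => G) (⟨0, hmem⟩ : Set.Icc (-((n : ℝ) + 1)) (n + 1)) X₀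
        (M.toNNReal * (n + 1)) 0 M.toNNReal L := by
      refine ⟨fun _ _ => hL.lipschitzOnWith, fun _ _ => continuousOn_const,
        fun _ _ X _ => (hM X).trans (Real.le_coe_toNNReal M), ?_⟩
      simp
    obtain ⟨X, h0, hX⟩ := hP.exists_eq_forall_mem_Icc_hasDerivWithinAt₀
    exact ⟨X, h0, fun t ht => (hX t ⟨ht.1.le, ht.2.le⟩).hasDerivAt (Icc_mem_nhds ht.1 ht.2)⟩
  choose X h0 hX using hloc
  have hmono : ∀ m n : ℕ, m ≤ n → Set.EqOn (X m) (X n) (Set.Ioo (-((m : ℝ) + 1)) (m + 1)) := by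
    intro m n hmn
    have hmn' : (m : ℝ) ≤ n := by exact_mod_cast hmn
    refine ODE_solution_unique_of_mem_Ioo (v := fun _ => G) (s := fun _ => Set.univ) (t₀ := 0)
      (K := L) (fun _ _ => hL.lipschitzOnWith) ?_ (fun t ht => ⟨hX m t ht, trivial⟩)
      (fun t ht => ⟨hX n t ⟨by linarith [ht.1], by linarith [ht.2]⟩, trivial⟩)
      ((h0 m).trans (h0 n).symm)
    constructor <;> linarith [(m.cast_nonneg : (0 : ℝ) ≤ m)]
  have heq : ∀ (n : ℕ) (t : ℝ), t ∈ Set.Ioo (-((n : ℝ) + 1)) (n + 1) →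
      X ⌈|t|⌉₊ t = X n t := by
    intro n t ht
    have h1 : |t| ≤ ⌈|t|⌉₊ := Nat.le_ceil _
    have h2 : t ∈ Set.Ioo (-((⌈|t|⌉₊ : ℝ) + 1)) (⌈|t|⌉₊ + 1) := by
      rcases abs_le.1 h1 with ⟨h3, h4⟩
      constructor <;> linarith
    rcases le_total ⌈|t|⌉₊ n with h | h
    · exact hmono _ _ h h2
    · exact (hmono _ _ h ht).symm
  refine ⟨fun t => X ⌈|t|⌉₊ t, by simpa using h0 0, fun t => ?_⟩
  obtain ⟨n, hn⟩ := exists_nat_ge |t|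
  have ht : t ∈ Set.Ioo (-((n : ℝ) + 1)) (n + 1) := by
    rcases abs_le.1 hn with ⟨h3, h4⟩
    constructor <;> linarith
  have := hX n t ht
  simp only [heq n t ht]
  refine this.congr_of_eventuallyEq ?_
  filter_upwards [isOpen_Ioo.mem_nhds ht] with s hs using heq n s hs

/-- Solutions of equations whose right-hand sides converge uniformly to a log-Lipschitz vector
field converge, locally uniformly in time, to a solution of the limit equation. -/
theorem exists_limit_solution {C : ℝ} (hC : 0 < C) {F : B → B}
    (hF : ∀ N X Y, ‖F X - F Y‖ ≤ C * logMod N ‖X - Y‖) {G : ℕ → B → B} {δ : ℕ → ℝ}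
    (hδ : Tendsto δ atTop (𝓝 0)) (hG : ∀ n X, ‖G n X - F X‖ ≤ δ n) {X : ℕ → ℝ → B} {X₀ : B}
    (h0 : ∀ n, X n 0 = X₀) (hX : ∀ n t, HasDerivAt (X n) (G n (X n t)) t) :
    ∃ Y : ℝ → B, Y 0 = X₀ ∧ (∀ t, HasDerivAt Y (F (Y t)) t) ∧
      ∀ t, Tendsto (fun n => X n t) atTop (𝓝 (Y t)) := by
  -- Osgood stability indexed by pairs (m, n), with error δ m + δ n, makes the sequence uniformly
  -- Cauchy on bounded times.
  have hcau : ∀ T : ℝ, ∀ ε > 0, ∃ n₀, ∀ m ≥ n₀, ∀ n ≥ n₀, ∀ t, |t| ≤ T → ‖X m t - X n t‖ ≤ ε := by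
    intro T ε hε
    have hδ2 : Tendsto (fun p : ℕ × ℕ => δ p.1 + δ p.2) (atTop ×ˢ atTop) (𝓝 0) := by
      simpa using (hδ.comp tendsto_fst).add (hδ.comp tendsto_snd)
    have := osgood_uniform_two_sided hC (f := fun p : ℕ × ℕ => fun t => X p.1 t - X p.2 t)
      (f' := fun p t => G p.1 (X p.1 t) - G p.2 (X p.2 t)) hδ2 (by simp [h0])
      (fun p t => (hX _ t).sub (hX _ t)) (fun p t N => by
        have h1 := hF N (X p.1 t) (X p.2 t)
        have h2 := hG p.1 (X p.1 t)
        have h3 := hG p.2 (X p.2 t)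
        rw [norm_sub_rev] at h3
        calc ‖G p.1 (X p.1 t) - G p.2 (X p.2 t)‖
            = ‖(G p.1 (X p.1 t) - F (X p.1 t)) + (F (X p.1 t) - F (X p.2 t)) +
                (F (X p.2 t) - G p.2 (X p.2 t))‖ := by congr 1; abel
          _ ≤ _ := norm_add₃_le
          _ ≤ _ := by linarith) T hε
    rw [prod_atTop_atTop_eq, eventually_atTop] at this
    obtain ⟨⟨a, b⟩, hab⟩ := this
    refine ⟨max a b, fun m hm n hn => hab (m, n) ⟨?_, ?_⟩⟩
    · exact (le_max_left a b).trans hm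
    · exact (le_max_right a b).trans hn
  have hlim : ∀ t, ∃ y, Tendsto (fun n => X n t) atTop (𝓝 y) := by
    intro t
    refine cauchySeq_tendsto_of_complete (Metric.cauchySeq_iff'.2 fun ε hε => ?_)
    obtain ⟨n₀, hn⟩ := hcau |t| (ε / 2) (by positivity)
    refine ⟨n₀, fun n h => ?_⟩
    rw [dist_eq_norm]
    exact (hn n h n₀ le_rfl t le_rfl).trans_lt (by linarith)
  choose Y hY using hlim
  have hunif : ∀ T : ℝ, ∀ ε > 0, ∃ n₀, ∀ n ≥ n₀, ∀ t, |t| ≤ T → ‖X n t - Y t‖ ≤ ε := by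
    intro T ε hε
    obtain ⟨n₀, hn⟩ := hcau T ε hε
    refine ⟨n₀, fun n h t ht => ?_⟩
    refine le_of_tendsto (((hY t).const_sub (X n t)).norm) ?_
    filter_upwards [eventually_ge_atTop n₀] with m hm using hn n h m hm t ht
  refine ⟨Y, tendsto_nhds_unique (hY 0) (by simp [h0]), fun t => ?_, hY⟩
  refine hasDerivAt_of_tendstoUniformlyOn (l := atTop) (f := X) (f' := fun n t => G n (X n t))
    (g' := fun t => F (Y t))
    (s := Set.Ioo (-(|t| + 1)) (|t| + 1)) isOpen_Ioo ?_ (.of_forall fun n s _ => hX n s)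
    (fun s _ => hY s) ?_
  · rw [Metric.tendstoUniformlyOn_iff]
    intro ε hε
    obtain ⟨η, hη, N, hN⟩ := exists_logMod_le hC.le (half_pos (half_pos hε))
    obtain ⟨n₀, hn⟩ := hunif (|t| + 1) η hη
    filter_upwards [eventually_ge_atTop n₀, hδ.eventually (Iic_mem_nhds (half_pos (half_pos hε)))]
      with n h1 h2 s hs
    rw [dist_eq_norm, norm_sub_rev]
    have h3 := hF N (X n s) (Y s)
    have h4 := hN _ (hn n h1 s (abs_le.2 ⟨hs.1.le, hs.2.le⟩))
    have h5 := hG n (X n s)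
    calc ‖G n (X n s) - F (Y s)‖ = ‖(G n (X n s) - F (X n s)) + (F (X n s) - F (Y s))‖ := by
          congr 1; abel
      _ ≤ _ := norm_add_le _ _
      _ < ε := by linarith
  · rcases abs_le.1 (le_refl |t|) with ⟨h3, h4⟩
    constructor <;> linarith

end Osgood

/-! ### Gaussian vortices -/

/-- Rotation of the plane by a right angle. -/
def perp : Plane →L[ℝ] Plane :=
  LinearMap.toContinuousLinearMap
    { toFun := fun x => !₂[-(x 1), x 0]
      map_add' := fun x y => by ext i; fin_cases i <;> simp [add_comm]
      map_smul' := fun c x => by ext i; fin_cases i <;> simp }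

lemma perp_apply_zero (x : Plane) : perp x 0 = -(x 1) := rfl

lemma perp_apply_one (x : Plane) : perp x 1 = x 0 := rfl

lemma norm_perp (x : Plane) : ‖perp x‖ = ‖x‖ := by
  rw [EuclideanSpace.norm_eq, EuclideanSpace.norm_eq]
  simp [Fin.sum_univ_two, perp_apply_zero, perp_apply_one, add_comm]

/-- The divergence of a linear map of the plane, i.e. its trace. -/
def planeTrace : (Plane →L[ℝ] Plane) →L[ℝ] ℝ :=
  (EuclideanSpace.proj 0 ∘L ContinuousLinearMap.apply ℝ Plane (EuclideanSpace.single 0 1)) +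
    (EuclideanSpace.proj 1 ∘L ContinuousLinearMap.apply ℝ Plane (EuclideanSpace.single 1 1))

lemma planeTrace_apply (A : Plane →L[ℝ] Plane) :
    planeTrace A = A (EuclideanSpace.single 0 1) 0 + A (EuclideanSpace.single 1 1) 1 := rfl

lemma planeTrace_perp : planeTrace perp = 0 := by
  simp [planeTrace_apply, perp_apply_zero, perp_apply_one]

/-- The velocity field of a Gaussian vortex. -/
def gaussVortex (c : ℝ) (x : Plane) : Plane := Real.exp (-(c * ‖x‖ ^ 2)) • perp x

/-- The derivative of `gaussVortex`. -/
def gaussVortexDeriv (c : ℝ) (x : Plane) : Plane →L[ℝ] Plane :=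
  Real.exp (-(c * ‖x‖ ^ 2)) • perp +
    (Real.exp (-(c * ‖x‖ ^ 2)) • -(c • (2 : ℝ) • innerSL ℝ x)).smulRight (perp x)

lemma norm_gaussVortex (c : ℝ) (x : Plane) :
    ‖gaussVortex c x‖ = Real.exp (-(c * ‖x‖ ^ 2)) * ‖x‖ := by
  rw [gaussVortex, norm_smul, norm_perp, Real.norm_eq_abs, Real.abs_exp]

/-- With y = √c ‖x‖ this is y ≤ 1 + y² ≤ exp(y²). -/
lemma norm_gaussVortex_le {c : ℝ} (hc : 0 < c) (x : Plane) :
    ‖gaussVortex c x‖ ≤ (Real.sqrt c)⁻¹ := by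
  rw [norm_gaussVortex, Real.exp_neg]
  have h1 : c * ‖x‖ ^ 2 = (Real.sqrt c * ‖x‖) ^ 2 := by
    rw [mul_pow, Real.sq_sqrt hc.le]
  have hs : 0 < Real.sqrt c := Real.sqrt_pos.2 hc
  have h2 := Real.add_one_le_exp (c * ‖x‖ ^ 2)
  rw [inv_mul_eq_div, div_le_iff₀ (Real.exp_pos _), inv_mul_eq_div, le_div_iff₀ hs]
  nlinarith [sq_nonneg (Real.sqrt c * ‖x‖ - 1)]

lemma hasFDerivAt_gaussVortex (c : ℝ) (x : Plane) :
    HasFDerivAt (gaussVortex c) (gaussVortexDeriv c x) x := by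
  have h1 : HasFDerivAt (fun y : Plane => ‖y‖ ^ 2) ((2 : ℝ) • innerSL ℝ x) x := by
    have h := (hasStrictFDerivAt_norm_sq x).hasFDerivAt
    rwa [← Nat.cast_smul_eq_nsmul ℝ, Nat.cast_ofNat] at h
  exact ((h1.const_mul c).neg.exp).smul perp.hasFDerivAt

lemma planeTrace_gaussVortexDeriv (c : ℝ) (x : Plane) : planeTrace (gaussVortexDeriv c x) = 0 := by
  rw [gaussVortexDeriv, map_add, map_smul, planeTrace_perp, planeTrace_apply]
  simp [perp_apply_zero, perp_apply_one, EuclideanSpace.inner_single_right]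
  ring

/-- With q = c‖x‖² the point is 1 + 2q ≤ 2 exp q. The bound does not depend on the width, so every
scale contributes alike to increments of the blob kernel; this is where its logarithm comes from. -/
lemma norm_gaussVortexDeriv_le {c : ℝ} (hc : 0 ≤ c) (x : Plane) :
    ‖gaussVortexDeriv c x‖ ≤ 2 := by
  refine ContinuousLinearMap.opNorm_le_bound _ (by norm_num) fun v => ?_
  have h1 : gaussVortexDeriv c x v = Real.exp (-(c * ‖x‖ ^ 2)) • perp v +
      (Real.exp (-(c * ‖x‖ ^ 2)) * -(c * (2 * inner ℝ x v))) • perp x := by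
    simp [gaussVortexDeriv]
  have h2 := Real.add_one_le_exp (c * ‖x‖ ^ 2)
  have h3 := abs_real_inner_le_norm x v
  set E := Real.exp (-(c * ‖x‖ ^ 2)) with hE
  have hE0 : 0 < E := Real.exp_pos _
  have h4 : E * (1 + 2 * (c * ‖x‖ ^ 2)) ≤ 2 := by
    rw [hE, Real.exp_neg, inv_mul_eq_div, div_le_iff₀ (Real.exp_pos _)]
    linarith
  calc ‖gaussVortexDeriv c x v‖ ≤ E * ‖v‖ + E * (c * (2 * |inner ℝ x v|)) * ‖x‖ := by
        rw [h1]
        refine (norm_add_le _ _).trans (le_of_eq ?_)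
        rw [norm_smul, norm_smul, norm_perp, norm_perp, norm_mul, norm_neg, norm_mul, norm_mul]
        simp only [Real.norm_eq_abs, abs_of_pos hE0, abs_of_nonneg hc]
        norm_num
    _ ≤ E * ‖v‖ + E * (c * (2 * (‖x‖ * ‖v‖))) * ‖x‖ := by gcongr
    _ = E * (1 + 2 * (c * ‖x‖ ^ 2)) * ‖v‖ := by ring
    _ ≤ 2 * ‖v‖ := by gcongr

lemma norm_gaussVortex_sub_le {c : ℝ} (hc : 0 ≤ c) (a b : Plane) :
    ‖gaussVortex c a - gaussVortex c b‖ ≤ 2 * ‖a - b‖ :=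
  Convex.norm_image_sub_le_of_norm_hasFDerivWithin_le (s := Set.univ)
    (fun x _ => (hasFDerivAt_gaussVortex c x).hasFDerivWithinAt)
    (fun x _ => norm_gaussVortexDeriv_le hc x) convex_univ (Set.mem_univ b) (Set.mem_univ a)

/-! ### Integrals of exponentials -/

lemma integrable_exp_neg_mul_exp {c : ℝ} (hc : 0 < c) :
    Integrable fun t : ℝ => Real.exp (-t) * Real.exp (-(c * Real.exp (-t))) := by
  have hmeas : Continuous fun t : ℝ => Real.exp (-t) * Real.exp (-(c * Real.exp (-t))) := by
    fun_prop
  rw [← integrableOn_univ, ← Set.Iic_union_Ioi (a := (0 : ℝ)), integrableOn_union]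
  constructor
  -- With y = exp(-t), the inequality exp(cy) ≥ (cy)²/2 gives the majorant (2/c²) exp t.
  · refine Integrable.mono' ((integrableOn_exp_Iic 0).const_mul (2 / c ^ 2))
      hmeas.aestronglyMeasurable (.of_forall fun t => ?_)
    rw [Real.norm_of_nonneg (by positivity)]
    have h1 := Real.quadratic_le_exp_of_nonneg (x := c * Real.exp (-t)) (by positivity)
    have hy := Real.exp_pos (-t)
    have h2 : Real.exp t = (Real.exp (-t))⁻¹ := by rw [Real.exp_neg, inv_inv]
    rw [h2, Real.exp_neg (c * _)]
    set y := Real.exp (-t)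
    rw [← div_eq_mul_inv, div_le_iff₀ (Real.exp_pos _)]
    have h3 : y = 2 / c ^ 2 * y⁻¹ * ((c * y) ^ 2 / 2) := by field_simp
    calc y = 2 / c ^ 2 * y⁻¹ * ((c * y) ^ 2 / 2) := h3
      _ ≤ _ := by gcongr; nlinarith [mul_pos hc hy]
  · refine Integrable.mono' (integrableOn_exp_neg_Ioi 0)
      hmeas.aestronglyMeasurable (.of_forall fun t => ?_)
    rw [Real.norm_of_nonneg (by positivity)]
    exact mul_le_of_le_one_right (Real.exp_pos _).le
      (Real.exp_le_one_iff.2 (neg_nonpos.2 (by positivity)))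

/-- The integrand has an explicit primitive. At c = ‖x‖²/(4α²) the value supplies the inverse-square
factor of the Euler kernel. -/
lemma integral_exp_neg_mul_exp {c : ℝ} (hc : 0 < c) :
    ∫ t : ℝ, Real.exp (-t) * Real.exp (-(c * Real.exp (-t))) = c⁻¹ := by
  have hd : ∀ t : ℝ, HasDerivAt (fun s => c⁻¹ * Real.exp (-(c * Real.exp (-s))))
      (Real.exp (-t) * Real.exp (-(c * Real.exp (-t)))) t := by
    intro t
    have h := ((((hasDerivAt_neg t).exp).const_mul c).fun_neg.exp).const_mul c⁻¹
    convert! h using 1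
    field_simp
  have hbot : Tendsto (fun s => c⁻¹ * Real.exp (-(c * Real.exp (-s)))) atBot (𝓝 0) := by
    have h : Tendsto (fun s : ℝ => c * Real.exp (-s)) atBot atTop :=
      (Real.tendsto_exp_atTop.comp tendsto_neg_atBot_atTop).const_mul_atTop hc
    simpa using (Real.tendsto_exp_neg_atTop_nhds_zero.comp h).const_mul c⁻¹
  have htop : Tendsto (fun s => c⁻¹ * Real.exp (-(c * Real.exp (-s)))) atTop (𝓝 c⁻¹) := by
    have h : Tendsto (fun s : ℝ => -(c * Real.exp (-s))) atTop (𝓝 0) := by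
      simpa using (Real.tendsto_exp_neg_atTop_nhds_zero.const_mul c).neg
    simpa using ((Real.continuous_exp.tendsto 0).comp h).const_mul c⁻¹
  simpa using integral_of_hasDerivAt_of_tendsto hd (integrable_exp_neg_mul_exp hc) hbot htop

lemma integrable_exp_mul_exp_neg_exp :
    Integrable fun t : ℝ => Real.exp t * Real.exp (-Real.exp t) := by
  simpa using (integrable_exp_neg_mul_exp one_pos).comp_neg

lemma integral_exp_mul_exp_neg_exp :
    ∫ t : ℝ, Real.exp t * Real.exp (-Real.exp t) = 1 := by
  have h := integral_neg_eq_self (fun t : ℝ => Real.exp t * Real.exp (-Real.exp t)) volume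
  rw [← h]
  simpa using integral_exp_neg_mul_exp one_pos

/-! ### The Bessel function -/

/-- The defining integrand is even, so the integral extends to the line; translating by log(s/2)
turns s cosh t into exp t + (s²/4) exp(-t). Only s² remains, which makes K₀ a superposition of
Gaussians. -/
lemma besselK0_eq {s : ℝ} (hs : 0 < s) :
    besselK0 s = 1 / 2 * ∫ t : ℝ, Real.exp (-Real.exp t) *
      Real.exp (-(s ^ 2 / 4 * Real.exp (-t))) := by
  have h1 : ∫ t : ℝ, Real.exp (-(s * Real.cosh |t|)) =
      2 * ∫ t in Set.Ioi (0 : ℝ), Real.exp (-(s * Real.cosh t)) :=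
    integral_comp_abs (f := fun t => Real.exp (-(s * Real.cosh t)))
  simp only [Real.cosh_abs] at h1
  have h2 := integral_sub_right_eq_self (μ := volume)
    (fun t : ℝ => Real.exp (-(s * Real.cosh t))) (Real.log (s / 2))
  rw [besselK0, ← mul_right_inj' (two_ne_zero (α := ℝ)), ← h1, ← h2, ← mul_assoc]
  norm_num
  congr 1
  funext t
  rw [← Real.exp_add]
  congr 1
  have hs2 : (0 : ℝ) < s / 2 := by positivity
  rw [Real.cosh_eq, neg_sub, Real.exp_sub, Real.exp_sub, Real.exp_log hs2, Real.exp_neg]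
  have := Real.exp_pos t
  field_simp
  ring

lemma exp_neg_exp_le_one (t : ℝ) : Real.exp (-Real.exp t) ≤ 1 :=
  Real.exp_le_one_iff.2 (neg_nonpos.2 (Real.exp_pos t).le)

lemma integrable_exp_neg_exp_mul {c : ℝ} (hc : 0 < c) :
    Integrable fun t : ℝ => Real.exp (-Real.exp t) * Real.exp (-(c * Real.exp (-t))) := by
  have hmeas : Continuous fun t : ℝ =>
      Real.exp (-Real.exp t) * Real.exp (-(c * Real.exp (-t))) := by fun_prop
  refine Integrable.mono' (integrable_exp_mul_exp_neg_exp.add (integrable_exp_neg_mul_exp hc))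
    hmeas.aestronglyMeasurable (.of_forall fun t => ?_)
  rw [Real.norm_of_nonneg (by positivity), Pi.add_apply]
  have h1 := exp_neg_exp_le_one t
  have h2 : Real.exp (-(c * Real.exp (-t))) ≤ 1 :=
    Real.exp_le_one_iff.2 (neg_nonpos.2 (by positivity))
  have p1 := Real.exp_pos (-Real.exp t)
  have p2 := Real.exp_pos (-(c * Real.exp (-t)))
  rcases le_total 0 t with ht | ht
  · have h3 : 1 ≤ Real.exp t := Real.one_le_exp ht
    have : 0 ≤ Real.exp (-t) * Real.exp (-(c * Real.exp (-t))) := by positivity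
    nlinarith
  · have h3 : 1 ≤ Real.exp (-t) := Real.one_le_exp (by linarith)
    have : 0 ≤ Real.exp t * Real.exp (-Real.exp t) := by positivity
    nlinarith

lemma hasDerivAt_besselK0 {s : ℝ} (hs : 0 < s) :
    HasDerivAt besselK0 (-(s / 4 * ∫ t : ℝ, Real.exp (-Real.exp t) *
      (Real.exp (-t) * Real.exp (-(s ^ 2 / 4 * Real.exp (-t)))))) s := by
  have hev : besselK0 =ᶠ[𝓝 s] fun s => 1 / 2 * ∫ t : ℝ, Real.exp (-Real.exp t) *
      Real.exp (-(s ^ 2 / 4 * Real.exp (-t))) := by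
    filter_upwards [Ioi_mem_nhds hs] with r hr using besselK0_eq hr
  refine HasDerivAt.congr_of_eventuallyEq ?_ hev
  have hd := hasDerivAt_integral_of_dominated_loc_of_deriv_le (μ := volume) (x₀ := s)
    (F := fun r t => Real.exp (-Real.exp t) * Real.exp (-(r ^ 2 / 4 * Real.exp (-t))))
    (F' := fun r t => -(r / 2 * (Real.exp (-Real.exp t) *
      (Real.exp (-t) * Real.exp (-(r ^ 2 / 4 * Real.exp (-t)))))))
    -- For r between s/2 and 2s one has r/2 ≤ s and r²/4 ≥ s²/16.
    (bound := fun t => s * (Real.exp (-t) * Real.exp (-(s ^ 2 / 16 * Real.exp (-t)))))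
    (s := Set.Ioo (s / 2) (2 * s)) (Ioo_mem_nhds (by linarith) (by linarith))
    (.of_forall fun r => (by fun_prop : Continuous _).aestronglyMeasurable)
    (integrable_exp_neg_exp_mul (by positivity))
    (by fun_prop : Continuous _).aestronglyMeasurable
    (.of_forall fun t r hr => ?_)
    ((integrable_exp_neg_mul_exp (by positivity)).const_mul _)
    (.of_forall fun t r _ => ?_)
  · convert! hd.2.const_mul (1 / 2 : ℝ) using 1
    rw [integral_neg, integral_const_mul]
    ring
  · have hr0 : 0 < r := by linarith [hr.1]
    rw [norm_neg, Real.norm_of_nonneg (by positivity)]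
    have h1 : s ^ 2 / 16 ≤ r ^ 2 / 4 := by nlinarith [hr.1]
    have h2 := exp_neg_exp_le_one t
    have h3 : Real.exp (-(r ^ 2 / 4 * Real.exp (-t))) ≤
        Real.exp (-(s ^ 2 / 16 * Real.exp (-t))) := by
      gcongr
    calc r / 2 * (Real.exp (-Real.exp t) *
          (Real.exp (-t) * Real.exp (-(r ^ 2 / 4 * Real.exp (-t)))))
        ≤ s * (1 * (Real.exp (-t) * Real.exp (-(s ^ 2 / 16 * Real.exp (-t))))) := by
          gcongr
          linarith [hr.2]
      _ = _ := by ring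
  · have h := ((((hasDerivAt_pow 2 r).div_const 4).mul_const (Real.exp (-t))).neg.exp).const_mul
      (Real.exp (-Real.exp t))
    convert! h using 1
    simp
    ring

/-! ### The kernels as superpositions of Gaussian vortices -/

/-- The weight of the Gaussian vortices in the blob kernel. -/
def blobWeight (t : ℝ) : ℝ := (1 - Real.exp (-Real.exp t)) * Real.exp (-t) / (8 * Real.pi)

/-- The inverse square width of the Gaussian vortices in the blob kernel. -/
def blobRate (α t : ℝ) : ℝ := Real.exp (-t) / (4 * α ^ 2)

/-- The blob kernel as a function of the relative position. -/
def blobField (α : ℝ) (x : Plane) : Plane :=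
  (α ^ 2)⁻¹ • ∫ t : ℝ, blobWeight t • gaussVortex (blobRate α t) x

/-- The blob kernel with the narrowest Gaussian vortices removed. -/
def blobFieldTrunc (α M : ℝ) (x : Plane) : Plane :=
  (α ^ 2)⁻¹ • ∫ t in Set.Ioi (-M), blobWeight t • gaussVortex (blobRate α t) x

/-- The Euler kernel as a function of the relative position. -/
def eulerField (x : Plane) : Plane := (2 * Real.pi * ‖x‖ ^ 2)⁻¹ • perp x

lemma continuous_blobWeight : Continuous blobWeight := by
  unfold blobWeight; fun_prop

lemma continuous_blobRate (α : ℝ) : Continuous (blobRate α) := by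
  unfold blobRate; fun_prop

lemma continuous_gaussVortex_blobRate (α : ℝ) (x : Plane) :
    Continuous fun t => gaussVortex (blobRate α t) x := by
  unfold gaussVortex blobRate; fun_prop

lemma continuous_gaussVortexDeriv_blobRate (α : ℝ) (x : Plane) :
    Continuous fun t => gaussVortexDeriv (blobRate α t) x := by
  have h : Continuous fun t => Real.exp (-(blobRate α t * ‖x‖ ^ 2)) := by
    unfold blobRate; fun_prop
  have h2 : (fun t => gaussVortexDeriv (blobRate α t) x) = fun t =>
      Real.exp (-(blobRate α t * ‖x‖ ^ 2)) • perp +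
      (Real.exp (-(blobRate α t * ‖x‖ ^ 2)) * -(blobRate α t)) •
        ((2 : ℝ) • innerSL ℝ x).smulRight (perp x) := by
    funext t
    rw [gaussVortexDeriv]
    congr 1
    ext v : 1
    simp [mul_smul]
  rw [h2]
  exact (h.smul continuous_const).add ((h.mul (continuous_blobRate α).neg).smul continuous_const)

lemma eight_pi_ge : (8 : ℝ) ≤ 8 * Real.pi := by linarith [Real.pi_gt_three]

lemma blobWeight_nonneg (t : ℝ) : 0 ≤ blobWeight t := by
  have := exp_neg_exp_le_one t
  have : 0 ≤ 1 - Real.exp (-Real.exp t) := by linarith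
  unfold blobWeight; positivity

lemma blobWeight_le_exp (t : ℝ) : blobWeight t ≤ Real.exp (-t) / (8 * Real.pi) := by
  unfold blobWeight
  gcongr
  exact mul_le_of_le_one_left (Real.exp_pos _).le (by linarith [Real.exp_pos (-Real.exp t)])

lemma blobWeight_le_exp' (t : ℝ) : blobWeight t ≤ Real.exp (-t) / 8 := by
  refine (blobWeight_le_exp t).trans ?_
  gcongr
  exact eight_pi_ge

lemma blobWeight_le_one (t : ℝ) : blobWeight t ≤ 1 / 8 := by
  unfold blobWeight
  have h1 : 1 - Real.exp (-Real.exp t) ≤ Real.exp t := by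
    linarith [Real.add_one_le_exp (-Real.exp t)]
  have h2 : (1 - Real.exp (-Real.exp t)) * Real.exp (-t) ≤ 1 := by
    calc (1 - Real.exp (-Real.exp t)) * Real.exp (-t) ≤ Real.exp t * Real.exp (-t) := by gcongr
      _ = 1 := by rw [← Real.exp_add]; simp
  gcongr
  exact eight_pi_ge

lemma blobRate_pos {α : ℝ} (hα : 0 < α) (t : ℝ) : 0 < blobRate α t := by
  unfold blobRate; positivity

lemma inv_sqrt_blobRate {α : ℝ} (hα : 0 < α) (t : ℝ) :
    (Real.sqrt (blobRate α t))⁻¹ = 2 * α * Real.exp (t / 2) := by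
  have h : blobRate α t = ((2 * α * Real.exp (t / 2))⁻¹) ^ 2 := by
    rw [inv_pow, mul_pow, ← Real.exp_nat_mul, blobRate, Real.exp_neg]
    push_cast
    have : (2 : ℝ) * (t / 2) = t := by ring
    rw [this]
    field_simp
    norm_num
  rw [h, Real.sqrt_sq (by positivity), inv_inv]

lemma norm_gaussVortex_blobRate_le {α : ℝ} (hα : 0 < α) (t : ℝ) (x : Plane) :
    ‖gaussVortex (blobRate α t) x‖ ≤ 2 * α * Real.exp (t / 2) :=
  inv_sqrt_blobRate hα t ▸ norm_gaussVortex_le (blobRate_pos hα t) x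

/-- The weight is bounded and the vortex at scale t has size of order α exp(t/2). The bound holds
for every t but is integrable only at −∞; `norm_blobWeight_smul_le_of_nonneg` uses the decay of the
weight to handle +∞. -/
lemma norm_blobWeight_smul_le_of_nonpos {α : ℝ} (hα : 0 < α) (t : ℝ) (x : Plane) :
    ‖blobWeight t • gaussVortex (blobRate α t) x‖ ≤ α * Real.exp (t / 2) := by
  rw [norm_smul, Real.norm_of_nonneg (blobWeight_nonneg t)]
  have h1 := norm_gaussVortex_blobRate_le hα t x
  have h2 := blobWeight_le_one t
  have : 0 < α * Real.exp (t / 2) := by positivity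
  calc blobWeight t * ‖gaussVortex (blobRate α t) x‖ ≤ 1 / 8 * (2 * α * Real.exp (t / 2)) := by
        gcongr
    _ ≤ _ := by linarith

lemma norm_blobWeight_smul_le_of_nonneg {α : ℝ} (hα : 0 < α) (t : ℝ) (x : Plane) :
    ‖blobWeight t • gaussVortex (blobRate α t) x‖ ≤ α * Real.exp (-(1 / 2) * t) := by
  rw [norm_smul, Real.norm_of_nonneg (blobWeight_nonneg t)]
  have h1 := norm_gaussVortex_blobRate_le hα t x
  have h2 := blobWeight_le_exp' t
  have h3 : Real.exp (-(1 / 2) * t) = Real.exp (-t) * Real.exp (t / 2) := by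
    rw [← Real.exp_add]; congr 1; ring
  rw [h3]
  have : 0 < α * (Real.exp (-t) * Real.exp (t / 2)) := by positivity
  calc blobWeight t * ‖gaussVortex (blobRate α t) x‖
      ≤ Real.exp (-t) / 8 * (2 * α * Real.exp (t / 2)) := by gcongr
    _ ≤ _ := by linarith

lemma aestronglyMeasurable_blob (α : ℝ) (x : Plane) (μ : Measure ℝ) :
    AEStronglyMeasurable (fun t => blobWeight t • gaussVortex (blobRate α t) x) μ :=
  (continuous_blobWeight.smul (continuous_gaussVortex_blobRate α x)).aestronglyMeasurable

lemma integrableOn_exp_half_Iic (c : ℝ) :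
    IntegrableOn (fun t : ℝ => Real.exp (t / 2)) (Set.Iic c) := by
  simpa [div_eq_inv_mul] using integrableOn_exp_mul_Iic (a := 1 / 2) (by norm_num) c

lemma integral_exp_half_Iic (c : ℝ) :
    ∫ t in Set.Iic c, Real.exp (t / 2) = 2 * Real.exp (c / 2) := by
  have := integral_exp_mul_Iic (a := 1 / 2) (by norm_num) c
  simp only [one_div, ← div_eq_inv_mul] at this
  rw [this]; field_simp

lemma integrable_blob {α : ℝ} (hα : 0 < α) (x : Plane) :
    Integrable fun t => blobWeight t • gaussVortex (blobRate α t) x := by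
  rw [← integrableOn_univ, ← Set.Iic_union_Ioi (a := (0 : ℝ)), integrableOn_union]
  constructor
  · exact Integrable.mono' ((integrableOn_exp_half_Iic 0).const_mul α)
      (aestronglyMeasurable_blob α x _)
      (.of_forall fun t => norm_blobWeight_smul_le_of_nonpos hα t x)
  · exact Integrable.mono' ((integrableOn_exp_mul_Ioi (a := -(1 / 2)) (by norm_num) 0).const_mul α)
      (aestronglyMeasurable_blob α x _)
      (.of_forall fun t => norm_blobWeight_smul_le_of_nonneg hα t x)

/-- The truncated kernels converge uniformly to the blob kernel. -/
lemma norm_blobFieldTrunc_sub_le {α : ℝ} (hα : 0 < α) (M : ℝ) (x : Plane) :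
    ‖blobFieldTrunc α M x - blobField α x‖ ≤ 2 * α⁻¹ * Real.exp (-M / 2) := by
  have hinteg := integrable_blob hα x
  have h1 : (∫ t : ℝ, blobWeight t • gaussVortex (blobRate α t) x) =
      (∫ t in Set.Iic (-M), blobWeight t • gaussVortex (blobRate α t) x) +
      ∫ t in Set.Ioi (-M), blobWeight t • gaussVortex (blobRate α t) x :=
    (intervalIntegral.integral_Iic_add_Ioi hinteg.integrableOn hinteg.integrableOn).symm
  have h2 : ‖∫ t in Set.Iic (-M), blobWeight t • gaussVortex (blobRate α t) x‖ ≤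
      α * (2 * Real.exp (-M / 2)) := by
    rw [← integral_exp_half_Iic, ← integral_const_mul]
    exact norm_integral_le_of_norm_le ((integrableOn_exp_half_Iic _).const_mul α)
      (.of_forall fun t => norm_blobWeight_smul_le_of_nonpos hα t x)
  rw [blobFieldTrunc, blobField, h1, ← smul_sub, sub_add_cancel_right, norm_smul, norm_neg,
    Real.norm_of_nonneg (by positivity)]
  calc (α ^ 2)⁻¹ * _ ≤ (α ^ 2)⁻¹ * (α * (2 * Real.exp (-M / 2))) := by gcongr
    _ = _ := by field_simp

/-- The scales are split at t = -2N and t = 0. Below -2N the vortices are small and contribute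
O(exp(-N)) in total; in the middle range, of length 2N, each is 2-Lipschitz with bounded weight;
above 0 the weight decays like exp(-t). -/
lemma norm_blobField_sub_le {α : ℝ} (hα : 0 < α) (N : ℕ) (a b : Plane) :
    ‖blobField α a - blobField α b‖ ≤ (α ^ 2)⁻¹ * (1 + 4 * α) * logMod N ‖a - b‖ := by
  set D := ‖a - b‖ with hD
  have hD0 : 0 ≤ D := norm_nonneg _
  set f : ℝ → Plane := fun t => blobWeight t • gaussVortex (blobRate α t) a -
    blobWeight t • gaussVortex (blobRate α t) b with hf
  have hfint : Integrable f := (integrable_blob hα a).sub (integrable_blob hα b)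
  have hbd : ∀ t, ‖f t‖ ≤ blobWeight t * (2 * D) := fun t => by
    rw [hf]
    simp only
    rw [← smul_sub, norm_smul, Real.norm_of_nonneg (blobWeight_nonneg t)]
    exact mul_le_mul_of_nonneg_left (norm_gaussVortex_sub_le (blobRate_pos hα t).le a b)
      (blobWeight_nonneg t)
  have hN : -(2 * (N : ℝ)) ≤ 0 := by simp
  have h1 : ‖∫ t in Set.Iic (-(2 * (N : ℝ))), f t‖ ≤ 4 * α * Real.exp (-N) := by
    have : 4 * α * Real.exp (-N) = ∫ t in Set.Iic (-(2 * (N : ℝ))), 2 * α * Real.exp (t / 2) := by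
      rw [integral_const_mul, integral_exp_half_Iic]
      have : -(2 * (N : ℝ)) / 2 = -N := by ring
      rw [this]; ring
    rw [this]
    refine norm_integral_le_of_norm_le ((integrableOn_exp_half_Iic _).const_mul _)
      (.of_forall fun t => ?_)
    have h1 := norm_blobWeight_smul_le_of_nonpos hα t a
    have h2 := norm_blobWeight_smul_le_of_nonpos hα t b
    exact (norm_sub_le _ _).trans (by linarith)
  have h2 : ‖∫ t in Set.Ioc (-(2 * (N : ℝ))) 0, f t‖ ≤ N * D := by
    have := norm_setIntegral_le_of_norm_le_const (μ := volume) (s := Set.Ioc (-(2 * (N : ℝ))) 0)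
      (f := f) (C := D / 2) measure_Ioc_lt_top (fun t _ => (hbd t).trans (by
        have := blobWeight_le_one t
        nlinarith))
    refine this.trans (le_of_eq ?_)
    rw [Real.volume_real_Ioc_of_le hN]; ring
  have h3 : ‖∫ t in Set.Ioi (0 : ℝ), f t‖ ≤ D := by
    have : D = ∫ t in Set.Ioi (0 : ℝ), D * Real.exp (-t) := by
      rw [integral_const_mul, integral_exp_neg_Ioi_zero, mul_one]
    rw [this]
    refine norm_integral_le_of_norm_le ((integrableOn_exp_neg_Ioi 0).const_mul _)
      (.of_forall fun t => (hbd t).trans ?_)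
    have := blobWeight_le_exp' t
    have := Real.exp_pos (-t)
    nlinarith
  have hsplit : ∫ t, f t = (∫ t in Set.Iic (-(2 * (N : ℝ))), f t) +
      (∫ t in Set.Ioc (-(2 * (N : ℝ))) 0, f t) + ∫ t in Set.Ioi (0 : ℝ), f t := by
    rw [← intervalIntegral.integral_Iic_add_Ioi (b := (0 : ℝ)) hfint.integrableOn
      hfint.integrableOn]
    congr 1
    rw [← setIntegral_union (Set.Iic_disjoint_Ioc le_rfl) measurableSet_Ioc hfint.integrableOn
      hfint.integrableOn, Set.Iic_union_Ioc_eq_Iic hN]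
  have h4 : blobField α a - blobField α b = (α ^ 2)⁻¹ • ∫ t, f t := by
    rw [blobField, blobField, ← smul_sub, hf, integral_sub (integrable_blob hα a)
      (integrable_blob hα b)]
  have hE := Real.exp_pos (-(N : ℝ))
  rw [h4, hsplit, norm_smul, Real.norm_of_nonneg (by positivity), mul_assoc]
  refine mul_le_mul_of_nonneg_left ?_ (by positivity)
  have h5 := norm_add₃_le (a := ∫ t in Set.Iic (-(2 * (N : ℝ))), f t)
    (b := ∫ t in Set.Ioc (-(2 * (N : ℝ))) 0, f t) (c := ∫ t in Set.Ioi (0 : ℝ), f t)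
  have h6 : 0 ≤ 4 * α * ((N + 1) * D) := by positivity
  unfold logMod
  nlinarith

/-- The truncated kernel is differentiable with bounded, trace-free derivative. -/
lemma hasFDerivAt_blobFieldTrunc {α : ℝ} (hα : 0 < α) (M : ℝ) (x : Plane) :
    ∃ A : Plane →L[ℝ] Plane, HasFDerivAt (blobFieldTrunc α M) A x ∧
      ‖A‖ ≤ (α ^ 2)⁻¹ * Real.exp M ∧ planeTrace A = 0 := by
  set μ := volume.restrict (Set.Ioi (-M))
  have hb : Integrable (fun t : ℝ => Real.exp (-t)) μ := integrableOn_exp_neg_Ioi (-M)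
  have hle : ∀ (t : ℝ) (y : Plane),
      ‖blobWeight t • gaussVortexDeriv (blobRate α t) y‖ ≤ Real.exp (-t) := by
    intro t y
    rw [norm_smul, Real.norm_of_nonneg (blobWeight_nonneg t)]
    have h1 := norm_gaussVortexDeriv_le (blobRate_pos hα t).le y
    have h2 := blobWeight_le_exp' t
    calc _ ≤ Real.exp (-t) / 8 * 2 := by gcongr
      _ ≤ _ := by linarith [Real.exp_pos (-t)]
  have hmeas : AEStronglyMeasurable (fun t => blobWeight t • gaussVortexDeriv (blobRate α t) x) μ :=
    (continuous_blobWeight.smul (continuous_gaussVortexDeriv_blobRate α x)).aestronglyMeasurable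
  have hinteg : Integrable (fun t => blobWeight t • gaussVortexDeriv (blobRate α t) x) μ :=
    hb.mono' hmeas (.of_forall fun t => hle t x)
  have hd := hasFDerivAt_integral_of_dominated_of_fderiv_le (μ := μ) (x₀ := x) (s := Set.univ)
    (F := fun y t => blobWeight t • gaussVortex (blobRate α t) y)
    (F' := fun y t => blobWeight t • gaussVortexDeriv (blobRate α t) y) univ_mem
    (.of_forall fun y => aestronglyMeasurable_blob α y _) (integrable_blob hα x).integrableOn
    hmeas (.of_forall fun t y _ => hle t y) hb
    (.of_forall fun t y _ => (hasFDerivAt_gaussVortex _ y).fun_const_smul _)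
  refine ⟨_, hd.const_smul ((α ^ 2)⁻¹), ?_, ?_⟩
  · rw [norm_smul, Real.norm_of_nonneg (by positivity)]
    refine mul_le_mul_of_nonneg_left ?_ (by positivity)
    have : Real.exp M = ∫ t in Set.Ioi (-M), Real.exp (-t) := by rw [integral_exp_neg_Ioi, neg_neg]
    rw [this]
    exact norm_integral_le_of_norm_le hb (.of_forall fun t => hle t x)
  · rw [map_smul, ← ContinuousLinearMap.integral_comp_comm _ hinteg]
    simp [planeTrace_gaussVortexDeriv]

/-! ### Comparison of the blob kernel with the Euler kernel -/

lemma norm_eulerField (x : Plane) : ‖eulerField x‖ = (2 * Real.pi * ‖x‖)⁻¹ := by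
  rw [eulerField, norm_smul, norm_perp, Real.norm_of_nonneg (by positivity)]
  rcases eq_or_ne x 0 with rfl | hx
  · simp
  · have : 0 < ‖x‖ := norm_pos_iff.2 hx
    field_simp

lemma integrable_exp_smul_gaussVortex {α : ℝ} (hα : 0 < α) {x : Plane} (hx : x ≠ 0) :
    Integrable fun t => (Real.exp (-t) / (8 * Real.pi)) • gaussVortex (blobRate α t) x := by
  have hr : 0 < ‖x‖ := norm_pos_iff.2 hx
  have h := ((integrable_exp_neg_mul_exp (c := ‖x‖ ^ 2 / (4 * α ^ 2)) (by positivity)).div_const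
    (8 * Real.pi)).smul_const (perp x)
  refine h.congr (.of_forall fun t => ?_)
  simp only [gaussVortex, blobRate, smul_smul]
  congr 1
  have : Real.exp (-t) / (4 * α ^ 2) * ‖x‖ ^ 2 = ‖x‖ ^ 2 / (4 * α ^ 2) * Real.exp (-t) := by ring
  rw [this]
  ring

lemma integral_exp_mul_exp_blobRate {α r : ℝ} (hα : 0 < α) (hr : 0 < r) :
    ∫ t, Real.exp (-t) / (8 * Real.pi) * Real.exp (-(blobRate α t * r ^ 2)) =
      α ^ 2 * (2 * Real.pi * r ^ 2)⁻¹ := by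
  have h := integral_exp_neg_mul_exp (c := r ^ 2 / (4 * α ^ 2)) (by positivity)
  have h2 : ∀ t, Real.exp (-t) / (8 * Real.pi) * Real.exp (-(blobRate α t * r ^ 2)) =
      (8 * Real.pi)⁻¹ * (Real.exp (-t) * Real.exp (-(r ^ 2 / (4 * α ^ 2) * Real.exp (-t)))) := by
    intro t
    have : blobRate α t * r ^ 2 = r ^ 2 / (4 * α ^ 2) * Real.exp (-t) := by
      unfold blobRate; ring
    rw [this]; ring
  simp_rw [h2]
  rw [integral_const_mul, h]
  field_simp
  norm_num

/-- The same field results for every α. Keeping α superposes the Euler and blob kernels over the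
same vortices, so that they can be compared weight by weight. -/
lemma eulerField_eq_integral {α : ℝ} (hα : 0 < α) {x : Plane} (hx : x ≠ 0) :
    eulerField x = (α ^ 2)⁻¹ •
      ∫ t, (Real.exp (-t) / (8 * Real.pi)) • gaussVortex (blobRate α t) x := by
  simp only [gaussVortex, smul_smul]
  rw [integral_smul_const, integral_exp_mul_exp_blobRate hα (norm_pos_iff.2 hx), eulerField,
    smul_smul]
  congr 1
  field_simp

/-- At a given x all Gaussian vortices are positive multiples of `perp x`, so norms add up exactly
in the Euler superposition and smaller weights give a smaller field. -/
lemma norm_integral_smul_gaussVortex_le {α : ℝ} (hα : 0 < α) {x : Plane} (hx : x ≠ 0)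
    {w : ℝ → ℝ} (hw : ∀ t, 0 ≤ w t) (hw' : ∀ t, w t ≤ Real.exp (-t) / (8 * Real.pi)) :
    ‖(α ^ 2)⁻¹ • ∫ t, w t • gaussVortex (blobRate α t) x‖ ≤ ‖eulerField x‖ := by
  have hr : 0 < ‖x‖ := norm_pos_iff.2 hx
  have h1 : ‖∫ t, w t • gaussVortex (blobRate α t) x‖ ≤
      ∫ t, ‖(Real.exp (-t) / (8 * Real.pi)) • gaussVortex (blobRate α t) x‖ := by
    refine norm_integral_le_of_norm_le (integrable_exp_smul_gaussVortex hα hx).norm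
      (.of_forall fun t => ?_)
    rw [norm_smul, norm_smul, Real.norm_of_nonneg (hw t), Real.norm_of_nonneg (by positivity)]
    gcongr
    exact hw' t
  rw [norm_smul, Real.norm_of_nonneg (by positivity), norm_eulerField]
  calc (α ^ 2)⁻¹ * _ ≤ (α ^ 2)⁻¹ * _ := mul_le_mul_of_nonneg_left h1 (by positivity)
    _ = (α ^ 2)⁻¹ * (∫ t, Real.exp (-t) / (8 * Real.pi) *
          Real.exp (-(blobRate α t * ‖x‖ ^ 2))) * ‖x‖ := by
        rw [mul_assoc, ← integral_mul_const]
        congr 2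
        funext t
        rw [norm_smul, norm_gaussVortex, Real.norm_of_nonneg (by positivity), mul_assoc]
    _ = _ := by
        rw [integral_exp_mul_exp_blobRate hα hr]
        field_simp

lemma blobField_zero (α : ℝ) : blobField α 0 = 0 := by simp [blobField, gaussVortex]

lemma norm_blobField_le {α : ℝ} (hα : 0 < α) (x : Plane) :
    ‖blobField α x‖ ≤ (2 * Real.pi * ‖x‖)⁻¹ := by
  rcases eq_or_ne x 0 with rfl | hx
  · simp [blobField_zero]
  · rw [← norm_eulerField]
    exact norm_integral_smul_gaussVortex_le hα hx blobWeight_nonneg blobWeight_le_exp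

lemma eulerField_sub_blobField {α : ℝ} (hα : 0 < α) {x : Plane} (hx : x ≠ 0) :
    eulerField x - blobField α x = (α ^ 2)⁻¹ • ∫ t,
      (Real.exp (-Real.exp t) * (Real.exp (-t) / (8 * Real.pi))) •
        gaussVortex (blobRate α t) x := by
  rw [eulerField_eq_integral hα hx, blobField, ← smul_sub,
    ← integral_sub (integrable_exp_smul_gaussVortex hα hx) (integrable_blob hα x)]
  congr 2
  funext t
  rw [← sub_smul, blobWeight]
  congr 1
  ring

lemma norm_eulerField_sub_blobField_le {α : ℝ} (hα : 0 < α) {x : Plane} (hx : x ≠ 0) :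
    ‖eulerField x - blobField α x‖ ≤ ‖eulerField x‖ := by
  rw [eulerField_sub_blobField hα hx]
  refine norm_integral_smul_gaussVortex_le hα hx (fun t => by positivity) fun t => ?_
  exact mul_le_of_le_one_left (by positivity) (exp_neg_exp_le_one t)

/-- The Gaussian is bounded by 2/q² with q = `blobRate α t` * ‖x‖². This costs exp(2t), which the
factor exp(-exp t) of the remaining weight absorbs. -/
lemma norm_eulerField_sub_blobField_le_far {α : ℝ} (hα : 0 < α) {x : Plane} (hx : x ≠ 0) :
    ‖eulerField x - blobField α x‖ ≤ 4 * α ^ 2 / ‖x‖ ^ 3 := by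
  have hr : 0 < ‖x‖ := norm_pos_iff.2 hx
  have h1 : ‖∫ t, (Real.exp (-Real.exp t) * (Real.exp (-t) / (8 * Real.pi))) •
        gaussVortex (blobRate α t) x‖ ≤
      ∫ t, 4 * α ^ 4 / ‖x‖ ^ 3 * (Real.exp t * Real.exp (-Real.exp t)) := by
    refine norm_integral_le_of_norm_le (integrable_exp_mul_exp_neg_exp.const_mul _)
      (.of_forall fun t => ?_)
    rw [norm_smul, norm_gaussVortex, Real.norm_of_nonneg (by positivity)]
    have h2 : Real.exp (-(blobRate α t * ‖x‖ ^ 2)) ≤ 32 * α ^ 4 * Real.exp t ^ 2 / ‖x‖ ^ 4 := by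
      have hq : 0 < blobRate α t * ‖x‖ ^ 2 := mul_pos (blobRate_pos hα t) (by positivity)
      have h3 := Real.quadratic_le_exp_of_nonneg hq.le
      have h4 : (32 * α ^ 4 * Real.exp t ^ 2 / ‖x‖ ^ 4) *
          ((blobRate α t * ‖x‖ ^ 2) ^ 2 / 2) = 1 := by
        rw [blobRate, Real.exp_neg]
        field_simp
        norm_num
      rw [Real.exp_neg, inv_le_iff_one_le_mul₀ (Real.exp_pos _), ← h4]
      gcongr
      linarith
    have h5 := eight_pi_ge
    calc Real.exp (-Real.exp t) * (Real.exp (-t) / (8 * Real.pi)) *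
          (Real.exp (-(blobRate α t * ‖x‖ ^ 2)) * ‖x‖)
        ≤ Real.exp (-Real.exp t) * (Real.exp (-t) / 8) *
          (32 * α ^ 4 * Real.exp t ^ 2 / ‖x‖ ^ 4 * ‖x‖) := by gcongr
      _ = 4 * α ^ 4 / ‖x‖ ^ 3 * (Real.exp t * Real.exp (-Real.exp t)) := by
          rw [Real.exp_neg t]
          field_simp
          norm_num
  rw [integral_const_mul, integral_exp_mul_exp_neg_exp, mul_one] at h1
  rw [eulerField_sub_blobField hα hx, norm_smul, Real.norm_of_nonneg (by positivity)]
  calc _ ≤ (α ^ 2)⁻¹ * (4 * α ^ 4 / ‖x‖ ^ 3) := by gcongr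
    _ = _ := by field_simp

/-- The Euler kernel is the composition of a rotation and an inversion. -/
lemma norm_eulerField_sub {a b : Plane} (ha : a ≠ 0) (hb : b ≠ 0) :
    ‖eulerField a - eulerField b‖ = ‖a - b‖ / (2 * Real.pi * (‖a‖ * ‖b‖)) := by
  have ha' : 0 < ‖a‖ := norm_pos_iff.2 ha
  have hb' : 0 < ‖b‖ := norm_pos_iff.2 hb
  have h1 : eulerField a - eulerField b =
      (2 * Real.pi)⁻¹ • perp ((‖a‖ ^ 2)⁻¹ • a - (‖b‖ ^ 2)⁻¹ • b) := by
    rw [map_sub, map_smul, map_smul, smul_sub, smul_smul, smul_smul, eulerField, eulerField,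
      mul_inv, mul_inv (2 * Real.pi)]
  have h2 : ‖(‖a‖ ^ 2)⁻¹ • a - (‖b‖ ^ 2)⁻¹ • b‖ = ‖a - b‖ / (‖a‖ * ‖b‖) := by
    rw [← sq_eq_sq₀ (norm_nonneg _) (by positivity), div_pow, @norm_sub_sq_real,
      @norm_sub_sq_real, norm_smul, norm_smul, inner_smul_left, inner_smul_right,
      Real.norm_of_nonneg (by positivity), Real.norm_of_nonneg (by positivity)]
    simp only [map_inv₀, map_pow, conj_trivial]
    field_simp
    ring
  rw [h1, norm_smul, norm_perp, h2, Real.norm_of_nonneg (by positivity)]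
  field_simp

/-! ### Identification of the kernels -/

lemma perpGrad_of_hasFDerivAt {f : Plane → ℝ} {a : ℝ} {v x : Plane}
    (h : HasFDerivAt f (a • innerSL ℝ v) x) : perpGrad f x = a • perp v := by
  rw [perpGrad, h.fderiv]
  ext i
  fin_cases i <;>
    simp [perp_apply_zero, perp_apply_one, EuclideanSpace.inner_single_right]

/-- The derivative at a centre of symmetry equals its own negative; where there is no derivative,
`fderiv` is zero by convention. This settles the diagonal values of both kernels. -/
lemma fderiv_eq_zero_of_symm {f : Plane → ℝ} {y : Plane} (h : ∀ v, f (y + v) = f (y - v)) :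
    fderiv ℝ f y = 0 := by
  by_cases hd : DifferentiableAt ℝ f y
  · have h1 : HasFDerivAt (fun z => f (y + (y - z))) (-fderiv ℝ f y) y := by
      have h2 : HasFDerivAt (fun z : Plane => y + (y - z)) (-ContinuousLinearMap.id ℝ Plane) y := by
        simpa using ((hasFDerivAt_id y).const_sub y).const_add y
      have h3 : HasFDerivAt f (fderiv ℝ f y) (y + (y - y)) := by simpa using hd.hasFDerivAt
      simpa [Function.comp_def] using h3.comp y h2
    have h4 : (fun z => f (y + (y - z))) = f := by
      funext z; rw [h]; congr 1; abel
    rw [h4] at h1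
    have h5 := hd.hasFDerivAt.unique h1
    have h6 : (2 : ℝ) • fderiv ℝ f y = 0 := by
      rw [two_smul]; nth_rewrite 1 [h5]; simp
    exact (smul_eq_zero.1 h6).resolve_left two_ne_zero
  · exact fderiv_zero_of_not_differentiableAt hd

lemma perpGrad_radial_self (g : ℝ → ℝ) (y : Plane) :
    perpGrad (fun z => g ‖z - y‖) y = 0 := by
  have h := fderiv_eq_zero_of_symm (f := fun z => g ‖z - y‖) (y := y) (fun v => by simp)
  rw [perpGrad, h]
  ext i
  fin_cases i <;> simp

lemma perpGrad_radial {g : ℝ → ℝ} {g' : ℝ} {x y : Plane} (hxy : x - y ≠ 0)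
    (h : HasDerivAt g g' ‖x - y‖) :
    perpGrad (fun z => g ‖z - y‖) x = (g' / ‖x - y‖) • perp (x - y) := by
  have hr : 0 < ‖x - y‖ := norm_pos_iff.2 hxy
  have h1 : HasFDerivAt (fun z : Plane => ‖z - y‖ ^ 2) ((2 : ℝ) • innerSL ℝ (x - y)) x := by
    have h0 := (hasStrictFDerivAt_norm_sq (x - y)).hasFDerivAt
    rw [← Nat.cast_smul_eq_nsmul ℝ, Nat.cast_ofNat] at h0
    simpa [Function.comp_def] using h0.comp x ((hasFDerivAt_id x).sub_const y)
  have h2 : HasFDerivAt (fun z : Plane => ‖z - y‖) (‖x - y‖⁻¹ • innerSL ℝ (x - y)) x := by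
    have h3 := h1.sqrt (by positivity)
    simp only [Real.sqrt_sq (norm_nonneg _), smul_smul] at h3
    convert! h3 using 2
    field_simp
  have h4 := h.comp_hasFDerivAt x h2
  rw [smul_smul, ← div_eq_mul_inv] at h4
  exact perpGrad_of_hasFDerivAt h4

lemma eulerKernel_eq (x y : Plane) : eulerKernel x y = eulerField (x - y) := by
  rcases eq_or_ne x y with rfl | hxy
  · rw [eulerKernel, perpGrad_radial_self (fun r => 1 / (2 * Real.pi) * Real.log r)]
    simp [eulerField]
  · have hr : 0 < ‖x - y‖ := norm_pos_iff.2 (sub_ne_zero.2 hxy)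
    rw [eulerKernel, perpGrad_radial (g := fun r => 1 / (2 * Real.pi) * Real.log r)
      (sub_ne_zero.2 hxy) ((Real.hasDerivAt_log hr.ne').const_mul _), eulerField]
    congr 1
    field_simp

lemma blobKernel_eq {α : ℝ} (hα : 0 < α) (x y : Plane) :
    blobKernel α x y = blobField α (x - y) := by
  rcases eq_or_ne x y with rfl | hxy
  · rw [blobKernel, perpGrad_radial_self (blobGreen α), sub_self, blobField_zero]
  have hz : x - y ≠ 0 := sub_ne_zero.2 hxy
  set r := ‖x - y‖ with hrdef
  have hr : 0 < r := norm_pos_iff.2 hz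
  set I : ℝ := ∫ t : ℝ, Real.exp (-Real.exp t) *
      (Real.exp (-t) * Real.exp (-((r / α) ^ 2 / 4 * Real.exp (-t)))) with hI
  have hd : HasDerivAt (blobGreen α)
      (1 / (2 * Real.pi) * (-(r / α / 4 * I) * (1 / α) + r⁻¹)) r := by
    have h1 := (hasDerivAt_besselK0 (s := r / α) (by positivity)).comp r
      ((hasDerivAt_id r).div_const α)
    exact (h1.add (Real.hasDerivAt_log hr.ne')).const_mul _
  rw [blobKernel, perpGrad_radial hz hd, ← hrdef]
  have hdiff := eulerField_sub_blobField hα hz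
  -- Once the common direction is taken out, the difference between the Euler and blob fields is
  -- governed by the integral in the derivative of K₀ at r/α.
  have h3 : (∫ t, (Real.exp (-Real.exp t) * (Real.exp (-t) / (8 * Real.pi))) •
      gaussVortex (blobRate α t) (x - y)) = ((8 * Real.pi)⁻¹ * I) • perp (x - y) := by
    simp only [gaussVortex, smul_smul]
    rw [integral_smul_const, hI, ← integral_const_mul]
    congr 2
    funext t
    have : blobRate α t * ‖x - y‖ ^ 2 = (r / α) ^ 2 / 4 * Real.exp (-t) := by
      unfold blobRate; rw [← hrdef]; field_simp
    rw [this]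
    ring
  rw [h3] at hdiff
  have h4 : blobField α (x - y) = eulerField (x - y) -
      (α ^ 2)⁻¹ • ((8 * Real.pi)⁻¹ * I) • perp (x - y) := by
    rw [← hdiff]; abel
  rw [h4, eulerField, ← hrdef, smul_smul, ← sub_smul]
  congr 1
  field_simp
  ring

/-! ### Integration against a difference of two finite measures -/

section PairIntegral

variable {E : Type*} [NormedAddCommGroup E] [NormedSpace ℝ E]

/-- The integral against the signed measure `μ - ν`. -/
def pairIntegral (μ ν : Measure Plane) (f : Plane → E) : E := (∫ y, f y ∂μ) - ∫ y, f y ∂ν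

/-- The total mass of `μ + ν`. -/
def pairMass (μ ν : Measure Plane) : ℝ := μ.real Set.univ + ν.real Set.univ

lemma pairMass_nonneg (μ ν : Measure Plane) : 0 ≤ pairMass μ ν :=
  add_nonneg measureReal_nonneg measureReal_nonneg

variable {μ ν : Measure Plane}

lemma norm_pairIntegral_le [IsFiniteMeasure μ] [IsFiniteMeasure ν] {f : Plane → E} {c : ℝ}
    (h : ∀ y, ‖f y‖ ≤ c) :
    ‖pairIntegral μ ν f‖ ≤ c * pairMass μ ν := by
  have h1 := norm_integral_le_of_norm_le_const (μ := μ) (.of_forall h)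
  have h2 := norm_integral_le_of_norm_le_const (μ := ν) (.of_forall h)
  rw [pairMass, mul_add]
  exact (norm_sub_le _ _).trans (add_le_add h1 h2)

lemma pairIntegral_sub {f g : Plane → E} (hf : Integrable f μ) (hf' : Integrable f ν)
    (hg : Integrable g μ) (hg' : Integrable g ν) :
    pairIntegral μ ν f - pairIntegral μ ν g = pairIntegral μ ν fun y => f y - g y := by
  rw [pairIntegral, pairIntegral, pairIntegral, integral_sub hf hg, integral_sub hf' hg']
  abel

lemma integrable_of_continuous_of_bounded {E : Type*} [NormedAddCommGroup E]
    [SecondCountableTopology E] [IsFiniteMeasure μ] {f : Plane → E} (hf : Continuous f)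
    {c : ℝ} (h : ∀ y, ‖f y‖ ≤ c) : Integrable f μ :=
  Integrable.of_bound hf.aestronglyMeasurable c (.of_forall h)

end PairIntegral

/-! ### The Lagrangian vector field -/

/-- Bounded displacement fields of the plane. -/
abbrev Disp : Type := Plane →ᵇ Plane

/-- The map `x ↦ x + X x` with displacement `X`. -/
def dispMap (X : Disp) : C(Plane, Plane) := ⟨fun x => x + X x, by fun_prop⟩

@[simp]
lemma dispMap_apply (X : Disp) (x : Plane) : dispMap X x = x + X x := rfl

lemma continuous_pairIntegral_comp (k : Disp) (μ ν : Measure Plane) [IsFiniteMeasure μ]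
    [IsFiniteMeasure ν] (z : C(Plane, Plane)) :
    Continuous fun p : Plane => pairIntegral μ ν fun y => k (p - z y) := by
  have h : ∀ (μ : Measure Plane) [IsFiniteMeasure μ],
      Continuous fun p : Plane => ∫ y, k (p - z y) ∂μ := fun μ _ =>
    continuous_of_dominated (bound := fun _ => ‖k‖)
      (fun p => (by fun_prop : Continuous fun y => k (p - z y)).aestronglyMeasurable)
      (fun p => .of_forall fun y => k.norm_coe_le_norm _) (integrable_const _)
      (.of_forall fun y => by fun_prop)
  exact (h μ).sub (h ν)

/-- The velocity of the particle labelled `x`, when the particles have displacement `X` and the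
vorticity `μ - ν` is transported by `g` and then by `x ↦ x + X x`. -/
def lagField (k : Disp) (μ ν : Measure Plane) [IsFiniteMeasure μ] [IsFiniteMeasure ν]
    (g : C(Plane, Plane)) (X : Disp) : Disp :=
  BoundedContinuousFunction.ofNormedAddCommGroup
    (fun x => pairIntegral μ ν fun y => k (dispMap X x - dispMap X (g y)))
    ((continuous_pairIntegral_comp k μ ν ((dispMap X).comp g)).comp (dispMap X).continuous)
    (‖k‖ * pairMass μ ν) (fun _ => norm_pairIntegral_le fun _ => k.norm_coe_le_norm _)

section LagField

variable {k : Disp} {μ ν : Measure Plane} [IsFiniteMeasure μ] [IsFiniteMeasure ν]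
  {g : C(Plane, Plane)}

lemma lagField_apply (X : Disp) (x : Plane) :
    lagField k μ ν g X x = pairIntegral μ ν fun y => k (dispMap X x - dispMap X (g y)) := rfl

lemma norm_lagField_le (X : Disp) : ‖lagField k μ ν g X‖ ≤ ‖k‖ * pairMass μ ν :=
  BoundedContinuousFunction.norm_ofNormedAddCommGroup_le _
    (mul_nonneg (norm_nonneg _) (pairMass_nonneg μ ν)) _

lemma integrable_kernel_comp (k : Disp) (z : C(Plane, Plane)) (p : Plane)
    (μ : Measure Plane) [IsFiniteMeasure μ] : Integrable (fun y => k (p - z y)) μ :=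
  integrable_of_continuous_of_bounded (by fun_prop) fun _ => k.norm_coe_le_norm _

lemma norm_lagField_sub_le {k' : Disp} {X Y : Disp} {c : ℝ} (hc : 0 ≤ c)
    (h : ∀ x y, ‖k (dispMap X x - dispMap X y) - k' (dispMap Y x - dispMap Y y)‖ ≤ c) :
    ‖lagField k μ ν g X - lagField k' μ ν g Y‖ ≤ c * pairMass μ ν := by
  rw [BoundedContinuousFunction.norm_le (mul_nonneg hc (pairMass_nonneg μ ν))]
  intro x
  rw [BoundedContinuousFunction.sub_apply, lagField_apply, lagField_apply]
  refine (congrArg norm (pairIntegral_sub (integrable_kernel_comp k ((dispMap X).comp g) _ _)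
    (integrable_kernel_comp k ((dispMap X).comp g) _ _)
    (integrable_kernel_comp k' ((dispMap Y).comp g) _ _)
    (integrable_kernel_comp k' ((dispMap Y).comp g) _ _))).trans_le ?_
  exact norm_pairIntegral_le fun y => h x (g y)

lemma norm_dispMap_sub_sub_le (X Y : Disp) (x y : Plane) :
    ‖dispMap X x - dispMap X y - (dispMap Y x - dispMap Y y)‖ ≤ 2 * ‖X - Y‖ := by
  have h1 := (X - Y).norm_coe_le_norm x
  have h2 := (X - Y).norm_coe_le_norm y
  have : dispMap X x - dispMap X y - (dispMap Y x - dispMap Y y) = (X - Y) x - (X - Y) y := by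
    simp only [dispMap_apply, BoundedContinuousFunction.sub_apply]; abel
  rw [this]
  exact (norm_sub_le _ _).trans (by linarith)

lemma norm_lagField_sub_le_logMod {C : ℝ} (hC : 0 ≤ C)
    (hk : ∀ (N : ℕ) a b, ‖k a - k b‖ ≤ C * logMod N ‖a - b‖) (N : ℕ) (X Y : Disp) :
    ‖lagField k μ ν g X - lagField k μ ν g Y‖ ≤ 2 * C * pairMass μ ν * logMod N ‖X - Y‖ := by
  have h := norm_lagField_sub_le (k := k) (k' := k) (μ := μ) (ν := ν) (g := g) (X := X) (Y := Y)
    (c := C * (2 * logMod N ‖X - Y‖))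
    (mul_nonneg hC (mul_nonneg zero_le_two (logMod_nonneg N (norm_nonneg _)))) (fun x y => by
      refine (hk N _ _).trans (mul_le_mul_of_nonneg_left ?_ hC)
      exact (logMod_mono N (norm_dispMap_sub_sub_le X Y x y)).trans
        (logMod_le_mul N one_le_two))
  linarith

lemma norm_lagField_kernel_sub_le (k k' : Disp) (X : Disp) :
    ‖lagField k μ ν g X - lagField k' μ ν g X‖ ≤ ‖k - k'‖ * pairMass μ ν :=
  norm_lagField_sub_le (norm_nonneg _) fun _ _ => (k - k').norm_coe_le_norm _

lemma lipschitzWith_lagField {L : ℝ} (hL : 0 ≤ L) (hk : ∀ a b, ‖k a - k b‖ ≤ L * ‖a - b‖) :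
    LipschitzWith (2 * L * pairMass μ ν).toNNReal (lagField k μ ν g) := by
  refine LipschitzWith.of_dist_le_mul fun X Y => ?_
  have hm := pairMass_nonneg μ ν
  rw [dist_eq_norm, dist_eq_norm, Real.coe_toNNReal _ (by positivity)]
  have h := norm_lagField_sub_le (k := k) (k' := k) (μ := μ) (ν := ν) (g := g) (X := X) (Y := Y)
    (c := L * (2 * ‖X - Y‖)) (by positivity) (fun x y =>
      (hk _ _).trans (mul_le_mul_of_nonneg_left (norm_dispMap_sub_sub_le X Y x y) hL))
  linarith

end LagField

/-! ### Volume of images -/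

/-- The term linear in s is the trace, which vanishes; only s² det A is left. -/
lemma det_one_add_smul (A : Plane →L[ℝ] Plane) (hA : planeTrace A = 0) (s : ℝ) :
    (ContinuousLinearMap.id ℝ Plane + s • A).det = 1 + s ^ 2 *
      (A (EuclideanSpace.single 0 1) 0 * A (EuclideanSpace.single 1 1) 1 -
        A (EuclideanSpace.single 1 1) 0 * A (EuclideanSpace.single 0 1) 1) := by
  rw [planeTrace_apply] at hA
  rw [ContinuousLinearMap.det, ← LinearMap.det_toMatrix (EuclideanSpace.basisFun (Fin 2) ℝ).toBasis,
    Matrix.det_fin_two]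
  simp [LinearMap.toMatrix_apply]
  linear_combination s * hA

lemma abs_apply_single_le (A : Plane →L[ℝ] Plane) (i j : Fin 2) :
    |A (EuclideanSpace.single i 1) j| ≤ ‖A‖ := by
  have h1 := A.le_opNorm (EuclideanSpace.single i 1)
  have h2 := PiLp.norm_apply_le (A (EuclideanSpace.single i (1 : ℝ))) j
  simp only [PiLp.norm_single, norm_one, mul_one] at h1
  exact h2.trans h1

lemma le_abs_det_one_add_smul {A : Plane →L[ℝ] Plane} (hA : planeTrace A = 0) {L : ℝ}
    (hL : ‖A‖ ≤ L) (s : ℝ) :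
    1 - 2 * (s * L) ^ 2 ≤ |(ContinuousLinearMap.id ℝ Plane + s • A).det| := by
  rw [det_one_add_smul A hA]
  have hb : ∀ i j i' j' : Fin 2,
      |A (EuclideanSpace.single i 1) j * A (EuclideanSpace.single i' 1) j'|
      ≤ L ^ 2 := by
    intro i j i' j'
    rw [abs_mul, sq]
    exact mul_le_mul ((abs_apply_single_le A i j).trans hL) ((abs_apply_single_le A i' j').trans hL)
      (abs_nonneg _) ((norm_nonneg _).trans hL)
  have h1 := abs_le.1 (hb 0 0 1 1)
  have h2 := abs_le.1 (hb 1 0 0 1)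
  refine le_trans ?_ (le_abs_self _)
  nlinarith [sq_nonneg s]

/-- A step along a divergence-free vector field decreases volumes only to second order. -/
lemma volume_image_step_ge {u : Plane → Plane} {L s : ℝ}
    (hu : ∀ x, ∃ A, HasFDerivAt u A x ∧ ‖A‖ ≤ L ∧ planeTrace A = 0) (hs : |s| * L < 1)
    {S : Set Plane} (hS : MeasurableSet S) :
    ENNReal.ofReal (1 - 2 * (s * L) ^ 2) * volume S ≤ volume ((fun x => x + s • u x) '' S) := by
  choose A hA hAL hAt using hu
  have hd : ∀ x, HasFDerivAt (fun x => x + s • u x) (ContinuousLinearMap.id ℝ Plane + s • A x) x :=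
    fun x => (hasFDerivAt_id x).fun_add ((hA x).fun_const_smul s)
  -- Since |s| L < 1 the displacement of the step is a contraction, so the step is injective and the
  -- area formula applies.
  have hinj : Function.Injective fun x => x + s • u x := by
    intro x y hxy
    have h1 := Convex.norm_image_sub_le_of_norm_hasFDerivWithin_le (s := Set.univ)
      (fun x _ => (hA x).hasFDerivWithinAt) (fun x _ => hAL x) convex_univ (Set.mem_univ y)
      (Set.mem_univ x)
    have h2 : x - y = -(s • (u x - u y)) := by
      have : x + s • u x = y + s • u y := hxy
      rw [smul_sub, eq_neg_iff_add_eq_zero, ← sub_eq_zero.2 this]; abel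
    have h3 : ‖x - y‖ ≤ |s| * L * ‖x - y‖ := by
      calc ‖x - y‖ = |s| * ‖u x - u y‖ := by
            conv_lhs => rw [h2]
            rw [norm_neg, norm_smul, Real.norm_eq_abs]
        _ ≤ |s| * (L * ‖x - y‖) := by gcongr
        _ = _ := by ring
    have h4 : ‖x - y‖ ≤ 0 := by nlinarith [norm_nonneg (x - y)]
    exact sub_eq_zero.1 (norm_le_zero_iff.1 h4)
  rw [← lintegral_abs_det_fderiv_eq_addHaar_image volume hS
    (fun x _ => (hd x).hasFDerivWithinAt) hinj.injOn, ← setLIntegral_const]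
  exact lintegral_mono fun x => ENNReal.ofReal_le_ofReal (le_abs_det_one_add_smul (hAt x) (hAL x) s)

/-- Lower bounds for volumes of images of compact sets pass to uniform limits. -/
lemma volume_le_image_of_tendsto {Y : ℕ → Disp} {X : Disp} (hY : Tendsto Y atTop (𝓝 X))
    {c : ℕ → ℝ} (hc : Tendsto c atTop (𝓝 1)) {A : Set Plane} (hA : IsCompact A)
    (h : ∀ᶠ n in atTop, ENNReal.ofReal (c n) * volume A ≤ volume (dispMap (Y n) '' A)) :
    volume A ≤ volume (dispMap X '' A) := by
  have hAX : IsCompact (dispMap X '' A) := hA.image (dispMap X).continuous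
  have hdist : Tendsto (fun n => ‖Y n - X‖) atTop (𝓝 0) := tendsto_iff_norm_sub_tendsto_zero.1 hY
  -- The images under `Y n` lie in closed thickenings of the compact limit image, whose volumes
  -- decrease to its volume. Only this semicontinuity is available, hence only lower bounds are
  -- carried to the limit.
  have h1 := (tendsto_measure_cthickening_of_isCompact (μ := volume) hAX).comp hdist
  have h2 : Tendsto (fun n => ENNReal.ofReal (c n) * volume A) atTop (𝓝 (volume A)) := by
    have h3 := ENNReal.tendsto_ofReal hc
    rw [ENNReal.ofReal_one] at h3
    simpa using ENNReal.Tendsto.mul_const (b := volume A) h3 (Or.inr hA.measure_lt_top.ne)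
  refine le_of_tendsto_of_tendsto h2 h1 ?_
  filter_upwards [h] with n hn
  refine hn.trans (measure_mono ?_)
  rintro _ ⟨x, hx, rfl⟩
  refine Metric.mem_cthickening_of_dist_le _ (dispMap X x) _ _ ⟨x, hx, rfl⟩ ?_
  rw [dist_eq_norm]
  have : dispMap (Y n) x - dispMap X x = (Y n - X) x := by simp
  rw [this]
  exact (Y n - X).norm_coe_le_norm x

/-! ### Area under the flow of a smooth kernel -/

/-- A kernel is smooth when it is differentiable with bounded and trace-free derivative. -/
def SmoothKernel (k : Disp) (L : ℝ) : Prop :=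
  ∀ x, ∃ A : Plane →L[ℝ] Plane, HasFDerivAt k A x ∧ ‖A‖ ≤ L ∧ planeTrace A = 0

lemma SmoothKernel.nonneg {k : Disp} {L : ℝ} (hk : SmoothKernel k L) : 0 ≤ L := by
  obtain ⟨A, _, hA, _⟩ := hk 0
  exact (norm_nonneg _).trans hA

lemma SmoothKernel.norm_sub_le {k : Disp} {L : ℝ} (hk : SmoothKernel k L) (a b : Plane) :
    ‖k a - k b‖ ≤ L * ‖a - b‖ := by
  choose A hA hAL _ using hk
  exact Convex.norm_image_sub_le_of_norm_hasFDerivWithin_le (s := Set.univ)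
    (fun x _ => (hA x).hasFDerivWithinAt) (fun x _ => hAL x) convex_univ (Set.mem_univ b)
    (Set.mem_univ a)

section Smooth

variable {k : Disp} {L : ℝ} {μ ν : Measure Plane} [IsFiniteMeasure μ] [IsFiniteMeasure ν]

lemma SmoothKernel.hasFDerivAt_pairIntegral (hk : SmoothKernel k L) (z : C(Plane, Plane))
    (p : Plane) :
    ∃ A : Plane →L[ℝ] Plane, HasFDerivAt (fun p => pairIntegral μ ν fun y => k (p - z y)) A p ∧
      ‖A‖ ≤ L * pairMass μ ν ∧ planeTrace A = 0 := by
  have hd : ∀ x, HasFDerivAt k (fderiv ℝ k x) x := fun x => by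
    obtain ⟨A, hA, _⟩ := hk x
    exact hA.differentiableAt.hasFDerivAt
  have hb : ∀ x, ‖fderiv ℝ k x‖ ≤ L := fun x => by
    obtain ⟨A, hA, hAL, _⟩ := hk x
    rwa [hA.fderiv]
  have ht : ∀ x, planeTrace (fderiv ℝ k x) = 0 := fun x => by
    obtain ⟨A, hA, _, hAt⟩ := hk x
    rwa [hA.fderiv]
  have : ProperSpace (Plane →L[ℝ] Plane) := FiniteDimensional.proper ℝ _
  have hmeas : StronglyMeasurable fun y => fderiv ℝ k (p - z y) :=
    ((measurable_fderiv ℝ k).comp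
      (by fun_prop : Continuous fun y => p - z y).measurable).stronglyMeasurable
  have hD : ∀ (μ : Measure Plane) [IsFiniteMeasure μ],
      HasFDerivAt (fun p => ∫ y, k (p - z y) ∂μ) (∫ y, fderiv ℝ k (p - z y) ∂μ) p := fun μ _ =>
    hasFDerivAt_integral_of_dominated_of_fderiv_le (μ := μ) (s := Set.univ)
      (F := fun p y => k (p - z y)) (F' := fun p y => fderiv ℝ k (p - z y)) (bound := fun _ => L)
      univ_mem
      (.of_forall fun p => (integrable_kernel_comp k z p μ).aestronglyMeasurable)
      (integrable_kernel_comp k z p μ) hmeas.aestronglyMeasurable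
      (.of_forall fun y p _ => hb _) (integrable_const _)
      (.of_forall fun y p _ => by
        simpa [Function.comp_def] using (hd (p - z y)).comp p ((hasFDerivAt_id p).sub_const (z y)))
  have hinteg : ∀ (μ : Measure Plane) [IsFiniteMeasure μ],
      Integrable (fun y => fderiv ℝ k (p - z y)) μ := fun μ _ =>
    Integrable.of_bound hmeas.aestronglyMeasurable L (.of_forall fun y => hb _)
  refine ⟨pairIntegral μ ν fun y => fderiv ℝ k (p - z y), (hD μ).sub (hD ν),
    norm_pairIntegral_le fun y => hb _, ?_⟩
  rw [pairIntegral, map_sub, ← ContinuousLinearMap.integral_comp_comm _ (hinteg μ),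
    ← ContinuousLinearMap.integral_comp_comm _ (hinteg ν)]
  simp [ht]

lemma SmoothKernel.volume_euler_scheme_ge (hk : SmoothKernel k L) (g : C(Plane, Plane)) {s : ℝ}
    (hs : |s| * (L * pairMass μ ν) < 1) (n : ℕ) {A : Set Plane} (hA : IsCompact A) :
    ENNReal.ofReal (1 - 2 * (s * (L * pairMass μ ν)) ^ 2) ^ n * volume A ≤
      volume (dispMap ((fun Y => Y + s • lagField k μ ν g Y)^[n] 0) '' A) := by
  induction n with
  | zero =>
    have : (dispMap (0 : Disp) : Plane → Plane) = id := by funext x; simp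
    simp [this]
  | succ n ih =>
    rw [Function.iterate_succ_apply']
    set Y := (fun Y => Y + s • lagField k μ ν g Y)^[n] 0
    have h1 := volume_image_step_ge (s := s)
      (fun p => hk.hasFDerivAt_pairIntegral (μ := μ) (ν := ν) ((dispMap Y).comp g) p) hs
      (hA.image (dispMap Y).continuous).measurableSet
    rw [← Set.image_comp] at h1
    -- An Euler step in `Disp` amounts to composition with one step of the plane along the frozen
    -- divergence-free velocity.
    have h2 : (dispMap (Y + s • lagField k μ ν g Y) : Plane → Plane) =
        (fun p => p + s • pairIntegral μ ν fun y => k (p - ((dispMap Y).comp g) y)) ∘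
          dispMap Y := by
      funext x
      simp only [dispMap_apply, BoundedContinuousFunction.add_apply,
        BoundedContinuousFunction.smul_apply, Function.comp_apply, ContinuousMap.comp_apply,
        lagField_apply]
      abel
    rw [h2]
    refine le_trans ?_ h1
    rw [pow_succ', mul_assoc]
    gcongr

lemma SmoothKernel.volume_le_image (hk : SmoothKernel k L) {g : C(Plane, Plane)} {X : ℝ → Disp}
    (h0 : X 0 = 0) (hX : ∀ t, HasDerivAt X (lagField k μ ν g (X t)) t) (t : ℝ) {A : Set Plane}
    (hA : IsCompact A) : volume A ≤ volume (dispMap (X t) '' A) := by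
  have hE := tendsto_euler_scheme (lipschitzWith_lagField (μ := μ) (ν := ν) (g := g) hk.nonneg
    hk.norm_sub_le) norm_lagField_le hX t
  rw [h0] at hE
  set m := L * pairMass μ ν with hm
  have hcast : Tendsto (fun n : ℕ => (n : ℝ) + 1) atTop atTop :=
    tendsto_atTop_add_const_right _ _ tendsto_natCast_atTop_atTop
  have hc : Tendsto (fun n : ℕ => 1 - 2 * (t * m) ^ 2 / ((n : ℝ) + 1)) atTop (𝓝 1) := by
    simpa using (tendsto_const_nhds.div_atTop hcast).const_sub (1 : ℝ)
  refine volume_le_image_of_tendsto hE hc hA ?_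
  filter_upwards [hcast.eventually_gt_atTop (|t| * m), hcast.eventually_gt_atTop (2 * (t * m) ^ 2)]
    with n hn hn2
  have hn0 : (0 : ℝ) < n + 1 := by positivity
  have hs : |t / ((n : ℝ) + 1)| * m < 1 := by
    rw [abs_div, abs_of_pos hn0, div_mul_eq_mul_div, div_lt_one hn0]
    exact hn
  refine le_trans ?_ (hk.volume_euler_scheme_ge g hs (n + 1) hA)
  gcongr
  have hq : 2 * (t / ((n : ℝ) + 1) * m) ^ 2 = 2 * (t * m) ^ 2 / (n + 1) ^ 2 := by
    field_simp
  have hq1 : 2 * (t * m) ^ 2 / ((n : ℝ) + 1) ^ 2 ≤ 1 := by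
    rw [div_le_one (by positivity)]
    nlinarith
  rw [hq, ← ENNReal.ofReal_pow (by linarith)]
  refine ENNReal.ofReal_le_ofReal ?_
  -- Bernoulli: with n + 1 steps, each losing a fraction 2(tm)²/(n + 1)² at most, the total loss is
  -- at most 2(tm)²/(n + 1).
  have hB := one_add_mul_le_pow (a := -(2 * (t * m) ^ 2 / ((n : ℝ) + 1) ^ 2)) (by linarith) (n + 1)
  rw [← sub_eq_add_neg 1] at hB
  refine le_trans (le_of_eq ?_) hB
  push_cast
  field_simp
  ring

end Smooth

/-! ### Flows of admissible kernels -/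

lemma continuous_of_logMod {E F : Type*} [SeminormedAddCommGroup E] [SeminormedAddCommGroup F]
    {f : E → F} {C : ℝ} (hC : 0 ≤ C)
    (h : ∀ (N : ℕ) a b, ‖f a - f b‖ ≤ C * logMod N ‖a - b‖) : Continuous f := by
  rw [Metric.continuous_iff]
  intro b ε hε
  obtain ⟨δ, hδ, N, hN⟩ := exists_logMod_le hC (half_pos hε)
  refine ⟨δ, hδ, fun a ha => ?_⟩
  rw [dist_eq_norm] at ha ⊢
  exact ((h N a b).trans (hN _ ha.le)).trans_lt (half_lt_self hε)

/-- A curve of displacement fields with pointwise derivative depending continuously on time is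
differentiable in the supremum norm. -/
lemma hasDerivAt_disp {X V : ℝ → Disp} (hV : Continuous V)
    (h : ∀ t x, HasDerivAt (fun s => X s x) (V t x) t) (t : ℝ) : HasDerivAt X (V t) t := by
  have hY : ∀ t, HasDerivAt (fun t => X 0 + ∫ s in (0 : ℝ)..t, V s) (V t) t := fun t =>
    (intervalIntegral.integral_hasDerivAt_right (hV.intervalIntegrable 0 t)
      (hV.stronglyMeasurableAtFilter _ _) hV.continuousAt).const_add _
  -- The integral of V in `Disp` has the same pointwise derivative as X, so the two agree at each
  -- label.
  have heq : X = fun t => X 0 + ∫ s in (0 : ℝ)..t, V s := by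
    funext t
    ext1 x
    have hd : ∀ r, HasDerivAt (fun r => X r x - (X 0 + ∫ s in (0 : ℝ)..r, V s) x) 0 r := fun r => by
      have h1 := (BoundedContinuousFunction.evalCLM ℝ x (α := Plane)
        (β := Plane)).hasFDerivAt.comp_hasDerivAt
        r (hY r)
      simpa [Function.comp_def] using (h r x).fun_sub h1
    have hc := is_const_of_deriv_eq_zero (fun r => (hd r).differentiableAt)
      (fun r => (hd r).deriv) t 0
    simpa [sub_eq_zero] using hc
  rw [heq]
  exact hY t

/-- Two measures on the plane that agree on compact sets are equal. -/
lemma measure_ext_of_isCompact {μ ν : Measure Plane} [IsFiniteMeasureOnCompacts μ]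
    (h : ∀ K, IsCompact K → μ K = ν K) : μ = ν := by
  have hclosed : ∀ F, IsClosed F → μ F = ν F := by
    intro F hF
    have hF' : F = ⋃ n : ℕ, F ∩ Metric.closedBall 0 n := by
      rw [← Set.inter_iUnion, Metric.iUnion_closedBall_nat, Set.inter_univ]
    have hm : Monotone fun n : ℕ => F ∩ Metric.closedBall (0 : Plane) n := fun m n hmn =>
      Set.inter_subset_inter_right _ (Metric.closedBall_subset_closedBall (by exact_mod_cast hmn))
    rw [hF', hm.measure_iUnion, hm.measure_iUnion]
    congr 1
    funext n
    exact h _ ((isCompact_closedBall _ _).inter_left hF)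
  refine Measure.ext_of_generateFrom_of_iUnion {s | IsClosed s} (fun n : ℕ => Metric.closedBall 0 n)
    ?_ isPiSystem_isClosed (Metric.iUnion_closedBall_nat 0) (fun n => Metric.isClosed_closedBall)
    (fun n => (isCompact_closedBall _ _).measure_lt_top.ne) hclosed
  rw [BorelSpace.measurable_eq (α := Plane), borel_eq_generateFrom_isClosed]

/-- A bounded log-Lipschitz kernel that is a uniform limit of smooth kernels. -/
structure AdmissibleKernel (k : Disp) (C : ℝ) : Prop where
  pos : 0 < C
  logLip : ∀ (N : ℕ) a b, ‖k a - k b‖ ≤ C * logMod N ‖a - b‖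
  approx : ∃ kn : ℕ → Disp, Tendsto kn atTop (𝓝 k) ∧ ∀ n, ∃ L, SmoothKernel (kn n) L

namespace AdmissibleKernel

variable {k : Disp} {C : ℝ} {μ ν : Measure Plane} [IsFiniteMeasure μ] [IsFiniteMeasure ν]
  {g : C(Plane, Plane)}

lemma lagField_logLip (hk : AdmissibleKernel k C) (N : ℕ) (X Y : Disp) :
    ‖lagField k μ ν g X - lagField k μ ν g Y‖ ≤
      (2 * C * pairMass μ ν + 1) * logMod N ‖X - Y‖ := by
  have h1 := norm_lagField_sub_le_logMod (μ := μ) (ν := ν) (g := g) hk.pos.le hk.logLip N X Y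
  have h2 := logMod_nonneg N (norm_nonneg (X - Y))
  linarith

/-- The summand 1 keeps the constant positive when the total mass is zero, as the Osgood estimates
require. -/
lemma lagConst_pos (hk : AdmissibleKernel k C) (μ ν : Measure Plane) :
    0 < 2 * C * pairMass μ ν + 1 := by
  have := hk.pos
  have := pairMass_nonneg μ ν
  positivity

lemma unique (hk : AdmissibleKernel k C) {X Y : ℝ → Disp}
    (hX : ∀ t, HasDerivAt X (lagField k μ ν g (X t)) t)
    (hY : ∀ t, HasDerivAt Y (lagField k μ ν g (Y t)) t) (h0 : X 0 = Y 0) : X = Y :=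
  logLipschitz_ode_unique (hk.lagConst_pos μ ν) (fun N => hk.lagField_logLip N) hX hY h0

/-- The flows of the smooth approximations converge by Osgood stability, and their area bound
survives the uniform limit. -/
lemma exists_solution (hk : AdmissibleKernel k C) (μ ν : Measure Plane) [IsFiniteMeasure μ]
    [IsFiniteMeasure ν] (g : C(Plane, Plane)) :
    ∃ X : ℝ → Disp, X 0 = 0 ∧ (∀ t, HasDerivAt X (lagField k μ ν g (X t)) t) ∧
      ∀ t A, IsCompact A → volume A ≤ volume (dispMap (X t) '' A) := by
  obtain ⟨kn, hkn, hsm⟩ := hk.approx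
  choose L hL using hsm
  have hex : ∀ n, ∃ X : ℝ → Disp, X 0 = 0 ∧ ∀ t, HasDerivAt X (lagField (kn n) μ ν g (X t)) t :=
    fun n => exists_global_solution_of_lipschitz
      (lipschitzWith_lagField (hL n).nonneg (hL n).norm_sub_le) norm_lagField_le 0
  choose X h0 hX using hex
  have hδ : Tendsto (fun n => ‖kn n - k‖ * pairMass μ ν) atTop (𝓝 0) := by
    simpa using (tendsto_iff_norm_sub_tendsto_zero.1 hkn).mul_const (pairMass μ ν)
  obtain ⟨Y, hY0, hY, hlim⟩ := exists_limit_solution (hk.lagConst_pos μ ν)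
    (F := lagField k μ ν g) (fun N => hk.lagField_logLip N) hδ
    (fun n X => norm_lagField_kernel_sub_le (kn n) k X) h0 hX
  refine ⟨Y, hY0, hY, fun t A hA => ?_⟩
  refine volume_le_image_of_tendsto (hlim t) (c := fun _ => 1) tendsto_const_nhds hA
    (.of_forall fun n => ?_)
  simpa using (hL n).volume_le_image (h0 n) (hX n) t hA

/-- The displacement of the flow of an admissible kernel. -/
def disp (hk : AdmissibleKernel k C) (μ ν : Measure Plane) [IsFiniteMeasure μ]
    [IsFiniteMeasure ν] (g : C(Plane, Plane)) : ℝ → Disp :=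
  (hk.exists_solution μ ν g).choose

lemma disp_zero (hk : AdmissibleKernel k C) : hk.disp μ ν g 0 = 0 :=
  (hk.exists_solution μ ν g).choose_spec.1

lemma hasDerivAt_disp (hk : AdmissibleKernel k C) (t : ℝ) :
    HasDerivAt (hk.disp μ ν g) (lagField k μ ν g (hk.disp μ ν g t)) t :=
  (hk.exists_solution μ ν g).choose_spec.2.1 t

lemma volume_le_image_disp (hk : AdmissibleKernel k C) (t : ℝ) {A : Set Plane}
    (hA : IsCompact A) : volume A ≤ volume (dispMap (hk.disp μ ν g t) '' A) :=
  (hk.exists_solution μ ν g).choose_spec.2.2 t A hA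

lemma dispMap_disp_zero (hk : AdmissibleKernel k C) :
    dispMap (hk.disp μ ν g 0) = ContinuousMap.id Plane := by
  ext1 x; simp [disp_zero]

/-- The cocycle property of the flow. -/
lemma dispMap_disp_add (hk : AdmissibleKernel k C) (s t : ℝ) :
    dispMap (hk.disp μ ν g (s + t)) =
      (dispMap (hk.disp μ ν ((dispMap (hk.disp μ ν g s)).comp g) t)).comp
        (dispMap (hk.disp μ ν g s)) := by
  set X := hk.disp μ ν g with hXdef
  set φ := dispMap (X s) with hφ
  set Z := hk.disp μ ν (φ.comp g) with hZ
  -- The flow restarted from φ, precomposed with φ, solves the original equation. The label map of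
  -- `lagField` exists for this purpose: after a restart the vorticity is carried by the displaced
  -- labels φ ∘ g.
  have hW : ∀ t, dispMap (X s + (Z t).compContinuous φ) = (dispMap (Z t)).comp φ := fun t => by
    ext1 x
    simp [hφ, add_assoc]
  have h1 : ∀ t, HasDerivAt (fun t => X s + (Z t).compContinuous φ)
      (lagField k μ ν g (X s + (Z t).compContinuous φ)) t := fun t => by
    have h2 := ((BoundedContinuousFunction.compContinuousCLM (𝕜 := ℝ) (β := Plane)
      φ).hasFDerivAt.comp_hasDerivAt t
        (hk.hasDerivAt_disp (μ := μ) (ν := ν) (g := φ.comp g) t)).const_add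
      (X s)
    have h3 : lagField k μ ν g (X s + (Z t).compContinuous φ) =
        (lagField k μ ν (φ.comp g) (Z t)).compContinuous φ := by
      ext1 x
      rw [BoundedContinuousFunction.compContinuous_apply, lagField_apply, lagField_apply, hW]
      rfl
    rw [h3]
    exact h2
  have h4 : (fun t => X (s + t)) = fun t => X s + (Z t).compContinuous φ := by
    refine hk.unique (μ := μ) (ν := ν) (g := g) (fun t => ?_) h1 ?_
    · simpa using (hk.hasDerivAt_disp (μ := μ) (ν := ν) (g := g) (s + t)).comp_const_add s t
    · simp only [add_zero]
      rw [hZ, hk.disp_zero]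
      ext1 x; simp
  rw [← hW t]
  exact congrArg dispMap (congrFun h4 t)

lemma dispMap_disp_neg_comp (hk : AdmissibleKernel k C) (s : ℝ) :
    (dispMap (hk.disp μ ν ((dispMap (hk.disp μ ν g s)).comp g) (-s))).comp
      (dispMap (hk.disp μ ν g s)) = ContinuousMap.id Plane := by
  rw [← hk.dispMap_disp_add, add_neg_cancel, hk.dispMap_disp_zero]

/-- The left-inverse identity is applied to the backward flow: restarting from it gives back the
label map g, so its left inverse is the forward flow itself. -/
lemma dispMap_disp_comp_neg (hk : AdmissibleKernel k C) (s : ℝ) :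
    (dispMap (hk.disp μ ν g s)).comp
      (dispMap (hk.disp μ ν ((dispMap (hk.disp μ ν g s)).comp g) (-s))) =
        ContinuousMap.id Plane := by
  have h := hk.dispMap_disp_neg_comp (μ := μ) (ν := ν)
    (g := (dispMap (hk.disp μ ν g s)).comp g) (-s)
  rwa [neg_neg, ← ContinuousMap.comp_assoc, hk.dispMap_disp_neg_comp, ContinuousMap.id_comp] at h

/-- The flow of an admissible kernel, as a family of homeomorphisms. -/
def flow (hk : AdmissibleKernel k C) (μ ν : Measure Plane) [IsFiniteMeasure μ]
    [IsFiniteMeasure ν] (g : C(Plane, Plane)) (t : ℝ) : Plane ≃ₜ Plane where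
  toFun := dispMap (hk.disp μ ν g t)
  invFun := dispMap (hk.disp μ ν ((dispMap (hk.disp μ ν g t)).comp g) (-t))
  left_inv x := DFunLike.congr_fun (hk.dispMap_disp_neg_comp (μ := μ) (ν := ν) (g := g) t) x
  right_inv x := DFunLike.congr_fun (hk.dispMap_disp_comp_neg (μ := μ) (ν := ν) (g := g) t) x
  continuous_toFun := (dispMap _).continuous
  continuous_invFun := (dispMap _).continuous

lemma flow_apply (hk : AdmissibleKernel k C) (t : ℝ) (x : Plane) :
    hk.flow μ ν g t x = dispMap (hk.disp μ ν g t) x := rfl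

/-- The inverse of the time-t map is a time −t map of the same kind, so neither decreases areas of
compact sets, and both preserve them. -/
lemma measurePreserving_flow (hk : AdmissibleKernel k C) (t : ℝ) :
    MeasurePreserving (hk.flow μ ν g t) volume volume := by
  set h := hk.flow μ ν g t with hh
  have h1 : ∀ A, IsCompact A → volume A ≤ volume (h '' A) := fun A hA =>
    hk.volume_le_image_disp t hA
  have h2 : ∀ A, IsCompact A → volume A ≤ volume (h.symm '' A) := fun A hA =>
    hk.volume_le_image_disp (-t) hA
  refine ⟨h.continuous.measurable, (measure_ext_of_isCompact fun K hK => ?_).symm⟩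
  rw [Measure.map_apply h.continuous.measurable hK.measurableSet, ← h.image_symm]
  refine le_antisymm (h2 K hK) ?_
  have := h1 _ (hK.image h.symm.continuous)
  rwa [← Set.image_comp, h.self_comp_symm, Set.image_id] at this

/-- Any family of homeomorphisms satisfying the flow equation pointwise is the flow. -/
lemma eq_flow (hk : AdmissibleKernel k C) {ζ : ℝ → Plane ≃ₜ Plane} (h0 : ∀ x, ζ 0 x = x)
    (hζ : ∀ x t, HasDerivAt (fun s => ζ s x) (pairIntegral μ ν fun y => k (ζ t x - ζ t y)) t) :
    ζ = hk.flow μ ν (ContinuousMap.id Plane) := by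
  have hM : 0 ≤ ‖k‖ * pairMass μ ν := mul_nonneg (norm_nonneg _) (pairMass_nonneg μ ν)
  -- The kernel is bounded, so ζ is Lipschitz in time uniformly in x. Its displacements are
  -- therefore bounded and form a continuous curve in `Disp`, where uniqueness is known.
  have hlip : ∀ x s t, ‖ζ t x - ζ s x‖ ≤ ‖k‖ * pairMass μ ν * |t - s| := fun x s t => by
    simpa using Convex.norm_image_sub_le_of_norm_hasDerivWithin_le (s := Set.univ)
      (fun r _ => (hζ x r).hasDerivWithinAt)
      (fun r _ => norm_pairIntegral_le fun _ => k.norm_coe_le_norm _) convex_univ (Set.mem_univ s)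
      (Set.mem_univ t)
  let X : ℝ → Disp := fun t => BoundedContinuousFunction.ofNormedAddCommGroup
    (fun x => ζ t x - x) ((ζ t).continuous.sub continuous_id) (‖k‖ * pairMass μ ν * |t|)
    (fun x => by simpa [h0] using hlip x 0 t)
  have hXapp : ∀ t x, X t x = ζ t x - x := fun _ _ => rfl
  have hXmap : ∀ t x, dispMap (X t) x = ζ t x := fun t x => by simp [hXapp]
  have hXc : Continuous X := by
    refine (LipschitzWith.of_dist_le_mul (K := (‖k‖ * pairMass μ ν).toNNReal)
      fun t s => ?_).continuous
    rw [dist_eq_norm, Real.coe_toNNReal _ hM, BoundedContinuousFunction.norm_le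
      (mul_nonneg hM dist_nonneg)]
    intro x
    have : (X t - X s) x = ζ t x - ζ s x := by simp [hXapp]
    rw [this, Real.dist_eq]
    exact hlip x s t
  have hF : Continuous (lagField k μ ν (ContinuousMap.id Plane)) :=
    continuous_of_logMod (hk.lagConst_pos μ ν).le fun N => hk.lagField_logLip N
  have hX : ∀ t, HasDerivAt X (lagField k μ ν (ContinuousMap.id Plane) (X t)) t := by
    refine _root_.hasDerivAt_disp (V := fun t => lagField k μ ν (ContinuousMap.id Plane) (X t))
      (hF.comp hXc) fun t x => ?_
    have h1 := (hζ x t).sub_const x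
    rw [lagField_apply]
    simp only [hXmap, ContinuousMap.id_apply]
    exact h1
  have hX0 : X 0 = 0 := by ext1 x; simp [hXapp, h0]
  have heq := hk.unique hX hk.hasDerivAt_disp (hX0.trans hk.disp_zero.symm)
  funext t
  ext1 x
  rw [hk.flow_apply, ← heq, hXmap]

lemma hasDerivAt_flow (hk : AdmissibleKernel k C) (x : Plane) (t : ℝ) :
    HasDerivAt (fun s => hk.flow μ ν (ContinuousMap.id Plane) s x)
      (pairIntegral μ ν fun y => k (hk.flow μ ν (ContinuousMap.id Plane) t x -
        hk.flow μ ν (ContinuousMap.id Plane) t y)) t := by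
  have h := ((BoundedContinuousFunction.evalCLM ℝ x (α := Plane)
    (β := Plane)).hasFDerivAt.comp_hasDerivAt
    t (hk.hasDerivAt_disp (μ := μ) (ν := ν) (g := ContinuousMap.id Plane) t)).const_add x
  exact h

lemma flow_zero (hk : AdmissibleKernel k C) (x : Plane) : hk.flow μ ν g 0 x = x := by
  simp [flow_apply, disp_zero]

end AdmissibleKernel

/-! ### Admissibility of the blob kernel -/

/-- A log-Lipschitz constant and bound for the blob kernel. -/
def blobConst (α : ℝ) : ℝ := 2 * ((α ^ 2)⁻¹ * (1 + 4 * α)) + 1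

lemma blobConst_pos {α : ℝ} (hα : 0 < α) : 0 < blobConst α := by
  unfold blobConst; positivity

lemma norm_blobField_sub_le_blobConst {α : ℝ} (hα : 0 < α) (N : ℕ) (a b : Plane) :
    ‖blobField α a - blobField α b‖ ≤ blobConst α * logMod N ‖a - b‖ := by
  refine (norm_blobField_sub_le hα N a b).trans
    (mul_le_mul_of_nonneg_right ?_ (logMod_nonneg N (norm_nonneg _)))
  have : 0 ≤ (α ^ 2)⁻¹ * (1 + 4 * α) := by positivity
  unfold blobConst; linarith

lemma norm_blobField_le_blobConst {α : ℝ} (hα : 0 < α) (x : Plane) :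
    ‖blobField α x‖ ≤ blobConst α := by
  have hc : 0 ≤ (α ^ 2)⁻¹ * (1 + 4 * α) := by positivity
  rcases le_total ‖x‖ 1 with h | h
  -- For ‖x‖ ≤ 1 the modulus with N = 0 is at most 2, whence the factor 2 in `blobConst`.
  · have h1 := norm_blobField_sub_le hα 0 x 0
    rw [blobField_zero, sub_zero, sub_zero] at h1
    simp only [logMod, Nat.cast_zero, zero_add, one_mul, neg_zero, Real.exp_zero] at h1
    unfold blobConst
    nlinarith
  · refine (norm_blobField_le hα x).trans ?_
    have h1 : 1 ≤ 2 * Real.pi * ‖x‖ := by nlinarith [Real.pi_gt_three]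
    have h2 := inv_le_one_of_one_le₀ h1
    unfold blobConst; linarith

/-- The blob kernel as a bounded continuous function. -/
def blobDisp {α : ℝ} (hα : 0 < α) : Disp :=
  BoundedContinuousFunction.ofNormedAddCommGroup (blobField α)
    (continuous_of_logMod (blobConst_pos hα).le (norm_blobField_sub_le_blobConst hα))
    (blobConst α) (norm_blobField_le_blobConst hα)

lemma admissibleKernel_blobDisp {α : ℝ} (hα : 0 < α) :
    AdmissibleKernel (blobDisp hα) (blobConst α) where
  pos := blobConst_pos hα
  logLip := norm_blobField_sub_le_blobConst hα
  approx := by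
    have hcont : ∀ M, Continuous (blobFieldTrunc α M) := fun M =>
      continuous_iff_continuousAt.2 fun x =>
        (hasFDerivAt_blobFieldTrunc hα M x).choose_spec.1.continuousAt
    have hb : ∀ M x, ‖blobFieldTrunc α M x‖ ≤ blobConst α + 2 * α⁻¹ * Real.exp (-M / 2) :=
      fun M x => by
        have h1 := norm_blobFieldTrunc_sub_le hα M x
        have h2 := norm_blobField_le_blobConst hα x
        have h3 := norm_le_norm_add_norm_sub (blobField α x) (blobFieldTrunc α M x)
        rw [norm_sub_rev] at h3
        linarith
    refine ⟨fun n => BoundedContinuousFunction.ofNormedAddCommGroup (blobFieldTrunc α n)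
      (hcont n) _ (hb n), ?_, fun n => ⟨_, fun x => hasFDerivAt_blobFieldTrunc hα n x⟩⟩
    rw [tendsto_iff_norm_sub_tendsto_zero]
    refine squeeze_zero (fun _ => norm_nonneg _) (g := fun n : ℕ => 2 * α⁻¹ * Real.exp (-n / 2))
      (fun n => ?_) ?_
    · rw [BoundedContinuousFunction.norm_le (by positivity)]
      exact fun x => norm_blobFieldTrunc_sub_le hα n x
    · have h : Tendsto (fun n : ℕ => Real.exp (-((n : ℝ) / 2))) atTop (𝓝 0) :=
        Real.tendsto_exp_neg_atTop_nhds_zero.comp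
          (tendsto_natCast_atTop_atTop.atTop_div_const two_pos)
      simpa [neg_div] using h.const_mul (2 * α⁻¹)

/-! ### Signed measures -/

/-- The positive part of a signed measure. -/
abbrev posPartMeasure (q : SignedMeasure Plane) : Measure Plane := q.toJordanDecomposition.posPart

/-- The negative part of a signed measure. -/
abbrev negPartMeasure (q : SignedMeasure Plane) : Measure Plane := q.toJordanDecomposition.negPart

lemma signedMeasure_integral_eq {E : Type*} [NormedAddCommGroup E] [NormedSpace ℝ E]
    (q : SignedMeasure Plane) {f : Plane → E}
    (h1 : Integrable f (posPartMeasure q)) (h2 : Integrable f (negPartMeasure q)) :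
    q.integral f (ContinuousLinearMap.lsmul ℝ ℝ).flip =
      pairIntegral (posPartMeasure q) (negPartMeasure q) f := by
  have hq : q = (posPartMeasure q).toSignedMeasure - (negPartMeasure q).toSignedMeasure :=
    (SignedMeasure.toSignedMeasure_toJordanDecomposition q).symm
  conv_lhs => rw [hq]
  rw [VectorMeasure.integral_sub_vectorMeasure, VectorMeasure.integral_toSignedMeasure,
    VectorMeasure.integral_toSignedMeasure, pairIntegral]
  · simpa [VectorMeasure.Integrable] using h1
  · simpa [VectorMeasure.Integrable] using h2

lemma signedMeasure_integral_real_eq (q : SignedMeasure Plane) {f : Plane → ℝ}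
    (h1 : Integrable f (posPartMeasure q)) (h2 : Integrable f (negPartMeasure q)) :
    q.integral f (ContinuousLinearMap.lsmul ℝ ℝ) =
      pairIntegral (posPartMeasure q) (negPartMeasure q) f := by
  have h : ContinuousLinearMap.lsmul ℝ ℝ = (ContinuousLinearMap.lsmul ℝ ℝ (E := ℝ)).flip := by
    ext; simp
  rw [h, signedMeasure_integral_eq q h1 h2]

lemma blob_integral_eq {α : ℝ} (hα : 0 < α) (q : SignedMeasure Plane) (ζ : Plane ≃ₜ Plane)
    (x : Plane) :
    q.integral (fun y => blobKernel α (ζ x) (ζ y)) (ContinuousLinearMap.lsmul ℝ ℝ).flip =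
      pairIntegral (posPartMeasure q) (negPartMeasure q)
        fun y => blobDisp hα (ζ x - ζ y) := by
  simp only [blobKernel_eq hα]
  exact signedMeasure_integral_eq q
    (integrable_kernel_comp (blobDisp hα) ⟨ζ, ζ.continuous⟩ (ζ x) _)
    (integrable_kernel_comp (blobDisp hα) ⟨ζ, ζ.continuous⟩ (ζ x) _)

/-- The flow of the vortex blob method. -/
def blobFlow {α : ℝ} (hα : 0 < α) (μ ν : Measure Plane) [IsFiniteMeasure μ]
    [IsFiniteMeasure ν] : ℝ → Plane ≃ₜ Plane :=
  (admissibleKernel_blobDisp hα).flow μ ν (ContinuousMap.id Plane)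

lemma isBlobFlow_blobFlow {α : ℝ} (hα : 0 < α) (q : SignedMeasure Plane) :
    IsBlobFlow α q (blobFlow hα (posPartMeasure q) (negPartMeasure q)) where
  measurePreserving t := (admissibleKernel_blobDisp hα).measurePreserving_flow t
  initial x := (admissibleKernel_blobDisp hα).flow_zero x
  hasDerivAt x t := by
    rw [blob_integral_eq hα]
    exact (admissibleKernel_blobDisp hα).hasDerivAt_flow x t

lemma IsBlobFlow.eq_blobFlow {α : ℝ} (hα : 0 < α) {q : SignedMeasure Plane}
    {ζ : ℝ → Plane ≃ₜ Plane} (h : IsBlobFlow α q ζ) :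
    ζ = blobFlow hα (posPartMeasure q) (negPartMeasure q) := by
  refine (admissibleKernel_blobDisp hα).eq_flow h.initial fun x t => ?_
  rw [← blob_integral_eq hα]
  exact h.hasDerivAt x t

lemma existsUnique_isBlobFlow {α : ℝ} (hα : 0 < α) (q : SignedMeasure Plane) :
    ∃! ζ : ℝ → Plane ≃ₜ Plane, IsBlobFlow α q ζ :=
  ⟨_, isBlobFlow_blobFlow hα q, fun _ h => h.eq_blobFlow hα⟩

/-! ### Radial integrals in the plane -/

/-- The area of the unit disc. -/
def discArea : ℝ := (volume : Measure Plane).real (Metric.ball 0 1)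

lemma discArea_nonneg : 0 ≤ discArea := measureReal_nonneg

/-- Polar coordinates; 2 * `discArea` is the length of the unit circle. -/
lemma lintegral_radial_le {f : ℝ → ℝ} (hf : ∀ r, 0 ≤ r → 0 ≤ f r) {c : ℝ}
    (hinteg : IntegrableOn (fun r : ℝ => r * f r) (Set.Ioi 0))
    (hc : ∫ r in Set.Ioi (0 : ℝ), r * f r = c) :
    ∫⁻ z : Plane, ENNReal.ofReal (f ‖z‖) ≤ ENNReal.ofReal (2 * discArea * c) := by
  have h1 : Integrable (fun z : Plane => f ‖z‖) := by
    rw [integrable_fun_norm_addHaar]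
    simpa using hinteg
  have h2 := integral_fun_norm_addHaar (volume : Measure Plane) f
  simp only [finrank_euclideanSpace, Fintype.card_fin, Nat.add_one_sub_one, pow_one, smul_eq_mul,
    nsmul_eq_mul, hc] at h2
  rw [← ofReal_integral_eq_lintegral_ofReal h1 (.of_forall fun z => hf _ (norm_nonneg z)), h2]
  refine ENNReal.ofReal_le_ofReal (le_of_eq ?_)
  rw [discArea]; push_cast; ring

lemma lintegral_ball_inv_norm_le {R : ℝ} (hR : 0 ≤ R) :
    ∫⁻ z in Metric.ball (0 : Plane) R, ENNReal.ofReal ‖z‖⁻¹ ≤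
      ENNReal.ofReal (2 * discArea * R) := by
  have hfun : Set.EqOn (fun r : ℝ => r * (Set.Iio R).indicator (fun r => r⁻¹) r)
      (fun r => (Set.Iio R).indicator (fun _ => (1 : ℝ)) r) (Set.Ioi 0) := fun r hr => by
    have hr' : (r : ℝ) ≠ 0 := (Set.mem_Ioi.1 hr).ne'
    by_cases h : r ∈ Set.Iio R <;> simp [h, hr']
  have hset : Set.Ioi (0 : ℝ) ∩ Set.Iio R = Set.Ioo 0 R := Set.Ioi_inter_Iio
  have hinteg : IntegrableOn (fun r : ℝ => r * (Set.Iio R).indicator (fun r => r⁻¹) r)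
      (Set.Ioi 0) := by
    rw [integrableOn_congr_fun hfun measurableSet_Ioi, IntegrableOn,
      integrable_indicator_iff measurableSet_Iio, IntegrableOn,
      Measure.restrict_restrict measurableSet_Iio, Set.inter_comm, hset]
    exact integrableOn_const (by simp)
  have hval : ∫ r in Set.Ioi (0 : ℝ), r * (Set.Iio R).indicator (fun r => r⁻¹) r = R := by
    rw [setIntegral_congr_fun measurableSet_Ioi hfun, setIntegral_indicator measurableSet_Iio, hset]
    simp [hR]
  have h := lintegral_radial_le (f := (Set.Iio R).indicator fun r => r⁻¹)
    (fun r hr => Set.indicator_apply_nonneg fun _ => inv_nonneg.2 hr) hinteg hval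
  refine le_trans (le_of_eq ?_) h
  rw [← lintegral_indicator measurableSet_ball]
  congr 1
  funext z
  by_cases hz : ‖z‖ < R <;> simp [hz]

/-- The radial integral of 1/r from exp(-N) to 1 equals N; this is the logarithm in the modulus of
the Biot–Savart velocity. -/
lemma lintegral_annulus_inv_sq_norm_le (N : ℕ) :
    ∫⁻ z in {z : Plane | Real.exp (-N) ≤ ‖z‖ ∧ ‖z‖ < 1}, ENNReal.ofReal (‖z‖ ^ 2)⁻¹ ≤
      ENNReal.ofReal (2 * discArea * N) := by
  have hE : 0 < Real.exp (-(N : ℝ)) := Real.exp_pos _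
  have hE1 : Real.exp (-(N : ℝ)) ≤ 1 := Real.exp_le_one_iff.2 (by simp)
  set e := Real.exp (-(N : ℝ)) with he
  have hfun : Set.EqOn (fun r : ℝ => r * (Set.Ico e 1).indicator (fun r => (r ^ 2)⁻¹) r)
      (fun r => (Set.Ico e 1).indicator (fun r => r⁻¹) r) (Set.Ioi 0) := fun r hr => by
    have hr' : (r : ℝ) ≠ 0 := (Set.mem_Ioi.1 hr).ne'
    by_cases h : r ∈ Set.Ico e 1
    · simp only [Set.indicator_of_mem h]; field_simp
    · simp [h]
  have hset : Set.Ioi (0 : ℝ) ∩ Set.Ico e 1 = Set.Ico e 1 :=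
    Set.inter_eq_right.2 fun r hr => hE.trans_le hr.1
  have hii : IntervalIntegrable (fun r : ℝ => r⁻¹) volume e 1 := by
    refine ContinuousOn.intervalIntegrable ?_
    rw [Set.uIcc_of_le hE1]
    exact continuousOn_inv₀.mono fun r hr => (hE.trans_le hr.1).ne'
  have h := lintegral_radial_le (f := (Set.Ico e 1).indicator fun r => (r ^ 2)⁻¹)
    (fun r _ => Set.indicator_nonneg (fun _ _ => by positivity) r) (c := N) ?_ ?_
  · refine le_trans (le_of_eq ?_) h
    rw [← lintegral_indicator (by measurability)]
    congr 1
    funext z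
    by_cases hz : e ≤ ‖z‖ ∧ ‖z‖ < 1 <;> simp [hz]
  · rw [integrableOn_congr_fun hfun measurableSet_Ioi, IntegrableOn,
      integrable_indicator_iff measurableSet_Ico, IntegrableOn,
      Measure.restrict_restrict measurableSet_Ico, Set.inter_comm, hset, ← IntegrableOn,
      integrableOn_Ico_iff_integrableOn_Ioo, ← integrableOn_Ioc_iff_integrableOn_Ioo]
    exact (intervalIntegrable_iff_integrableOn_Ioc_of_le hE1).1 hii
  · rw [setIntegral_congr_fun measurableSet_Ioi hfun, setIntegral_indicator measurableSet_Ico, hset,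
      integral_Ico_eq_integral_Ioc, ← intervalIntegral.integral_of_le hE1,
      integral_inv_of_pos hE one_pos, he, one_div, ← Real.exp_neg, Real.log_exp, neg_neg]

/-! ### Vorticity transported by measure preserving maps -/

/-- The constant in the estimates for the Biot–Savart integral of a vorticity. -/
def vortConst (ω : Plane → ℝ) : ℝ :=
  2 * discArea * (eLpNorm ω ⊤ volume).toReal + (eLpNorm ω 1 volume).toReal

lemma vortConst_nonneg (ω : Plane → ℝ) : 0 ≤ vortConst ω := by
  have := discArea_nonneg
  unfold vortConst; positivity

/-- Near the singularity |ω| is bounded by its supremum and φ is removed by area preservation; away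
from it f is bounded and ω is integrated. The result does not depend on φ. -/
lemma lintegral_transport_le {ω : Plane → ℝ} (hω₁ : MemLp ω 1 volume) (hω₂ : MemLp ω ⊤ volume)
    {f : Plane → ENNReal} (hf : Measurable f) {S : Set Plane}
    (hS : MeasurableSet S) {a b : ℝ} (ha : 0 ≤ a) (hb : 0 ≤ b)
    (hfa : ∫⁻ z in S, f z ≤ ENNReal.ofReal (2 * discArea * a))
    (hfb : ∀ z ∉ S, f z ≤ ENNReal.ofReal b) {φ : Plane → Plane}
    (hφ : MeasurePreserving φ volume volume) (p : Plane) :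
    ∫⁻ y, f (p - φ y) * ‖ω y‖ₑ ≤ ENNReal.ofReal (vortConst ω * max a b) := by
  set B := eLpNorm ω ⊤ volume with hB
  have hBtop : B ≠ ⊤ := hω₂.eLpNorm_ne_top
  have hItop : eLpNorm ω 1 volume ≠ ⊤ := hω₁.eLpNorm_ne_top
  have hbound : ∀ᵐ y, ‖ω y‖ₑ ≤ B := by
    rw [hB, eLpNorm_exponent_top]
    exact enorm_ae_le_eLpNormEssSup ω volume
  have hle : ∀ z, f z ≤ S.indicator f z + ENNReal.ofReal b := fun z => by
    by_cases hz : z ∈ S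
    · simp [hz]
    · simpa [hz] using hfb z hz
  have hSf : Measurable (S.indicator f) := hf.indicator hS
  have h1 : ∫⁻ y, S.indicator f (p - φ y) * ‖ω y‖ₑ ≤ ENNReal.ofReal (2 * discArea * a) * B := by
    calc ∫⁻ y, S.indicator f (p - φ y) * ‖ω y‖ₑ ≤ ∫⁻ y, S.indicator f (p - φ y) * B := by
          refine lintegral_mono_ae ?_
          filter_upwards [hbound] with y hy
          gcongr
      _ = (∫⁻ y, S.indicator f (p - φ y)) * B := by
          rw [lintegral_mul_const]
          exact hSf.comp (measurable_const.sub hφ.measurable)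
      _ = (∫⁻ z, S.indicator f z) * B := by
          rw [hφ.lintegral_comp (f := fun z => S.indicator f (p - z))
            (hSf.comp (measurable_const.sub measurable_id)), lintegral_sub_left_eq_self]
      _ ≤ _ := by
          rw [lintegral_indicator hS]
          gcongr
  have h2 : ∫⁻ y, ‖ω y‖ₑ = eLpNorm ω 1 volume := eLpNorm_one_eq_lintegral_enorm.symm
  have hd := discArea_nonneg
  calc ∫⁻ y, f (p - φ y) * ‖ω y‖ₑ
      ≤ ∫⁻ y, S.indicator f (p - φ y) * ‖ω y‖ₑ + ENNReal.ofReal b * ‖ω y‖ₑ := by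
        refine lintegral_mono fun y => ?_
        rw [← add_mul]
        gcongr
        exact hle _
    _ = (∫⁻ y, S.indicator f (p - φ y) * ‖ω y‖ₑ) + ENNReal.ofReal b * eLpNorm ω 1 volume := by
        rw [lintegral_add_right', lintegral_const_mul', h2]
        · simp
        · exact hω₁.1.enorm.const_mul _
    _ ≤ ENNReal.ofReal (2 * discArea * a) * B + ENNReal.ofReal b * eLpNorm ω 1 volume := by
        gcongr
    _ = ENNReal.ofReal (2 * discArea * a * B.toReal + b * (eLpNorm ω 1 volume).toReal) := by
        rw [ENNReal.ofReal_add (by positivity) (by positivity),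
          ENNReal.ofReal_mul (p := 2 * discArea * a) (by positivity),
          ENNReal.ofReal_mul hb, ENNReal.ofReal_toReal hBtop, ENNReal.ofReal_toReal hItop]
    _ ≤ _ := by
        refine ENNReal.ofReal_le_ofReal ?_
        have h3 : a ≤ max a b := le_max_left _ _
        have h4 : b ≤ max a b := le_max_right _ _
        calc _ ≤ 2 * discArea * max a b * B.toReal + max a b * (eLpNorm ω 1 volume).toReal := by
              gcongr
          _ = _ := by rw [vortConst]; ring

/-- An integral over transported vorticity is controlled by a bound near the singularity of the
kernel and a bound away from it. -/
lemma norm_integral_transport_le {ω : Plane → ℝ} (hω₁ : MemLp ω 1 volume)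
    (hω₂ : MemLp ω ⊤ volume) {u : Plane → Plane} {f : Plane → ENNReal} (hf : Measurable f)
    {S : Set Plane} (hS : MeasurableSet S) {a b : ℝ} (ha : 0 ≤ a) (hb : 0 ≤ b)
    (hfa : ∫⁻ z in S, f z ≤ ENNReal.ofReal (2 * discArea * a))
    (hfb : ∀ z ∉ S, f z ≤ ENNReal.ofReal b) {φ : Plane → Plane}
    (hφ : MeasurePreserving φ volume volume) (p : Plane)
    (hu : ∀ y, φ y ≠ p → ‖u y‖ₑ ≤ f (p - φ y)) :
    ∫⁻ y, ‖ω y • u y‖ₑ ≤ ENNReal.ofReal (vortConst ω * max a b) := by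
  refine le_trans (lintegral_mono_ae ?_) (lintegral_transport_le hω₁ hω₂ hf hS ha hb hfa hfb hφ p)
  have hne : ∀ᵐ y, φ y ≠ p := by
    have h1 : volume (φ ⁻¹' {p}) = 0 := by
      rw [hφ.measure_preimage (measurableSet_singleton p).nullMeasurableSet]
      simp
    filter_upwards [compl_mem_ae_iff.2 h1] with y hy using hy
  filter_upwards [hne] with y hy
  rw [enorm_smul, mul_comm]
  gcongr
  exact hu y hy

lemma measurable_eulerField : Measurable eulerField := by
  unfold eulerField
  exact ((measurable_const.mul (measurable_norm.pow_const 2)).inv).smul perp.continuous.measurable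

lemma enorm_eulerField_le (z : Plane) : ‖eulerField z‖ₑ ≤ ENNReal.ofReal ‖z‖⁻¹ := by
  rw [← ofReal_norm, norm_eulerField, mul_inv]
  refine ENNReal.ofReal_le_ofReal (mul_le_of_le_one_left (by positivity) ?_)
  exact inv_le_one_of_one_le₀ (by linarith [Real.pi_gt_three])

lemma ofReal_inv_norm_le_of_notMem_ball {R : ℝ} (hR : 0 < R) {z : Plane}
    (hz : z ∉ Metric.ball (0 : Plane) R) : ‖z‖⁻¹ ≤ R⁻¹ := by
  have h : R ≤ ‖z‖ := by simpa using hz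
  gcongr

/-! ### Velocities induced by transported vorticity -/

section EulerVelocity

variable {ω : Plane → ℝ} {φ ψ : Plane → Plane}

lemma lintegral_eulerField_le (hω₁ : MemLp ω 1 volume) (hω₂ : MemLp ω ⊤ volume)
    (hφ : MeasurePreserving φ volume volume) (p : Plane) :
    ∫⁻ y, ‖ω y • eulerField (p - φ y)‖ₑ ≤ ENNReal.ofReal (vortConst ω) := by
  have h := norm_integral_transport_le hω₁ hω₂ (u := fun y => eulerField (p - φ y))
    (f := fun z => ENNReal.ofReal ‖z‖⁻¹) (by fun_prop) (S := Metric.ball 0 1) measurableSet_ball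
    (a := 1) (b := 1) zero_le_one zero_le_one (lintegral_ball_inv_norm_le zero_le_one)
    (fun z hz => ENNReal.ofReal_le_ofReal
      (by simpa using ofReal_inv_norm_le_of_notMem_ball one_pos hz)) hφ p
    (fun y _ => enorm_eulerField_le _)
  simpa using h

lemma integrable_eulerField (hω₁ : MemLp ω 1 volume) (hω₂ : MemLp ω ⊤ volume)
    (hφ : MeasurePreserving φ volume volume) (p : Plane) :
    Integrable fun y => ω y • eulerField (p - φ y) := by
  refine ⟨hω₁.1.smul (measurable_eulerField.comp
    (measurable_const.sub hφ.measurable)).aestronglyMeasurable, ?_⟩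
  exact (lintegral_eulerField_le hω₁ hω₂ hφ p).trans_lt ENNReal.ofReal_lt_top

lemma norm_integral_eulerField_le (hω₁ : MemLp ω 1 volume) (hω₂ : MemLp ω ⊤ volume)
    (hφ : MeasurePreserving φ volume volume) (p : Plane) :
    ‖∫ y, ω y • eulerField (p - φ y)‖ ≤ vortConst ω := by
  have h := (enorm_integral_le_lintegral_enorm _).trans (lintegral_eulerField_le hω₁ hω₂ hφ p)
  rwa [← ofReal_norm, ENNReal.ofReal_le_ofReal_iff (vortConst_nonneg ω)] at h

/-- A majorant for increments of the Euler kernel. -/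
def eulerMajorant (N : ℕ) (D : ℝ) (z : Plane) : ℝ :=
  if ‖z‖ < Real.exp (-N) then ‖z‖⁻¹ else D * (‖z‖ ^ 2)⁻¹

lemma eulerMajorant_nonneg (N : ℕ) {D : ℝ} (hD : 0 ≤ D) (z : Plane) : 0 ≤ eulerMajorant N D z := by
  unfold eulerMajorant; split_ifs <;> positivity

lemma measurable_eulerMajorant (N : ℕ) (D : ℝ) : Measurable (eulerMajorant N D) := by
  unfold eulerMajorant
  exact Measurable.ite (measurableSet_lt measurable_norm measurable_const) (by fun_prop)
    (by fun_prop)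

/-- If a point lies within exp(-N) of the origin, the singular bound at the nearer one dominates;
otherwise `norm_eulerField_sub` and the arithmetic–geometric mean inequality apply. The majorant
separates a from b, so each can be integrated through its own measure preserving map. -/
lemma norm_eulerField_sub_le {N : ℕ} {D : ℝ} {a b : Plane} (ha : a ≠ 0) (hb : b ≠ 0)
    (hD : ‖a - b‖ ≤ D) :
    ‖eulerField a - eulerField b‖ ≤ eulerMajorant N D a + eulerMajorant N D b := by
  have ha' : 0 < ‖a‖ := norm_pos_iff.2 ha
  have hb' : 0 < ‖b‖ := norm_pos_iff.2 hb
  have hD0 : 0 ≤ D := (norm_nonneg _).trans hD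
  have hπ : (2 : ℝ) ≤ 2 * Real.pi := by linarith [Real.pi_gt_three]
  have h2 : ∀ z : Plane, ‖eulerField z‖ ≤ ‖z‖⁻¹ / 2 := fun z => by
    rw [norm_eulerField, mul_inv, div_eq_inv_mul]
    gcongr
  have h3 : ‖eulerField a - eulerField b‖ ≤ ‖a‖⁻¹ / 2 + ‖b‖⁻¹ / 2 :=
    (norm_sub_le _ _).trans (add_le_add (h2 a) (h2 b))
  have na := eulerMajorant_nonneg N hD0 a
  have nb := eulerMajorant_nonneg N hD0 b
  have pa : 0 < ‖a‖⁻¹ := by positivity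
  have pb : 0 < ‖b‖⁻¹ := by positivity
  by_cases h1 : ‖a‖ < Real.exp (-N) <;> by_cases h1' : ‖b‖ < Real.exp (-N)
  · rw [eulerMajorant, eulerMajorant, if_pos h1, if_pos h1']
    linarith
  · have : ‖b‖⁻¹ ≤ ‖a‖⁻¹ := by gcongr; linarith
    have : eulerMajorant N D a = ‖a‖⁻¹ := if_pos h1
    linarith
  · have : ‖a‖⁻¹ ≤ ‖b‖⁻¹ := by gcongr; linarith
    have : eulerMajorant N D b = ‖b‖⁻¹ := if_pos h1'
    linarith
  · rw [eulerMajorant, eulerMajorant, if_neg h1, if_neg h1', norm_eulerField_sub ha hb, ← inv_pow,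
      ← inv_pow]
    calc ‖a - b‖ / (2 * Real.pi * (‖a‖ * ‖b‖)) ≤ D / (2 * (‖a‖ * ‖b‖)) := by gcongr
      _ = D * (‖a‖⁻¹ * ‖b‖⁻¹ / 2) := by field_simp
      _ ≤ D * (‖a‖⁻¹ ^ 2 + ‖b‖⁻¹ ^ 2) := by
          gcongr
          nlinarith [sq_nonneg (‖a‖⁻¹ - ‖b‖⁻¹), sq_nonneg (‖a‖⁻¹ + ‖b‖⁻¹)]
      _ = _ := by ring

lemma lintegral_ball_eulerMajorant_le (N : ℕ) {D : ℝ} (hD : 0 ≤ D) :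
    ∫⁻ z in Metric.ball (0 : Plane) 1, ENNReal.ofReal (eulerMajorant N D z) ≤
      ENNReal.ofReal (2 * discArea * logMod N D) := by
  have hE : 0 < Real.exp (-(N : ℝ)) := Real.exp_pos _
  have hd := discArea_nonneg
  have hsub : Metric.ball (0 : Plane) 1 ⊆ Metric.ball 0 (Real.exp (-N)) ∪
      {z | Real.exp (-N) ≤ ‖z‖ ∧ ‖z‖ < 1} := fun z hz => by
    rcases lt_or_ge ‖z‖ (Real.exp (-N)) with h | h
    · exact Or.inl (by simpa using h)
    · exact Or.inr ⟨h, by simpa using hz⟩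
  calc ∫⁻ z in Metric.ball (0 : Plane) 1, ENNReal.ofReal (eulerMajorant N D z)
      ≤ (∫⁻ z in Metric.ball (0 : Plane) (Real.exp (-N)), ENNReal.ofReal (eulerMajorant N D z)) +
        ∫⁻ z in {z : Plane | Real.exp (-N) ≤ ‖z‖ ∧ ‖z‖ < 1},
          ENNReal.ofReal (eulerMajorant N D z) :=
        (lintegral_mono_set hsub).trans (lintegral_union_le _ _ _)
    _ = (∫⁻ z in Metric.ball (0 : Plane) (Real.exp (-N)), ENNReal.ofReal ‖z‖⁻¹) +
        ∫⁻ z in {z : Plane | Real.exp (-N) ≤ ‖z‖ ∧ ‖z‖ < 1},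
          ENNReal.ofReal D * ENNReal.ofReal (‖z‖ ^ 2)⁻¹ := by
        congr 1
        · refine setLIntegral_congr_fun measurableSet_ball fun z hz => ?_
          have : ‖z‖ < Real.exp (-N) := by simpa using hz
          simp only [eulerMajorant, if_pos this]
        · refine setLIntegral_congr_fun (by measurability) fun z hz => ?_
          simp only [eulerMajorant, if_neg (not_lt.2 hz.1), ENNReal.ofReal_mul hD]
    _ ≤ ENNReal.ofReal (2 * discArea * Real.exp (-N)) +
          ENNReal.ofReal D * ENNReal.ofReal (2 * discArea * N) := by
        rw [lintegral_const_mul' _ _ ENNReal.ofReal_ne_top]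
        gcongr
        · exact lintegral_ball_inv_norm_le hE.le
        · exact lintegral_annulus_inv_sq_norm_le N
    _ ≤ _ := by
        rw [← ENNReal.ofReal_mul hD, ← ENNReal.ofReal_add (by positivity) (by positivity)]
        refine ENNReal.ofReal_le_ofReal ?_
        have : 0 ≤ discArea * D := by positivity
        unfold logMod
        nlinarith

lemma lintegral_eulerMajorant_le (hω₁ : MemLp ω 1 volume) (hω₂ : MemLp ω ⊤ volume)
    (hφ : MeasurePreserving φ volume volume) (p : Plane) (N : ℕ) {D : ℝ} (hD : 0 ≤ D) :
    ∫⁻ y, ENNReal.ofReal (eulerMajorant N D (p - φ y)) * ‖ω y‖ₑ ≤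
      ENNReal.ofReal (vortConst ω * logMod N D) := by
  have hDl : D ≤ logMod N D := by
    have := Real.exp_pos (-(N : ℝ))
    have : 0 ≤ (N : ℝ) * D := by positivity
    unfold logMod; linarith
  have h := lintegral_transport_le hω₁ hω₂
    (f := fun z => ENNReal.ofReal (eulerMajorant N D z))
    (measurable_eulerMajorant N D).ennreal_ofReal (S := Metric.ball 0 1) measurableSet_ball
    (a := logMod N D) (b := D) (logMod_nonneg N hD) hD (lintegral_ball_eulerMajorant_le N hD)
    (fun z hz => ENNReal.ofReal_le_ofReal (by
      have hz1 : 1 ≤ ‖z‖ := by simpa using hz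
      have h1 : Real.exp (-(N : ℝ)) ≤ 1 := Real.exp_le_one_iff.2 (by simp)
      rw [eulerMajorant, if_neg (not_lt.2 (h1.trans hz1))]
      exact mul_le_of_le_one_right hD (inv_le_one_of_one_le₀ (one_le_pow₀ hz1)))) hφ p
  rwa [max_eq_left hDl] at h

/-- The Biot–Savart velocity depends on the transported vorticity with a log-Lipschitz modulus. -/
lemma norm_integral_eulerField_sub_le (hω₁ : MemLp ω 1 volume) (hω₂ : MemLp ω ⊤ volume)
    (hφ : MeasurePreserving φ volume volume) (hψ : MeasurePreserving ψ volume volume)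
    {p p' : Plane} {D : ℝ} (hD : ∀ y, ‖p - φ y - (p' - ψ y)‖ ≤ D) (N : ℕ) :
    ‖(∫ y, ω y • eulerField (p - φ y)) - ∫ y, ω y • eulerField (p' - ψ y)‖ ≤
      2 * vortConst ω * logMod N D := by
  have hD0 : 0 ≤ D := (norm_nonneg _).trans (hD 0)
  have hne : ∀ {φ : Plane → Plane}, MeasurePreserving φ volume volume → ∀ p : Plane,
      ∀ᵐ y, p - φ y ≠ 0 := fun {φ} hφ p => by
    have h1 : volume (φ ⁻¹' {p}) = 0 := by
      rw [hφ.measure_preimage (measurableSet_singleton p).nullMeasurableSet]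
      simp
    filter_upwards [compl_mem_ae_iff.2 h1] with y hy h
    exact hy (sub_eq_zero.1 h).symm
  have h1 : ∫⁻ y, ‖ω y • eulerField (p - φ y) - ω y • eulerField (p' - ψ y)‖ₑ ≤
      ENNReal.ofReal (2 * vortConst ω * logMod N D) := by
    calc _ ≤ ∫⁻ y, ENNReal.ofReal (eulerMajorant N D (p - φ y)) * ‖ω y‖ₑ +
          ENNReal.ofReal (eulerMajorant N D (p' - ψ y)) * ‖ω y‖ₑ := by
          refine lintegral_mono_ae ?_
          filter_upwards [hne hφ p, hne hψ p'] with y hy hy'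
          rw [← smul_sub, enorm_smul, mul_comm, ← add_mul,
            ← ENNReal.ofReal_add (eulerMajorant_nonneg N hD0 _) (eulerMajorant_nonneg N hD0 _),
            ← ofReal_norm (eulerField _ - _)]
          gcongr
          exact norm_eulerField_sub_le hy hy' (hD y)
      _ = (∫⁻ y, ENNReal.ofReal (eulerMajorant N D (p - φ y)) * ‖ω y‖ₑ) +
          ∫⁻ y, ENNReal.ofReal (eulerMajorant N D (p' - ψ y)) * ‖ω y‖ₑ := by
          refine lintegral_add_right' _ (AEMeasurable.mul ?_ hω₁.1.enorm)
          exact ((measurable_eulerMajorant N D).ennreal_ofReal.comp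
            (measurable_const.sub hψ.measurable)).aemeasurable
      _ ≤ _ := add_le_add (lintegral_eulerMajorant_le hω₁ hω₂ hφ p N hD0)
          (lintegral_eulerMajorant_le hω₁ hω₂ hψ p' N hD0)
      _ = _ := by
          have := mul_nonneg (vortConst_nonneg ω) (logMod_nonneg N hD0)
          rw [← ENNReal.ofReal_add this this]
          congr 1; ring
  rw [← integral_sub (integrable_eulerField hω₁ hω₂ hφ p) (integrable_eulerField hω₁ hω₂ hψ p')]
  have h2 := (enorm_integral_le_lintegral_enorm _).trans h1
  have := mul_nonneg (mul_nonneg zero_le_two (vortConst_nonneg ω)) (logMod_nonneg N hD0)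
  rwa [← ofReal_norm, ENNReal.ofReal_le_ofReal_iff this] at h2

/-- The velocities given by the blob kernel and the Euler kernel are close. -/
lemma norm_integral_blobField_sub_eulerField_le (hω₁ : MemLp ω 1 volume)
    (hω₂ : MemLp ω ⊤ volume) (hφ : MeasurePreserving φ volume volume) (p : Plane) {α : ℝ}
    (hα : 0 < α) :
    ‖(∫ y, ω y • blobField α (p - φ y)) - ∫ y, ω y • eulerField (p - φ y)‖ ≤
      vortConst ω * (4 * Real.sqrt α) := by
  have hs : 0 < Real.sqrt α := Real.sqrt_pos.2 hα
  have hcont : Continuous (blobField α) := (blobDisp hα).continuous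
  have hinteg : Integrable fun y => ω y • blobField α (p - φ y) := by
    refine (memLp_one_iff_integrable.1 hω₁).smul_of_top_left ?_
    refine memLp_top_of_bound (hcont.measurable.comp
      (measurable_const.sub hφ.measurable)).aestronglyMeasurable (blobConst α)
      (.of_forall fun y => norm_blobField_le_blobConst hα _)
  rw [norm_sub_rev, ← integral_sub (integrable_eulerField hω₁ hω₂ hφ p) hinteg]
  simp only [← smul_sub]
  have h := norm_integral_transport_le hω₁ hω₂
    (u := fun y => eulerField (p - φ y) - blobField α (p - φ y))
    (f := fun z => ENNReal.ofReal ‖eulerField z - blobField α z‖)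
    (measurable_eulerField.sub hcont.measurable).norm.ennreal_ofReal
    -- The radius √α balances the two regions: the singular bound integrates to O(√α) inside, and
    -- 4α²/‖z‖³ ≤ 4√α outside.
    (S := Metric.ball 0 (Real.sqrt α)) measurableSet_ball
    (a := Real.sqrt α) (b := 4 * Real.sqrt α) hs.le (by positivity)
    (le_trans (lintegral_mono fun z => ?_) (lintegral_ball_inv_norm_le hs.le))
    (fun z hz => ENNReal.ofReal_le_ofReal ?_) hφ p (fun y _ => by rw [← ofReal_norm])
  · rw [max_eq_right (by linarith)] at h
    have h2 := (enorm_integral_le_lintegral_enorm _).trans h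
    have := mul_nonneg (vortConst_nonneg ω) (by positivity : 0 ≤ 4 * Real.sqrt α)
    rwa [← ofReal_norm, ENNReal.ofReal_le_ofReal_iff this] at h2
  · rcases eq_or_ne z 0 with rfl | hz
    · simp [blobField_zero, eulerField]
    · refine le_trans ?_ (enorm_eulerField_le z)
      rw [← ofReal_norm]
      exact ENNReal.ofReal_le_ofReal (norm_eulerField_sub_blobField_le hα hz)
  · have hz1 : Real.sqrt α ≤ ‖z‖ := by simpa using hz
    have hz0 : z ≠ 0 := norm_pos_iff.1 (hs.trans_le hz1)
    refine (norm_eulerField_sub_blobField_le_far hα hz0).trans ?_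
    calc 4 * α ^ 2 / ‖z‖ ^ 3 ≤ 4 * α ^ 2 / Real.sqrt α ^ 3 := by gcongr
      _ = 4 * Real.sqrt α := by
          rw [div_eq_iff (by positivity)]
          nth_rewrite 1 [← Real.sq_sqrt hα.le]
          ring

end EulerVelocity

/-! ### The Euler flow as a curve of displacements -/

/-- The equation holds only pointwise in x. Area preservation and the log-Lipschitz estimate make
the velocity bounded and continuous in time in the supremum norm, so differentiability in `Disp`
follows. -/
lemma IsEulerFlow.exists_disp {ω : Plane → ℝ} {η : ℝ → Plane ≃ₜ Plane} (hη : IsEulerFlow ω η)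
    (hω₁ : MemLp ω 1 volume) (hω₂ : MemLp ω ⊤ volume) :
    ∃ X V : ℝ → Disp, X 0 = 0 ∧ (∀ t x, dispMap (X t) x = η t x) ∧
      (∀ t x, V t x = ∫ y, ω y • eulerField (η t x - η t y)) ∧ ∀ t, HasDerivAt X (V t) t := by
  set A := vortConst ω with hA
  have hA0 : 0 ≤ A := vortConst_nonneg ω
  have hd : ∀ x t, HasDerivAt (fun s => η s x) (∫ y, ω y • eulerField (η t x - η t y)) t :=
    fun x t => by simpa only [eulerKernel_eq] using hη.hasDerivAt x t
  have hlip : ∀ x s t, ‖η t x - η s x‖ ≤ A * |t - s| := fun x s t => by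
    simpa using Convex.norm_image_sub_le_of_norm_hasDerivWithin_le (s := Set.univ)
      (fun r _ => (hd x r).hasDerivWithinAt)
      (fun r _ => norm_integral_eulerField_le hω₁ hω₂ (hη.measurePreserving r) _) convex_univ
      (Set.mem_univ s) (Set.mem_univ t)
  let X : ℝ → Disp := fun t => BoundedContinuousFunction.ofNormedAddCommGroup
    (fun x => η t x - x) ((η t).continuous.sub continuous_id) (A * |t|)
    (fun x => by simpa [hη.initial] using hlip x 0 t)
  have hXapp : ∀ t x, X t x = η t x - x := fun _ _ => rfl
  have hcont : ∀ t, Continuous fun p : Plane => ∫ y, ω y • eulerField (p - η t y) := fun t =>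
    continuous_of_logMod (C := 2 * A) (by positivity) fun N p p' =>
      norm_integral_eulerField_sub_le hω₁ hω₂ (hη.measurePreserving t) (hη.measurePreserving t)
        (fun y => by simp) N
  let V : ℝ → Disp := fun t => BoundedContinuousFunction.ofNormedAddCommGroup
    (fun x => ∫ y, ω y • eulerField (η t x - η t y)) ((hcont t).comp (η t).continuous) A
    (fun x => norm_integral_eulerField_le hω₁ hω₂ (hη.measurePreserving t) _)
  have hVapp : ∀ t x, V t x = ∫ y, ω y • eulerField (η t x - η t y) := fun _ _ => rfl
  have hV : Continuous V := by
    refine continuous_of_logMod (C := 2 * A * (2 * A + 1)) (by positivity) fun N t s => ?_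
    have hl := logMod_nonneg N (norm_nonneg (t - s))
    rw [BoundedContinuousFunction.norm_le (by positivity)]
    intro x
    rw [BoundedContinuousFunction.sub_apply, hVapp, hVapp]
    -- Two particles each move by at most A |t - s|; the extra 1 makes the factor at least 1, as
    -- `logMod_le_mul` needs.
    refine (norm_integral_eulerField_sub_le hω₁ hω₂ (hη.measurePreserving t)
      (hη.measurePreserving s) (D := (2 * A + 1) * ‖t - s‖) (fun y => ?_) N).trans ?_
    · have h1 := hlip x s t
      have h2 := hlip y s t
      have h3 : η t x - η t y - (η s x - η s y) = (η t x - η s x) - (η t y - η s y) := by abel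
      rw [h3]
      refine (norm_sub_le _ _).trans ?_
      rw [Real.norm_eq_abs]
      nlinarith [abs_nonneg (t - s)]
    · have h4 := logMod_le_mul N (d := ‖t - s‖) (c := 2 * A + 1) (by linarith)
      rw [mul_assoc (2 * A)]
      gcongr
  refine ⟨X, V, by ext1 x; simp [hXapp, hη.initial], fun t x => by simp [hXapp], hVapp,
    hasDerivAt_disp hV fun t x => ?_⟩
  exact (hd x t).sub_const x

/-! ### Absolutely continuous vorticity -/

/-- The positive part of the vorticity, as a measure. -/
abbrev vortPos (ω : Plane → ℝ) : Measure Plane :=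
  volume.withDensity fun y => ENNReal.ofReal (ω y)

/-- The negative part of the vorticity, as a measure. -/
abbrev vortNeg (ω : Plane → ℝ) : Measure Plane :=
  volume.withDensity fun y => ENNReal.ofReal (-ω y)

lemma isFiniteMeasure_vortPos {ω : Plane → ℝ} (hω : Integrable ω) : IsFiniteMeasure (vortPos ω) :=
  isFiniteMeasure_withDensity_ofReal hω.2

lemma isFiniteMeasure_vortNeg {ω : Plane → ℝ} (hω : Integrable ω) : IsFiniteMeasure (vortNeg ω) :=
  isFiniteMeasure_withDensity_ofReal hω.neg.2

lemma integral_withDensity_ofReal {E : Type*} [NormedAddCommGroup E] [NormedSpace ℝ E]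
    {ω : Plane → ℝ} (hω : Integrable ω) (f : Plane → E) :
    ∫ y, f y ∂(volume.withDensity fun y => ENNReal.ofReal (ω y)) = ∫ y, max (ω y) 0 • f y := by
  rw [integral_withDensity_eq_integral_toReal_smul₀ hω.1.aemeasurable.ennreal_ofReal
    (.of_forall fun _ => ENNReal.ofReal_lt_top)]
  simp only [ENNReal.toReal_ofReal']

lemma pairIntegral_vort {E : Type*} [NormedAddCommGroup E] [NormedSpace ℝ E]
    [SecondCountableTopology E] {ω : Plane → ℝ} (hω : Integrable ω) {f : Plane → E}
    (hf : Continuous f) {c : ℝ} (hc : ∀ y, ‖f y‖ ≤ c) :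
    pairIntegral (vortPos ω) (vortNeg ω) f = ∫ y, ω y • f y := by
  have hb : MemLp f ⊤ (volume : Measure Plane) :=
    memLp_top_of_bound hf.aestronglyMeasurable c (.of_forall hc)
  have h1 : Integrable fun y => max (ω y) 0 • f y := hω.pos_part.smul_of_top_left hb
  have h2 : Integrable fun y => max (-ω y) 0 • f y := hω.neg_part.smul_of_top_left hb
  rw [pairIntegral, vortPos, vortNeg, integral_withDensity_ofReal hω,
    integral_withDensity_ofReal (ω := fun y => -ω y) hω.neg, ← integral_sub h1 h2]
  congr 1
  funext y
  rw [← sub_smul]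
  congr 1
  rcases le_total 0 (ω y) with h | h
  · rw [max_eq_left h, max_eq_right (by linarith)]; ring
  · rw [max_eq_right h, max_eq_left (by linarith)]; ring

/-! ### Blob flows converge to the Euler flow -/

/-- The displacement of the flow of the vortex blob method. -/
def blobFlowDisp {α : ℝ} (hα : 0 < α) (μ ν : Measure Plane) [IsFiniteMeasure μ]
    [IsFiniteMeasure ν] : ℝ → Disp :=
  (admissibleKernel_blobDisp hα).disp μ ν (ContinuousMap.id Plane)

lemma blobFlow_apply {α : ℝ} (hα : 0 < α) (μ ν : Measure Plane) [IsFiniteMeasure μ]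
    [IsFiniteMeasure ν] (t : ℝ) (x : Plane) :
    blobFlow hα μ ν t x = dispMap (blobFlowDisp hα μ ν t) x := rfl

lemma hasDerivAt_blobFlowDisp {α : ℝ} (hα : 0 < α) (μ ν : Measure Plane) [IsFiniteMeasure μ]
    [IsFiniteMeasure ν] (t : ℝ) :
    HasDerivAt (blobFlowDisp hα μ ν) (lagField (blobDisp hα) μ ν (ContinuousMap.id Plane)
      (blobFlowDisp hα μ ν t)) t :=
  (admissibleKernel_blobDisp hα).hasDerivAt_disp t

lemma blobFlowDisp_zero {α : ℝ} (hα : 0 < α) (μ ν : Measure Plane) [IsFiniteMeasure μ]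
    [IsFiniteMeasure ν] : blobFlowDisp hα μ ν 0 = 0 :=
  (admissibleKernel_blobDisp hα).disp_zero

/-- As `α → 0`, the blob flow of a bounded integrable vorticity converges to the Euler flow. -/
theorem blobFlowDisp_tendsto_euler {ω : Plane → ℝ} (hω₁ : MemLp ω 1 volume)
    (hω₂ : MemLp ω ⊤ volume) [IsFiniteMeasure (vortPos ω)] [IsFiniteMeasure (vortNeg ω)]
    {η : ℝ → Plane ≃ₜ Plane} (hη : IsEulerFlow ω η) {X V : ℝ → Disp} (hX0 : X 0 = 0)
    (hXη : ∀ t x, dispMap (X t) x = η t x)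
    (hV : ∀ t x, V t x = ∫ y, ω y • eulerField (η t x - η t y))
    (hX : ∀ t, HasDerivAt X (V t) t) {α : ℕ → ℝ} (hα : ∀ j, 0 < α j)
    (hα0 : Tendsto α atTop (𝓝 0)) (T : ℝ) {ε : ℝ} (hε : 0 < ε) :
    ∀ᶠ j in atTop, ∀ t ∈ Set.Icc 0 T,
      ‖blobFlowDisp (hα j) (vortPos ω) (vortNeg ω) t - X t‖ ≤ ε := by
  have hinteg : Integrable ω := memLp_one_iff_integrable.1 hω₁
  have hA0 := vortConst_nonneg ω
  have hδ : Tendsto (fun j => vortConst ω * (4 * Real.sqrt (α j))) atTop (𝓝 0) := by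
    have h1 : Tendsto (fun j => Real.sqrt (α j)) atTop (𝓝 0) := by
      simpa [Function.comp_def] using (Real.continuous_sqrt.tendsto 0).comp hα0
    simpa using (h1.const_mul 4).const_mul (vortConst ω)
  refine osgood_uniform (C := 4 * vortConst ω + 1) (by positivity)
    (f := fun j t => blobFlowDisp (hα j) (vortPos ω) (vortNeg ω) t - X t)
    (f' := fun j t => lagField (blobDisp (hα j)) (vortPos ω) (vortNeg ω) (ContinuousMap.id Plane)
      (blobFlowDisp (hα j) (vortPos ω) (vortNeg ω) t) - V t) hδ ?_
    (.of_forall fun j t _ => (hasDerivAt_blobFlowDisp (hα j) _ _ t).sub (hX t))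
    (.of_forall fun j t _ N => ?_) hε
  · simp [blobFlowDisp_zero, hX0]
  · set Y := blobFlowDisp (hα j) (vortPos ω) (vortNeg ω) t with hY
    have hl := logMod_nonneg N (norm_nonneg (Y - X t))
    rw [BoundedContinuousFunction.norm_le (by positivity)]
    intro x
    have hmp : MeasurePreserving (dispMap Y) volume volume :=
      (admissibleKernel_blobDisp (hα j)).measurePreserving_flow t
    -- The intermediate velocity is the Euler kernel applied to ω carried by the blob flow. The
    -- log-Lipschitz constant then comes from the Euler kernel alone and is independent of α.
    have h1 := norm_integral_blobField_sub_eulerField_le hω₁ hω₂ hmp (dispMap Y x) (hα j)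
    have h2 := norm_integral_eulerField_sub_le hω₁ hω₂ hmp (hη.measurePreserving t)
      (p := dispMap Y x) (p' := η t x) (D := 2 * ‖Y - X t‖) (fun y => by
        simpa only [hXη] using norm_dispMap_sub_sub_le Y (X t) x y) N
    have h3 : lagField (blobDisp (hα j)) (vortPos ω) (vortNeg ω) (ContinuousMap.id Plane) Y x =
        ∫ y, ω y • blobField (α j) (dispMap Y x - dispMap Y y) :=
      pairIntegral_vort hinteg (f := fun y => blobDisp (hα j) (dispMap Y x - dispMap Y y))
        (by fun_prop) (fun y => (blobDisp (hα j)).norm_coe_le_norm _)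
    rw [BoundedContinuousFunction.sub_apply, h3, hV]
    have h4 := logMod_le_mul N (d := ‖Y - X t‖) one_le_two
    have h5 := norm_sub_le_norm_sub_add_norm_sub
      (∫ y, ω y • blobField (α j) (dispMap Y x - dispMap Y y))
      (∫ y, ω y • eulerField (dispMap Y x - dispMap Y y)) (∫ y, ω y • eulerField (η t x - η t y))
    have h6 : 2 * vortConst ω * logMod N (2 * ‖Y - X t‖) ≤
        4 * vortConst ω * logMod N ‖Y - X t‖ := by
      calc _ ≤ 2 * vortConst ω * (2 * logMod N ‖Y - X t‖) := by gcongr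
        _ = _ := by ring
    linarith

/-! ### Weak convergence of signed measures without loss of mass -/

/-- Weak convergence of `μ n - ν n` to `μ' - ν'`, with convergence of the total variations; the
last condition says that the total variation of `μ' - ν'` is the mass of `μ' + ν'`. -/
structure PairConverges (μ ν : ℕ → Measure Plane) (μ' ν' : Measure Plane) : Prop where
  weak : ∀ φ : Plane → ℝ, Continuous φ → HasCompactSupport φ →
    Tendsto (fun n => pairIntegral (μ n) (ν n) φ) atTop (𝓝 (pairIntegral μ' ν' φ))
  mass : Tendsto (fun n => pairMass (μ n) (ν n)) atTop (𝓝 (pairMass μ' ν'))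
  attained : ∀ ε > 0, ∃ φ : Plane → ℝ, Continuous φ ∧ HasCompactSupport φ ∧ (∀ y, |φ y| ≤ 1) ∧
    pairMass μ' ν' - pairIntegral μ' ν' φ ≤ ε

/-- The factor 1 - |φ| is at most 1 - φ against μ and at most 1 + φ against ν. Hence a compactly
supported φ that nearly attains the total mass leaves little mass outside its support. -/
lemma norm_pairIntegral_one_sub_abs_smul_le {μ ν : Measure Plane} [IsFiniteMeasure μ]
    [IsFiniteMeasure ν] {φ : Plane → ℝ} (hφ : Continuous φ) (hφ1 : ∀ y, |φ y| ≤ 1)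
    {f : Plane → Plane} {c : ℝ} (hc : ∀ y, ‖f y‖ ≤ c) :
    ‖pairIntegral μ ν fun y => (1 - |φ y|) • f y‖ ≤ c * (pairMass μ ν - pairIntegral μ ν φ) := by
  have hc0 : 0 ≤ c := (norm_nonneg _).trans (hc 0)
  have hinteg : ∀ (μ : Measure Plane) [IsFiniteMeasure μ], Integrable φ μ := fun μ _ =>
    integrable_of_continuous_of_bounded hφ (c := 1) hφ1
  have hb : ∀ y, ‖(1 - |φ y|) • f y‖ ≤ (1 - |φ y|) * c := fun y => by
    rw [norm_smul, Real.norm_of_nonneg (by linarith [hφ1 y])]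
    exact mul_le_mul_of_nonneg_left (hc y) (by linarith [hφ1 y])
  have h1 : ‖∫ y, (1 - |φ y|) • f y ∂μ‖ ≤ ∫ y, c * (1 - φ y) ∂μ := by
    refine norm_integral_le_of_norm_le (((integrable_const 1).sub (hinteg μ)).const_mul c)
      (.of_forall fun y => (hb y).trans ?_)
    rw [mul_comm]
    exact mul_le_mul_of_nonneg_left (by linarith [le_abs_self (φ y)]) hc0
  have h2 : ‖∫ y, (1 - |φ y|) • f y ∂ν‖ ≤ ∫ y, c * (1 + φ y) ∂ν := by
    refine norm_integral_le_of_norm_le (((integrable_const 1).add (hinteg ν)).const_mul c)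
      (.of_forall fun y => (hb y).trans ?_)
    rw [mul_comm]
    exact mul_le_mul_of_nonneg_left (by linarith [neg_abs_le (φ y)]) hc0
  rw [integral_const_mul, integral_sub (integrable_const 1) (hinteg μ)] at h1
  rw [integral_const_mul, integral_add (integrable_const 1) (hinteg ν)] at h2
  simp only [integral_const, smul_eq_mul, mul_one] at h1 h2
  rw [pairIntegral, pairIntegral, pairMass]
  refine (norm_sub_le _ _).trans ((add_le_add h1 h2).trans (le_of_eq ?_))
  ring

lemma PairConverges.weak_vector {μ ν : ℕ → Measure Plane} {μ' ν' : Measure Plane}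
    [∀ n, IsFiniteMeasure (μ n)] [∀ n, IsFiniteMeasure (ν n)] [IsFiniteMeasure μ']
    [IsFiniteMeasure ν'] (h : PairConverges μ ν μ' ν') {f : Plane → Plane} (hf : Continuous f)
    (hc : HasCompactSupport f) :
    Tendsto (fun n => pairIntegral (μ n) (ν n) f) atTop (𝓝 (pairIntegral μ' ν' f)) := by
  have hcoord : ∀ i, Continuous fun y => f y i := fun i => by fun_prop
  have hcs : ∀ i, HasCompactSupport fun y => f y i := fun i =>
    hc.comp_left (g := fun v : Plane => v i) rfl
  have hdec : ∀ (μ ν : Measure Plane) [IsFiniteMeasure μ] [IsFiniteMeasure ν],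
      pairIntegral μ ν f = pairIntegral μ ν (fun y => f y 0) • EuclideanSpace.single 0 (1 : ℝ) +
        pairIntegral μ ν (fun y => f y 1) • EuclideanSpace.single 1 (1 : ℝ) := by
    intro μ ν _ _
    have hi : ∀ (μ : Measure Plane) [IsFiniteMeasure μ] (i : Fin 2),
        Integrable (fun y => f y i • EuclideanSpace.single i (1 : ℝ)) μ := fun μ _ i =>
      ((hcoord i).integrable_of_hasCompactSupport (hcs i)).smul_const _
    have hfe : f = fun y => f y 0 • EuclideanSpace.single 0 (1 : ℝ) +
        f y 1 • EuclideanSpace.single 1 (1 : ℝ) := by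
      funext y
      ext i
      fin_cases i <;> simp
    have hm : ∀ (μ : Measure Plane) [IsFiniteMeasure μ], ∫ y, f y ∂μ =
        (∫ y, f y 0 ∂μ) • EuclideanSpace.single 0 (1 : ℝ) +
        (∫ y, f y 1 ∂μ) • EuclideanSpace.single 1 (1 : ℝ) := fun μ _ => by
      conv_lhs => rw [hfe]
      rw [integral_add (hi μ 0) (hi μ 1), integral_smul_const, integral_smul_const]
    rw [pairIntegral, pairIntegral, pairIntegral, hm μ, hm ν, sub_smul, sub_smul]
    abel
  simp only [hdec]
  exact ((h.weak _ (hcoord 0) (hcs 0)).smul_const _).add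
    ((h.weak _ (hcoord 1) (hcs 1)).smul_const _)

set_option maxHeartbeats 1000000 in
/-- Uniform convergence of the velocities, along a curve of displacements. -/
theorem PairConverges.lagField_uniform {μ ν : ℕ → Measure Plane} {μ' ν' : Measure Plane}
    [∀ n, IsFiniteMeasure (μ n)] [∀ n, IsFiniteMeasure (ν n)] [IsFiniteMeasure μ']
    [IsFiniteMeasure ν'] (h : PairConverges μ ν μ' ν') {k : Disp} {C : ℝ}
    (hk : AdmissibleKernel k C) (hdecay : Tendsto k (cocompact Plane) (𝓝 0)) {X : ℝ → Disp}
    (hX : Continuous X) (T : ℝ) {ε : ℝ} (hε : 0 < ε) :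
    ∀ᶠ n in atTop, ∀ t ∈ Set.Icc 0 T,
      ‖lagField k (μ n) (ν n) (ContinuousMap.id Plane) (X t) -
        lagField k μ' ν' (ContinuousMap.id Plane) (X t)‖ ≤ ε := by
  set m := pairMass μ' ν' + 1 with hm
  have hm'0 := pairMass_nonneg μ' ν'
  have hm0 : 0 < m := by positivity
  have hmass : ∀ᶠ n in atTop, pairMass (μ n) (ν n) ≤ m :=
    h.mass.eventually (Iic_mem_nhds (by linarith))
  -- the part of the vorticity near infinity
  set e₁ := ε / (8 * (‖k‖ + 1)) with he₁
  have he₁0 : 0 < e₁ := by positivity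
  obtain ⟨φ, hφ, hφc, hφ1, hφd⟩ := h.attained e₁ he₁0
  -- The defect of φ for the n-th data converges to its defect for the limit, which is at most e₁.
  have hdef : ∀ᶠ n in atTop, pairMass (μ n) (ν n) - pairIntegral (μ n) (ν n) φ ≤ 2 * e₁ :=
    (h.mass.sub (h.weak φ hφ hφc)).eventually (Iic_mem_nhds (by linarith))
  -- the localized integrand
  set f : Plane × ℝ → Plane → Plane := fun z y => |φ y| • k (z.1 - dispMap (X z.2) y) with hf
  have hfcont : ∀ z, Continuous (f z) := fun z => by rw [hf]; fun_prop
  have hfcs : ∀ z, HasCompactSupport (f z) := fun z =>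
    HasCompactSupport.smul_right (f' := fun y => k (z.1 - dispMap (X z.2) y))
      (hφc.comp_left (g := fun r : ℝ => |r|) abs_zero)
  have hfint : ∀ z (μ : Measure Plane) [IsFiniteMeasure μ], Integrable (f z) μ := fun z μ _ =>
    (hfcont z).integrable_of_hasCompactSupport (hfcs z)
  set G : ℕ → Plane × ℝ → Plane := fun n z =>
    pairIntegral (μ n) (ν n) (f z) - pairIntegral μ' ν' (f z) with hG
  set e₂ := ε / (8 * m) with he₂
  have he₂0 : 0 < e₂ := by positivity
  have hGle : ∀ n z c, pairMass (μ n) (ν n) ≤ m → 0 ≤ c → (∀ y, ‖f z y‖ ≤ c) →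
      ‖G n z‖ ≤ 2 * (c * m) := by
    intro n z c hn hc0 hc
    have h1 := norm_pairIntegral_le (μ := μ n) (ν := ν n) hc
    have h2 := norm_pairIntegral_le (μ := μ') (ν := ν') hc
    have h3 : c * pairMass (μ n) (ν n) ≤ c * m := by gcongr
    have h4 : c * pairMass μ' ν' ≤ c * m := by gcongr; linarith
    exact (norm_sub_le _ _).trans (by linarith)
  have hGdiff : ∀ n z z' c, pairMass (μ n) (ν n) ≤ m → 0 ≤ c → (∀ y, ‖f z y - f z' y‖ ≤ c) →
      ‖G n z - G n z'‖ ≤ 2 * (c * m) := by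
    intro n z z' c hn hc0 hc
    have h1 := norm_pairIntegral_le (μ := μ n) (ν := ν n) hc
    have h2 := norm_pairIntegral_le (μ := μ') (ν := ν') hc
    rw [← pairIntegral_sub (hfint z _) (hfint z _) (hfint z' _) (hfint z' _)] at h1 h2
    have h3 : c * pairMass (μ n) (ν n) ≤ c * m := by gcongr
    have h4 : c * pairMass μ' ν' ≤ c * m := by gcongr; linarith
    have h5 : G n z - G n z' = (pairIntegral (μ n) (ν n) (f z) - pairIntegral (μ n) (ν n) (f z')) -
        (pairIntegral μ' ν' (f z) - pairIntegral μ' ν' (f z')) := by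
      simp only [hG]; abel
    rw [h5]
    exact (norm_sub_le _ _).trans (by linarith)
  have he₂m : 2 * (e₂ * m) = ε / 4 := by rw [he₂]; field_simp; norm_num
  -- far away positions
  obtain ⟨R, hR⟩ := hφc.isCompact.isBounded.subset_closedBall (0 : Plane)
  obtain ⟨b, hb⟩ : ∃ b, ∀ t ∈ Set.Icc 0 T, ‖X t‖ ≤ b := by
    obtain ⟨b, hb⟩ := isCompact_Icc.exists_bound_of_continuousOn
      (hX.continuousOn (s := Set.Icc 0 T))
    exact ⟨b, hb⟩
  obtain ⟨ρ, hρ⟩ : ∃ ρ, ∀ z : Plane, ρ < ‖z‖ → ‖k z‖ ≤ e₂ := by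
    have h1 : ∀ᶠ z in cocompact Plane, ‖k z‖ ≤ e₂ := by
      have := hdecay.norm
      rw [norm_zero] at this
      exact this.eventually (Iic_mem_nhds he₂0)
    rw [← Metric.cobounded_eq_cocompact, ← comap_norm_atTop, eventually_comap] at h1
    obtain ⟨ρ, hρ⟩ := eventually_atTop.1 h1
    exact ⟨ρ, fun z hz => hρ _ hz.le z rfl⟩
  have hfar : ∀ n z, pairMass (μ n) (ν n) ≤ m → z.2 ∈ Set.Icc 0 T → ρ + R + b < ‖z.1‖ →
      ‖G n z‖ ≤ ε / 4 := by
    intro n z hn hz hz1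
    rw [← he₂m]
    refine hGle n z e₂ hn he₂0.le fun y => ?_
    by_cases hy : φ y = 0
    · simp [hf, hy, he₂0.le]
    · have hyR : ‖y‖ ≤ R := by simpa using hR (subset_tsupport _ hy)
      have h1 := (X z.2).norm_coe_le_norm y
      have h2 := hb _ hz
      have h3 : ‖dispMap (X z.2) y‖ ≤ R + b := by
        rw [dispMap_apply]; exact (norm_add_le _ _).trans (by linarith)
      have h4 := norm_sub_norm_le z.1 (dispMap (X z.2) y)
      rw [hf]
      simp only
      rw [norm_smul, Real.norm_eq_abs, abs_abs]
      exact (mul_le_of_le_one_left (norm_nonneg _) (hφ1 y)).trans (hρ _ (by linarith))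
  -- positions in a compact set
  have hnear : ∀ᶠ n in atTop, ∀ z ∈ Metric.closedBall (0 : Plane) (ρ + R + b) ×ˢ Set.Icc 0 T,
      ‖G n z‖ ≤ ε / 2 := by
    refine ((isCompact_closedBall (0 : Plane) (ρ + R + b)).prod isCompact_Icc).induction_on
      (p := fun s => ∀ᶠ n in atTop, ∀ z ∈ s, ‖G n z‖ ≤ ε / 2) (by simp)
      (fun s t hst ht => ht.mono fun n hn z hz => hn z (hst hz))
      (fun s t hs ht => by
        filter_upwards [hs, ht] with n h1 h2 z hz using hz.elim (h1 z) (h2 z)) fun z₀ _ => ?_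
    -- Equicontinuity: near z₀ the integrand changes by at most e₂ at all labels, and the masses are
    -- bounded, so convergence at z₀ spreads to a neighbourhood independent of n.
    obtain ⟨δ, hδ, N, hN⟩ := exists_logMod_le hk.pos.le he₂0
    have hopen : {z : Plane × ℝ | ‖z.1 - z₀.1‖ + ‖X z.2 - X z₀.2‖ < δ} ∈ 𝓝 z₀ := by
      refine IsOpen.mem_nhds ?_ (by simpa using hδ)
      exact isOpen_lt (by fun_prop) continuous_const
    refine ⟨_, mem_nhdsWithin_of_mem_nhds hopen, ?_⟩
    have hpt : ∀ᶠ n in atTop, ‖G n z₀‖ ≤ ε / 4 := by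
      have h1 := tendsto_iff_norm_sub_tendsto_zero.1 (h.weak_vector (hfcont z₀) (hfcs z₀))
      exact h1.eventually (Iic_mem_nhds (by positivity))
    filter_upwards [hpt, hmass] with n h1 h2 z hz
    have h3 : ‖G n z - G n z₀‖ ≤ ε / 4 := by
      rw [← he₂m]
      refine hGdiff n z z₀ e₂ h2 he₂0.le fun y => ?_
      simp only [hf]
      rw [← smul_sub, norm_smul, Real.norm_eq_abs, abs_abs]
      refine (mul_le_of_le_one_left (norm_nonneg _) (hφ1 y)).trans ((hk.logLip N _ _).trans
        (hN _ (le_trans ?_ (le_of_lt hz))))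
      have h4 := (X z.2 - X z₀.2).norm_coe_le_norm y
      have h5 : z.1 - dispMap (X z.2) y - (z₀.1 - dispMap (X z₀.2) y) =
          (z.1 - z₀.1) - (X z.2 - X z₀.2) y := by
        simp only [dispMap_apply, BoundedContinuousFunction.sub_apply]; abel
      rw [h5]
      exact (norm_sub_le _ _).trans (by linarith)
    have h6 : ‖G n z‖ ≤ ‖G n z₀‖ + ‖G n z - G n z₀‖ := norm_le_norm_add_norm_sub' _ _
    linarith
  filter_upwards [hmass, hdef, hnear] with n hn1 hn2 hn3 t ht
  rw [BoundedContinuousFunction.norm_le hε.le]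
  intro x
  set z : Plane × ℝ := (dispMap (X t) x, t) with hz
  have hGz : ‖G n z‖ ≤ ε / 2 := by
    by_cases hzn : ρ + R + b < ‖z.1‖
    · linarith [hfar n z hn1 ht hzn]
    · exact hn3 z ⟨by simpa using not_lt.1 hzn, ht⟩
  set u : Plane → Plane := fun y => k (dispMap (X t) x - dispMap (X t) y) with hu
  have hub : ∀ y, ‖u y‖ ≤ ‖k‖ := fun y => k.norm_coe_le_norm _
  have hui : ∀ (μ : Measure Plane) [IsFiniteMeasure μ], Integrable u μ := fun μ _ =>
    integrable_kernel_comp k (dispMap (X t)) _ μ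
  have hsplit : ∀ (μ ν : Measure Plane) [IsFiniteMeasure μ] [IsFiniteMeasure ν],
      pairIntegral μ ν u = pairIntegral μ ν (f z) +
        pairIntegral μ ν fun y => (1 - |φ y|) • u y := by
    intro μ ν _ _
    have h1 := pairIntegral_sub (hui μ) (hui ν) (hfint z μ) (hfint z ν)
    have h2 : (fun y => u y - f z y) = fun y => (1 - |φ y|) • u y := by
      funext y
      rw [sub_smul, one_smul]
    rw [← h2, ← h1]
    abel
  have ht1 := norm_pairIntegral_one_sub_abs_smul_le (μ := μ n) (ν := ν n) hφ hφ1 hub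
  have ht2 := norm_pairIntegral_one_sub_abs_smul_le (μ := μ') (ν := ν') hφ hφ1 hub
  have hk0 := norm_nonneg k
  have ht3 : ‖k‖ * (pairMass (μ n) (ν n) - pairIntegral (μ n) (ν n) φ) ≤ ‖k‖ * (2 * e₁) := by
    gcongr
  have ht4 : ‖k‖ * (pairMass μ' ν' - pairIntegral μ' ν' φ) ≤ ‖k‖ * e₁ := by gcongr
  -- The two tails cost at most 3ε/8 together, besides ε/2 for the localized part.
  have ht5 : (‖k‖ + 1) * e₁ = ε / 8 := by rw [he₁]; field_simp
  have hgoal : (lagField k (μ n) (ν n) (ContinuousMap.id Plane) (X t) -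
        lagField k μ' ν' (ContinuousMap.id Plane) (X t)) x =
      G n z + ((pairIntegral (μ n) (ν n) fun y => (1 - |φ y|) • u y) -
        pairIntegral μ' ν' fun y => (1 - |φ y|) • u y) := by
    have e1 : (lagField k (μ n) (ν n) (ContinuousMap.id Plane) (X t) -
        lagField k μ' ν' (ContinuousMap.id Plane) (X t)) x =
        pairIntegral (μ n) (ν n) u - pairIntegral μ' ν' u := rfl
    rw [e1, hsplit, hsplit]
    simp only [hG]
    abel
  rw [hgoal]
  have h7 := norm_add_le (G n z) ((pairIntegral (μ n) (ν n) fun y => (1 - |φ y|) • u y) -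
        pairIntegral μ' ν' fun y => (1 - |φ y|) • u y)
  have h8 := norm_sub_le (pairIntegral (μ n) (ν n) fun y => (1 - |φ y|) • u y)
        (pairIntegral μ' ν' fun y => (1 - |φ y|) • u y)
  linarith

/-- For a fixed admissible kernel, the flows converge when the initial data converge. -/
theorem PairConverges.disp_uniform {μ ν : ℕ → Measure Plane} {μ' ν' : Measure Plane}
    [∀ n, IsFiniteMeasure (μ n)] [∀ n, IsFiniteMeasure (ν n)] [IsFiniteMeasure μ']
    [IsFiniteMeasure ν'] (h : PairConverges μ ν μ' ν') {k : Disp} {C : ℝ}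
    (hk : AdmissibleKernel k C) (hdecay : Tendsto k (cocompact Plane) (𝓝 0)) {T : ℝ} (hT : 0 < T)
    {ε : ℝ} (hε : 0 < ε) :
    ∀ᶠ n in atTop, ∀ t ∈ Set.Icc 0 T,
      ‖hk.disp (μ n) (ν n) (ContinuousMap.id Plane) t -
        hk.disp μ' ν' (ContinuousMap.id Plane) t‖ ≤ ε := by
  set X := hk.disp μ' ν' (ContinuousMap.id Plane) with hX
  have hXd : ∀ t, HasDerivAt X (lagField k μ' ν' (ContinuousMap.id Plane) (X t)) t :=
    hk.hasDerivAt_disp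
  have hXc : Continuous X := continuous_iff_continuousAt.2 fun t => (hXd t).continuousAt
  -- Osgood stability needs an error independent of time, so the velocity discrepancy is maximized
  -- over [0, T]. It is measured only along the limit curve X; the log-Lipschitz bound accounts for
  -- the distance to it.
  set a : ℕ → Set.Icc (0 : ℝ) T → ℝ := fun n t =>
    ‖lagField k (μ n) (ν n) (ContinuousMap.id Plane) (X t) -
      lagField k μ' ν' (ContinuousMap.id Plane) (X t)‖ with ha
  have hne : Nonempty (Set.Icc (0 : ℝ) T) := ⟨⟨0, le_rfl, hT.le⟩⟩
  have hbdd : ∀ n, BddAbove (Set.range (a n)) := fun n => by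
    refine ⟨‖k‖ * pairMass (μ n) (ν n) + ‖k‖ * pairMass μ' ν', ?_⟩
    rintro _ ⟨t, rfl⟩
    exact (norm_sub_le _ _).trans (add_le_add (norm_lagField_le _) (norm_lagField_le _))
  have hδ : Tendsto (fun n => ⨆ t, a n t) atTop (𝓝 0) := by
    rw [Metric.tendsto_nhds]
    intro e he
    filter_upwards [h.lagField_uniform hk hdecay hXc T (half_pos he)] with n hn
    rw [dist_zero_right, Real.norm_of_nonneg (Real.iSup_nonneg fun t => norm_nonneg _)]
    exact (ciSup_le fun t : Set.Icc (0 : ℝ) T => hn t.1 t.2).trans_lt (half_lt_self he)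
  have hm'0 := pairMass_nonneg μ' ν'
  have hmass : ∀ᶠ n in atTop, pairMass (μ n) (ν n) ≤ pairMass μ' ν' + 1 :=
    h.mass.eventually (Iic_mem_nhds (by linarith))
  have hC := hk.pos
  refine osgood_uniform (C := 2 * C * (pairMass μ' ν' + 1) + 1) (by positivity)
    (f := fun n t => hk.disp (μ n) (ν n) (ContinuousMap.id Plane) t - X t)
    (f' := fun n t => lagField k (μ n) (ν n) (ContinuousMap.id Plane)
      (hk.disp (μ n) (ν n) (ContinuousMap.id Plane) t) -
      lagField k μ' ν' (ContinuousMap.id Plane) (X t)) hδ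
    (by simp [hX, hk.disp_zero])
    (.of_forall fun n t _ => (hk.hasDerivAt_disp t).sub (hXd t)) ?_ hε
  filter_upwards [hmass] with n hn t ht N
  set Y := hk.disp (μ n) (ν n) (ContinuousMap.id Plane) t
  have h1 := hk.lagField_logLip (μ := μ n) (ν := ν n) (g := ContinuousMap.id Plane) N Y (X t)
  have h2 : a n ⟨t, ht⟩ ≤ ⨆ t, a n t := le_ciSup (hbdd n) ⟨t, ht⟩
  have h3 := norm_sub_le_norm_sub_add_norm_sub
    (lagField k (μ n) (ν n) (ContinuousMap.id Plane) Y)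
    (lagField k (μ n) (ν n) (ContinuousMap.id Plane) (X t))
    (lagField k μ' ν' (ContinuousMap.id Plane) (X t))
  have h4 : (2 * C * pairMass (μ n) (ν n) + 1) * logMod N ‖Y - X t‖ ≤
      (2 * C * (pairMass μ' ν' + 1) + 1) * logMod N ‖Y - X t‖ := by
    have := logMod_nonneg N (norm_nonneg (Y - X t))
    gcongr
  exact h3.trans (add_le_add (h1.trans h4) h2)

/-! ### Verification for a bounded integrable limit -/

lemma pairMass_vort {ω : Plane → ℝ} (hω : Integrable ω) :
    pairMass (vortPos ω) (vortNeg ω) = ∫ y, |ω y| := by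
  have h1 := integral_withDensity_ofReal hω fun _ => (1 : ℝ)
  have h2 := integral_withDensity_ofReal hω.neg fun _ => (1 : ℝ)
  simp only [integral_const, smul_eq_mul, mul_one, Pi.neg_apply] at h1 h2
  rw [pairMass, h1, h2, ← integral_add hω.pos_part hω.neg_part]
  congr 1
  funext y
  rcases le_total 0 (ω y) with h | h
  · rw [max_eq_left h, max_eq_right (by linarith), abs_of_nonneg h]; ring
  · rw [max_eq_right h, max_eq_left (by linarith), abs_of_nonpos h]; ring

/-- The sign of ω is approximated in L¹(|ω| dx) by a compactly supported continuous function, then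
clamped to [-1, 1]; clamping does not increase the distance to ±1. -/
lemma exists_compactSupport_approx_sign {ω : Plane → ℝ} (hω : Integrable ω) {ε : ℝ} (hε : 0 < ε) :
    ∃ φ : Plane → ℝ, Continuous φ ∧ HasCompactSupport φ ∧ (∀ y, |φ y| ≤ 1) ∧
      (∫ y, |ω y|) - ∫ y, ω y * φ y ≤ ε := by
  set ω' := hω.1.mk ω with hω'
  have hω'm : Measurable ω' := hω.1.stronglyMeasurable_mk.measurable
  have hωω' : ω =ᵐ[volume] ω' := hω.1.ae_eq_mk
  set s : Plane → ℝ := fun y => if 0 ≤ ω' y then 1 else -1 with hs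
  have hsm : Measurable s :=
    Measurable.ite (measurableSet_le measurable_const hω'm) measurable_const measurable_const
  have hsb : ∀ y, |s y| ≤ 1 := fun y => by simp only [hs]; split_ifs <;> simp
  have hsω : ∀ᵐ y, ω y * s y = |ω y| := by
    filter_upwards [hωω'] with y hy
    simp only [hs, hy]
    split_ifs with h
    · rw [abs_of_nonneg h, mul_one]
    · rw [abs_of_neg (not_le.1 h)]; ring
  have hfin : IsFiniteMeasure (volume.withDensity fun y => ENNReal.ofReal |ω y|) :=
    isFiniteMeasure_withDensity_ofReal hω.abs.2
  obtain ⟨g, hgc, hg, hgcont, -⟩ :=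
    (Integrable.of_bound (μ := volume.withDensity fun y => ENNReal.ofReal |ω y|)
      hsm.aestronglyMeasurable 1 (.of_forall hsb)).exists_hasCompactSupport_integral_sub_le hε
  rw [integral_withDensity_ofReal hω.abs] at hg
  have hφ1 : ∀ y, |max (-1) (min 1 (g y))| ≤ 1 := fun y =>
    abs_le.2 ⟨le_max_left _ _, max_le (by norm_num) (min_le_left _ _)⟩
  refine ⟨fun y => max (-1) (min 1 (g y)), by fun_prop,
    hgc.comp_left (g := fun r : ℝ => max (-1) (min 1 r)) (by norm_num), hφ1, ?_⟩
  have hi1 : Integrable fun y => ω y * max (-1) (min 1 (g y)) :=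
    hω.mul_bdd (c := 1) (by fun_prop : Continuous _).aestronglyMeasurable (.of_forall hφ1)
  have hgb : ∃ c, ∀ y, ‖s y - g y‖ ≤ c := by
    obtain ⟨c, hc⟩ := hgc.exists_bound_of_continuous hgcont
    exact ⟨1 + c, fun y => (norm_sub_le _ _).trans (add_le_add (hsb y) (hc y))⟩
  obtain ⟨c, hc⟩ := hgb
  have hi2 : Integrable fun y => max |ω y| 0 • ‖s y - g y‖ := by
    refine hω.abs.pos_part.mul_bdd (c := c)
      ((hsm.sub hgcont.measurable).norm).aestronglyMeasurable (.of_forall fun y => ?_)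
    rw [norm_norm]; exact hc y
  rw [← integral_sub hω.abs hi1]
  refine (integral_mono_ae (hω.abs.sub hi1) hi2 ?_).trans hg
  filter_upwards [hsω] with y hy
  simp only [Pi.sub_apply, smul_eq_mul]
  have hdiff : |ω y| - ω y * max (-1) (min 1 (g y)) =
      ω y * (s y - max (-1) (min 1 (g y))) := by rw [← hy]; ring
  rw [hdiff, max_eq_left (abs_nonneg (ω y))]
  refine (le_abs_self _).trans ?_
  rw [abs_mul, Real.norm_eq_abs]
  refine mul_le_mul_of_nonneg_left ?_ (abs_nonneg _)
  have hsv : s y = 1 ∨ s y = -1 := by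
    simp only [hs]; split_ifs <;> simp
  rcases hsv with h | h
  · rw [h, abs_of_nonneg (sub_nonneg.2 (max_le (by norm_num) (min_le_left _ _)))]
    rcases le_total 1 (g y) with h1 | h1
    · rw [min_eq_left h1]; norm_num
    · rw [min_eq_right h1]
      exact (sub_le_sub_left (le_max_right _ _) _).trans (le_abs_self _)
  · rw [h, abs_sub_comm, abs_sub_comm (-1 : ℝ), abs_of_nonneg (sub_nonneg.2 (le_max_left _ _))]
    rcases le_total (-1) (min 1 (g y)) with h1 | h1
    · rw [max_eq_right h1]
      exact (sub_le_sub_right (min_le_right _ _) _).trans (le_abs_self _)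
    · rw [max_eq_left h1]; simp

lemma pairConverges_of_weaklyConvergesTo {ω : Plane → ℝ} (hω₁ : MemLp ω 1 volume)
    {q : ℕ → SignedMeasure Plane} (hweak : WeaklyConvergesTo q ω)
    (hvar : Tendsto (fun n => (q n).totalVariation Set.univ) atTop (𝓝 (eLpNorm ω 1 volume))) :
    PairConverges (fun n => posPartMeasure (q n)) (fun n => negPartMeasure (q n)) (vortPos ω)
      (vortNeg ω) := by
  have hω : Integrable ω := memLp_one_iff_integrable.1 hω₁
  have hcs : ∀ φ : Plane → ℝ, Continuous φ → HasCompactSupport φ →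
      pairIntegral (vortPos ω) (vortNeg ω) φ = ∫ y, ω y * φ y := fun φ hφ hc => by
    obtain ⟨c, hc⟩ := hc.exists_bound_of_continuous hφ
    exact pairIntegral_vort hω hφ hc
  refine ⟨fun φ hφ hc => ?_, ?_, fun ε hε => ?_⟩
  · have h := hweak φ hφ hc
    simp only [signedMeasure_integral_real_eq _ (hφ.integrable_of_hasCompactSupport hc)
      (hφ.integrable_of_hasCompactSupport hc)] at h
    rw [hcs φ hφ hc]
    simpa only [mul_comm] using h
  · have h1 : ∀ n, pairMass (posPartMeasure (q n)) (negPartMeasure (q n)) =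
        ((q n).totalVariation Set.univ).toReal := fun n => by
      rw [pairMass, Measure.real, Measure.real, SignedMeasure.totalVariation, Measure.add_apply,
        ENNReal.toReal_add (measure_ne_top _ _) (measure_ne_top _ _)]
    have h2 : pairMass (vortPos ω) (vortNeg ω) = (eLpNorm ω 1 volume).toReal := by
      rw [pairMass_vort hω, eLpNorm_one_eq_lintegral_enorm, ← integral_norm_eq_lintegral_enorm hω.1]
      rfl
    simp only [h1, h2]
    exact (ENNReal.tendsto_toReal hω₁.eLpNorm_ne_top).comp hvar
  · obtain ⟨φ, hφ, hφc, hφ1, h⟩ := exists_compactSupport_approx_sign hω hε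
    refine ⟨φ, hφ, hφc, hφ1, ?_⟩
    rwa [pairMass_vort hω, hcs φ hφ hφc]

lemma tendsto_blobDisp_cocompact {α : ℝ} (hα : 0 < α) :
    Tendsto (blobDisp hα) (cocompact Plane) (𝓝 0) := by
  refine squeeze_zero_norm (a := fun z : Plane => (2 * Real.pi * ‖z‖)⁻¹)
    (fun z => norm_blobField_le hα z) ?_
  exact tendsto_inv_atTop_zero.comp ((tendsto_norm_cocompact_atTop).const_mul_atTop (by positivity))

/-! ### The diagonal choice -/

/-- `K n` is the largest k ≤ n whose threshold has been passed at time n: it tends to infinity, but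
slowly enough for `P (K n) n` to hold eventually. -/
lemma exists_diagonal {P : ℕ → ℕ → Prop} (h : ∀ k, ∀ᶠ n in atTop, P k n) :
    ∃ K : ℕ → ℕ, Tendsto K atTop atTop ∧ ∀ k₀, ∀ᶠ n in atTop, k₀ ≤ K n ∧ P (K n) n := by
  classical
  choose n₀ hn₀ using fun k => eventually_atTop.1 (h k)
  set Q : ℕ → ℕ → Prop := fun n k => n₀ k ≤ n with hQ
  set K : ℕ → ℕ := fun n => Nat.findGreatest (Q n) n with hK
  have hge : ∀ k, ∀ᶠ n in atTop, k ≤ K n := fun k => by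
    filter_upwards [eventually_ge_atTop (max k (n₀ k))] with n hn
    exact Nat.le_findGreatest ((le_max_left _ _).trans hn) ((le_max_right _ _).trans hn)
  refine ⟨K, tendsto_atTop.2 hge, fun k₀ => ?_⟩
  filter_upwards [hge k₀, eventually_ge_atTop (n₀ 0)] with n h1 h2
  refine ⟨h1, hn₀ _ _ ?_⟩
  -- `Nat.findGreatest` returns 0 when nothing qualifies, so the threshold of index 0 must have been
  -- passed.
  exact Nat.findGreatest_spec (P := Q n) (m := 0) (Nat.zero_le n) h2

theorem mainTheorem2 (ω₀ : Plane → ℝ)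
    (hω₁ : MemLp ω₀ 1 volume) (hω₂ : MemLp ω₀ ⊤ volume)
    (η : ℝ → Plane ≃ₜ Plane) (hη : IsEulerFlow ω₀ η)
    (q₀ : ℕ → SignedMeasure Plane)
    (hweak : WeaklyConvergesTo q₀ ω₀)
    (hvar : Tendsto (fun n => (q₀ n).totalVariation Set.univ) atTop (𝓝 (eLpNorm ω₀ 1 volume)))
    (T : ℝ) (hT : 0 < T) :
    ∃ α : ℕ → ℝ, (∀ n, 0 < α n) ∧ Tendsto α atTop (𝓝 0) ∧
      (∀ n, ∃! ζ : ℝ → Plane ≃ₜ Plane, IsBlobFlow (α n) (q₀ n) ζ) ∧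
      ∀ ηα : ℕ → ℝ → Plane ≃ₜ Plane, (∀ n, IsBlobFlow (α n) (q₀ n) (ηα n)) →
        Tendsto (fun n => ⨆ t ∈ Set.Icc (0 : ℝ) T, ⨆ x : Plane, ‖ηα n t x - η t x‖ₑ)
          atTop (𝓝 0) := by
  have hω : Integrable ω₀ := memLp_one_iff_integrable.1 hω₁
  have hfp := isFiniteMeasure_vortPos hω
  have hfn := isFiniteMeasure_vortNeg hω
  obtain ⟨X, V, hX0, hXη, hV, hX⟩ := hη.exists_disp hω₁ hω₂
  have hpair := pairConverges_of_weaklyConvergesTo hω₁ hweak hvar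
  set β : ℕ → ℝ := fun j => 1 / ((j : ℝ) + 1) with hβ
  have hβpos : ∀ j, 0 < β j := fun j => by simp only [hβ]; positivity
  have hβ0 : Tendsto β atTop (𝓝 0) := tendsto_one_div_add_atTop_nhds_zero_nat
  -- The tolerance is the blob size `β j` itself, so a single null sequence controls both the
  -- regularization and the distance to the blob flow of ω₀.
  obtain ⟨K, hK, hKP⟩ := exists_diagonal (P := fun j n => ∀ t ∈ Set.Icc 0 T,
    ‖blobFlowDisp (hβpos j) (posPartMeasure (q₀ n)) (negPartMeasure (q₀ n)) t -
      blobFlowDisp (hβpos j) (vortPos ω₀) (vortNeg ω₀) t‖ ≤ β j)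
    (fun j => hpair.disp_uniform (admissibleKernel_blobDisp (hβpos j))
      (tendsto_blobDisp_cocompact (hβpos j)) hT (hβpos j))
  refine ⟨fun n => β (K n), fun n => hβpos _, hβ0.comp hK,
    fun n => existsUnique_isBlobFlow (hβpos _) _, fun ηα hηα => ?_⟩
  rw [ENNReal.tendsto_nhds_zero]
  intro ε hε
  obtain ⟨e, he0, heε⟩ : ∃ e : ℝ, 0 < e ∧ ENNReal.ofReal e ≤ ε := by
    obtain ⟨r, hr0, hr⟩ := ENNReal.lt_iff_exists_nnreal_btwn.1 hε
    exact ⟨r, by exact_mod_cast hr0, by simpa using hr.le⟩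
  have hEuler := blobFlowDisp_tendsto_euler hω₁ hω₂ hη hX0 hXη hV hX hβpos hβ0 T (half_pos he0)
  have hβe : ∀ᶠ j in atTop, β j ≤ e / 2 := hβ0.eventually (Iic_mem_nhds (half_pos he0))
  filter_upwards [hKP 0, hK.eventually hEuler, hK.eventually hβe] with n h1 h2 h3
  refine iSup₂_le fun t ht => iSup_le fun x => le_trans ?_ heε
  rw [← ofReal_norm]
  refine ENNReal.ofReal_le_ofReal ?_
  rw [(hηα n).eq_blobFlow (hβpos (K n)), blobFlow_apply, ← hXη]
  set Y := blobFlowDisp (hβpos (K n)) (posPartMeasure (q₀ n)) (negPartMeasure (q₀ n)) t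
  have h4 : ‖Y - X t‖ ≤ e := by
    have h5 := norm_sub_le_norm_sub_add_norm_sub Y
      (blobFlowDisp (hβpos (K n)) (vortPos ω₀) (vortNeg ω₀) t) (X t)
    have h6 := h1.2 t ht
    have h7 := h2 t ht
    linarith
  refine le_trans (le_of_eq ?_) (((Y - X t).norm_coe_le_norm x).trans h4)
  simp
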